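/- **Setting.** Index the positions of a triangle with $n$ rows by $(i,j)$, $1\le j\le i\le n$ (row $i$ from the top, $j$-th entry in the row). The SW and SE neighbours of $(i,j)$ are $(i+1,j)$ and $(i+1,j+1)$. The $k$-th NE-diagonal consists of the positions $(i,k)$; the $k$-th SE-diagonal consists of the positions $(i,j)$ with $n+j-i=k$. The bottom entry of a diagonal is its entry in the lowest row. Let $n,l,r\ge 0$ with $l+r\le n$, and let $\mathbf s=(s_1,\dots,s_l)$ be a weakly decreasing and $\mathbf t=(t_{n-r+1},\dots,t_n)$ a weakly increasing sequence of non-negative integers. Delete from the triangle the bottom $s_i$ entries of the $i$-th NE-diagonal ($1\le i\le l$) and the bottom $t_i$ entries of the $i$-th SE-diagonal ($n-r+1\le i\le n$). We assume that the two families of deletions do not interfere: with $s_i=0$ for $i>l$, the positions $(n-s_i,i)$ for $1\le i\le n-r$ and $(n-t_i,i-t_i)$ for $n-r+1\le i\le n$ are $n$ distinct positions of the remaining shape (equivalently, every row keeps at least one entry). An *$(\mathbf s,\mathbf t)$-tree of order $n$* is an integer array $M=(m_{i,j})$ on the remaining shape such that, calling an entry *regular* if both its SW and its SE neighbour remain,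 $m_{i+1,j}\le m_{i,j}\le m_{i+1,j+1}$ for each regular $m_{i,j}$, and two adjacent regular entries $m_{i,j},m_{i,j+1}$ are distinct. Put $$\operatorname{inv}(M)=\#\{m_{i,j}\text{ regular}: m_{i,j}=m_{i+1,j+1}\},\qquad \operatorname{inv}'(M)=\#\{m_{i,j}\text{ regular}: m_{i,j}=m_{i+1,j}\}.$$ For $J\subseteq\{j: n-r+1\le j<n,\ t_j<t_{j+1}\}\cup\{n\}$ let $\operatorname{inv}_J(M)$ count only those entries in $\operatorname{inv}(M)$ for which $m_{i+1,j+1}$ is not the bottom entry of a SE-diagonal with number in $J$; for $I\subseteq\{1\}\cup\{i: 2\le i\le l,\ s_{i-1}>s_i\}$ let $\operatorname{inv}'_I(M)$ count only those entries in $\operatorname{inv}'(M)$ for which $m_{i+1,j}$ is not the bottom entry of a NE-diagonal with number in $I$. Let $R$ be a commutative $\mathbb Q$-algebra and $u,v\in R$ (for instance indeterminates, $R=\mathbb Q[u,v]$). On polynomials over $R$ let $\operatorname{E}_xp(x)=p(x+1)$, $\overline\Delta_x=\operatorname{E}_x-\operatorname{Id}$, $\underline\Delta_x=\operatorname{Id}-\operatorname{E}_x^{-1}$,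 $$\operatorname{Strict}_{x,y}=u\operatorname{E}_y+v\operatorname{E}_x^{-1}+(1-u-v)\operatorname{E}_x^{-1}\operatorname{E}_y,$$ $$\overline\Delta[v]_x=(1+(1-v)\overline\Delta_x)^{-1}\overline\Delta_x,\qquad \underline\Delta[u]_x=(1+(u-1)\underline\Delta_x)^{-1}\underline\Delta_x$$ (the inverses exist since $\overline\Delta_x,\underline\Delta_x$ are locally nilpotent on polynomials). Put $$M_n(u,v,\mathbf x)=\prod_{1\le p<q\le n}\operatorname{Strict}_{x_q,x_p}\ \prod_{1\le i<j\le n}\frac{x_j-x_i+j-i}{j-i},$$ and, for $n\ge1$ and integers $\min\le a\le\max$, $$M_{n,a,\min,\max}(u,v,\mathbf x)=\prod_{1\le p<q\le n}\operatorname{Strict}_{x_q,x_p}\ \sum_{b=0}^{\max-\min}(-1)^{a+\min+b}\binom{b}{a-\min}\det_{1\le i,j\le n}\left(\binom{x_i+i-\min-1}{j-1+b[j=n]}\right),$$ where $[j=n]$ is $1$ if $j=n$ and $0$ otherwise. **Theorem.** Let $b_1<b_2<\dots<b_n$ be integers; if $u=v=1$, it suffices that $b_1\le b_2\le\dots\le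 b_n$. Let $\mathcal T$ be the set of $(\mathbf s,\mathbf t)$-trees of order $n$ in which the bottom entry of the $i$-th NE-diagonal is $b_i$ for $1\le i\le n-r$, and the bottom entry of the $i$-th SE-diagonal is $b_i$ for $n-r+1\le i\le n$. Then $\mathcal T$ is finite and the following hold. 1. $\sum_{M\in\mathcal T}u^{\operatorname{inv}(M)}v^{\operatorname{inv}'(M)}$ is the evaluation at $\mathbf x=(b_1,\dots,b_n)$ of $$(-\overline\Delta[v]_{x_1})^{s_1}\cdots(-\overline\Delta[v]_{x_l})^{s_l}\ \underline\Delta[u]_{x_{n-r+1}}^{t_{n-r+1}}\cdots\underline\Delta[u]_{x_n}^{t_n}\,M_n(u,v,\mathbf x).\qquad(*)$$ 2. For all $I,J$ as above, $\sum_{M\in\mathcal T}u^{\operatorname{inv}_J(M)}v^{\operatorname{inv}'_I(M)}$ is the evaluation at $\mathbf x=(b_1,\dots,b_n)$ of the polynomial obtained from $(*)$ by applying $$\prod_{i\in I}(1+(1-v)\overline\Delta_{x_i})^{-1}\prod_{j\in J}(1+(u-1)\underline\Delta_{x_j})^{-1}.$$ 3. Let $n\ge1$ and let $\min\le a\le\max$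 be integers with $\min\le b_1$ and $b_n\le\max$. Then 1 remains true if the sum is restricted to the trees $M\in\mathcal T$ with top entry $m_{1,1}=a$ and $M_n(u,v,\mathbf x)$ is replaced by $M_{n,a,\min,\max}(u,v,\mathbf x)$. The same holds for 2 provided that the top entry is not the bottom entry of an exceptional diagonal, that is: if $1\in I$, then $v=1$ or $m_{1,1}$ is not the bottom entry of the first NE-diagonal; and if $n\in J$, then $u=1$ or $m_{1,1}$ is not the bottom entry of the $n$-th SE-diagonal. -/

import Mathlib

/-! Polynomials in the variables `x₁, x₂, …` over a commutative `ℚ`-algebra `R` are elements of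
`MvPolynomial ℕ R`; an expression in `x₁, …, xₙ` uses the variables `X 1, …, X n` only.
All sequences and arrays are indexed from `1`, as on paper. -/

namespace STTrees

open MvPolynomial

section Operators

variable {R : Type*} [CommRing R]

/-- The shift `p(xᵢ) ↦ p(xᵢ + c)` in the variable `xᵢ`. -/
noncomputable def shift (c : R) (i : ℕ) : Module.End R (MvPolynomial ℕ R) :=
  (aeval (Function.update X i (X i + C c)) :
    MvPolynomial ℕ R →ₐ[R] MvPolynomial ℕ R).toLinearMap

/-- The shift operator `E` in the variable `xᵢ`. -/
noncomputable def shiftE (i : ℕ) : Module.End R (MvPolynomial ℕ R) := shift 1 i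

/-- The inverse `E⁻¹` of the shift operator in the variable `xᵢ`. -/
noncomputable def shiftEInv (i : ℕ) : Module.End R (MvPolynomial ℕ R) := shift (-1) i

/-- The forward difference `E - Id` in the variable `xᵢ`. -/
noncomputable def fwdDiff (i : ℕ) : Module.End R (MvPolynomial ℕ R) := shiftE i - 1

/-- The backward difference `Id - E⁻¹` in the variable `xᵢ`. -/
noncomputable def bwdDiff (i : ℕ) : Module.End R (MvPolynomial ℕ R) := 1 - shiftEInv i

/-- `Strict` with respect to the variables `x = xᵢ`, `y = xⱼ`:
`u E_y + v E_x⁻¹ + (1 - u - v) E_x⁻¹ E_y`. -/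
noncomputable def strictOp (u v : R) (i j : ℕ) : Module.End R (MvPolynomial ℕ R) :=
  u • shiftE j + v • shiftEInv i + (1 - u - v) • (shiftEInv i * shiftE j)

theorem shift_sub_one_X_mul (c : R) (i j : ℕ) :
    ∃ d : R, ∀ p : MvPolynomial ℕ R, (shift c i - 1) (X j * p) =
      X j * (shift c i - 1) p + d • (shift c i - 1) p + d • p := by
  by_cases hj : j = i
  · subst hj
    refine ⟨c, fun p => ?_⟩
    simp only [shift, LinearMap.sub_apply, AlgHom.toLinearMap_apply, map_mul, aeval_X,
      Function.update_self, Module.End.one_apply, MvPolynomial.smul_eq_C_mul]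
    ring
  · refine ⟨0, fun p => ?_⟩
    simp only [shift, LinearMap.sub_apply, AlgHom.toLinearMap_apply, map_mul, aeval_X,
      Function.update_of_ne hj, Module.End.one_apply, zero_smul]
    ring

theorem shift_sub_one_pow_X_mul (c : R) (i j k : ℕ) (p : MvPolynomial ℕ R)
    (hp : ((shift c i - 1) ^ k) p = 0) : ((shift c i - 1) ^ (k + 1)) (X j * p) = 0 := by
  obtain ⟨d, hd⟩ := shift_sub_one_X_mul c i j
  induction k generalizing p with
  | zero => simp only [pow_zero, Module.End.one_apply] at hp; simp [hp]
  | succ k ih =>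
    have h1 : ((shift c i - 1) ^ k) ((shift c i - 1) p) = 0 := by
      rwa [pow_succ, Module.End.mul_apply] at hp
    have h2 : ((shift c i - 1) ^ (k + 1)) ((shift c i - 1) p) = 0 := by
      rw [pow_succ', Module.End.mul_apply, h1, map_zero]
    rw [pow_succ, Module.End.mul_apply, hd, map_add, map_add, map_smul, map_smul, ih _ h1, h2, hp]
    simp

/-- Every polynomial is annihilated by a sufficiently high power of a difference operator. -/
theorem exists_shift_sub_one_pow_eq_zero (c : R) (i : ℕ) (p : MvPolynomial ℕ R) :
    ∃ k : ℕ, ((shift c i - 1) ^ k) p = 0 := by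
  have mono : ∀ (q : MvPolynomial ℕ R) (k m : ℕ), ((shift c i - 1) ^ k) q = 0 →
      ((shift c i - 1) ^ (k + m)) q = 0 := by
    intro q k m h
    rw [add_comm, pow_add, Module.End.mul_apply, h, map_zero]
  induction p using MvPolynomial.induction_on with
  | C a => exact ⟨1, by simp [shift]⟩
  | add p q hp hq =>
    obtain ⟨k, hk⟩ := hp
    obtain ⟨m, hm⟩ := hq
    refine ⟨k + m, ?_⟩
    rw [map_add, mono p k m hk, add_comm k m, mono q m k hm, add_zero]
  | mul_X p j hp =>
    obtain ⟨k, hk⟩ := hp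
    exact ⟨k + 1, by rw [mul_comm]; exact shift_sub_one_pow_X_mul c i j k p hk⟩

theorem isUnit_one_add_smul (a c : R) (i : ℕ) :
    IsUnit (1 + a • (shift c i - 1) : Module.End R (MvPolynomial ℕ R)) := by
  set g : Module.End R (MvPolynomial ℕ R) := (-a) • (shift c i - 1) with hg
  have hpow : ∀ p : MvPolynomial ℕ R, ∃ k : ℕ, (g ^ k) p = 0 := by
    intro p
    obtain ⟨k, hk⟩ := exists_shift_sub_one_pow_eq_zero c i p
    refine ⟨k, ?_⟩
    rw [hg, smul_pow, LinearMap.smul_apply, hk, smul_zero]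
  have h1 : 1 + a • (shift c i - 1) = 1 - g := by rw [hg]; module
  rw [h1, Module.End.isUnit_iff]
  constructor
  · rw [injective_iff_map_eq_zero]
    intro p hp
    obtain ⟨k, hk⟩ := hpow p
    have h := congrArg (fun f : Module.End R (MvPolynomial ℕ R) => f p) (geom_sum_mul_neg g k)
    simp only [Module.End.mul_apply, hp, map_zero, LinearMap.sub_apply, Module.End.one_apply,
      hk, sub_zero] at h
    exact h.symm
  · intro p
    obtain ⟨k, hk⟩ := hpow p
    have h := congrArg (fun f : Module.End R (MvPolynomial ℕ R) => f p) (mul_neg_geom_sum g k)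
    simp only [Module.End.mul_apply, LinearMap.sub_apply, Module.End.one_apply,
      hk, sub_zero] at h
    exact ⟨_, h⟩

theorem isUnit_fwd (v : R) (i : ℕ) :
    IsUnit (1 + (1 - v) • fwdDiff i : Module.End R (MvPolynomial ℕ R)) :=
  isUnit_one_add_smul (1 - v) 1 i

theorem isUnit_bwd (u : R) (i : ℕ) :
    IsUnit (1 + (u - 1) • bwdDiff i : Module.End R (MvPolynomial ℕ R)) := by
  have h := isUnit_one_add_smul (1 - u) (-1 : R) i
  have e : (1 + (u - 1) • bwdDiff i : Module.End R (MvPolynomial ℕ R)) =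
      1 + (1 - u) • (shift (-1) i - 1) := by
    unfold bwdDiff shiftEInv
    module
  rw [e]
  exact h

/-- `(1 + (1 - v) Δ)⁻¹`, with `Δ` the forward difference in `xᵢ`. -/
noncomputable def fwdInv (v : R) (i : ℕ) : Module.End R (MvPolynomial ℕ R) :=
  ((isUnit_fwd v i).unit⁻¹ : (Module.End R (MvPolynomial ℕ R))ˣ)

/-- `(1 + (u - 1) Δ)⁻¹`, with `Δ` the backward difference in `xᵢ`. -/
noncomputable def bwdInv (u : R) (i : ℕ) : Module.End R (MvPolynomial ℕ R) :=
  ((isUnit_bwd u i).unit⁻¹ : (Module.End R (MvPolynomial ℕ R))ˣ)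

/-- The `v`-forward difference operator in `xᵢ`. -/
noncomputable def vFwdDiff (v : R) (i : ℕ) : Module.End R (MvPolynomial ℕ R) :=
  fwdInv v i * fwdDiff i

/-- The `u`-backward difference operator in `xᵢ`. -/
noncomputable def uBwdDiff (u : R) (i : ℕ) : Module.End R (MvPolynomial ℕ R) :=
  bwdInv u i * bwdDiff i

/-- The composition `f a ∘ f (a+1) ∘ ⋯ ∘ f (a+k-1)`. It is used only for operators that commute
with one another, so the order is immaterial. -/
noncomputable def opProd (a k : ℕ) (f : ℕ → Module.End R (MvPolynomial ℕ R)) :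
    Module.End R (MvPolynomial ℕ R) :=
  ((List.range' a k).map f).prod

/-- `∏_{1 ≤ p < q ≤ n} Strict_{x_q, x_p}`. -/
noncomputable def strictProd (u v : R) (n : ℕ) : Module.End R (MvPolynomial ℕ R) :=
  opProd 1 n fun q => opProd 1 (q - 1) fun p => strictOp u v q p

/-- The operator
`(-Δ[v]_{x₁})^{s₁} ⋯ (-Δ[v]_{x_l})^{s_l} Δ[u]_{x_{n-r+1}}^{t_{n-r+1}} ⋯ Δ[u]_{x_n}^{t_n}`
(forward differences with `v`, backward differences with `u`). -/
noncomputable def truncOp (u v : R) (n l r : ℕ) (s t : ℕ → ℕ) :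
    Module.End R (MvPolynomial ℕ R) :=
  opProd 1 l (fun i => (-vFwdDiff v i) ^ s i) *
    opProd (n - r + 1) r (fun j => uBwdDiff u j ^ t j)

/-- `∏_{i ∈ I} (1 + (1 - v) Δ_{x_i})⁻¹ ∏_{j ∈ J} (1 + (u - 1) Δ_{x_j})⁻¹` for
`I, J ⊆ {1, …, n}` (forward differences for `I`, backward differences for `J`). -/
noncomputable def excOp (u v : R) (n : ℕ) (I J : Finset ℕ) :
    Module.End R (MvPolynomial ℕ R) :=
  opProd 1 n (fun i => if i ∈ I then fwdInv v i else 1) *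
    opProd 1 n (fun j => if j ∈ J then bwdInv u j else 1)

end Operators

section Polynomials

variable (R : Type*) [CommRing R] [Algebra ℚ R]

/-- `∏_{1 ≤ i < j ≤ n} (x_j - x_i + j - i) / (j - i)`. -/
noncomputable def GT (n : ℕ) : MvPolynomial ℕ R :=
  ∏ j ∈ Finset.Icc 1 n, ∏ i ∈ Finset.Ico 1 j,
    ((j : ℚ) - (i : ℚ))⁻¹ • (X j - X i + (j : MvPolynomial ℕ R) - (i : MvPolynomial ℕ R))

variable {R}

/-- The binomial coefficient `y (y - 1) ⋯ (y - k + 1) / k!` of a polynomial `y`. -/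
noncomputable def binom (y : MvPolynomial ℕ R) (k : ℕ) : MvPolynomial ℕ R :=
  (k.factorial : ℚ)⁻¹ • ∏ m ∈ Finset.range k, (y - (m : MvPolynomial ℕ R))

variable (R)

/-- `∑_{b=0}^{max-min} (-1)^{a+min+b} (b choose a-min)
det_{1 ≤ i, j ≤ n} ((x_i + i - min - 1) choose (j - 1 + b [j = n]))`, for `min ≤ a ≤ max`.
The indices `i, j : Fin n` stand for `i + 1`, `j + 1`. -/
noncomputable def GTTop (n : ℕ) (a mn mx : ℤ) : MvPolynomial ℕ R :=
  ∑ b ∈ Finset.range ((mx - mn).toNat + 1),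
    ((((a + mn + b).negOnePow : ℤˣ) : ℤ) * (b.choose (a - mn).toNat : ℤ)) •
      (Matrix.of fun i j : Fin n =>
        binom (X ((i : ℕ) + 1) + ((((i : ℕ) + 1 : ℤ) - mn - 1 : ℤ) : MvPolynomial ℕ R))
          ((j : ℕ) + if (j : ℕ) + 1 = n then b else 0)).det

variable {R}

/-- `M_n(u, v, x)`. -/
noncomputable def MPoly (u v : R) (n : ℕ) : MvPolynomial ℕ R :=
  strictProd u v n (GT R n)

/-- `M_{n, a, min, max}(u, v, x)`. -/
noncomputable def MTopPoly (u v : R) (n : ℕ) (a mn mx : ℤ) : MvPolynomial ℕ R :=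
  strictProd u v n (GTTop R n a mn mx)

/-- Evaluation at `x_i = b_i`. -/
noncomputable def evalAt (b : ℕ → ℤ) (p : MvPolynomial ℕ R) : R :=
  MvPolynomial.eval (fun i => (b i : R)) p

end Polynomials

section Trees

/-- The positions `(i, j)` (row, column) of an `(s,t)`-tree of order `n`, with
`s = (s_1, …, s_l)` and `t = (t_{n-r+1}, …, t_n)`. The full triangle is `1 ≤ j ≤ i ≤ n`. The `j`-th
NE-diagonal is column `j`; the entries `(i, j)` with `i > n - s_j` are deleted for `j ≤ l`.
The position `(i, j)` is on the SE-diagonal number `k = n + j - i`; it is deleted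
if `k > n - r` and `i > n - t_k`. -/
def shape (n l r : ℕ) (s t : ℕ → ℕ) : Finset (ℕ × ℕ) :=
  (Finset.Icc 1 n ×ˢ Finset.Icc 1 n).filter fun p =>
    p.2 ≤ p.1 ∧ (p.2 ≤ l → p.1 + s p.2 ≤ n) ∧
      (n - r < n + p.2 - p.1 → p.1 + t (n + p.2 - p.1) ≤ n)

/-- `(i, j)` is the bottom entry of the `k`-th NE-diagonal. -/
def IsBottomNE (n l r : ℕ) (s t : ℕ → ℕ) (k i j : ℕ) : Prop :=
  (i, j) ∈ shape n l r s t ∧ j = k ∧ ∀ i', (i', k) ∈ shape n l r s t → i' ≤ i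

/-- `(i, j)` is the bottom entry of the `k`-th SE-diagonal. -/
def IsBottomSE (n l r : ℕ) (s t : ℕ → ℕ) (k i j : ℕ) : Prop :=
  (i, j) ∈ shape n l r s t ∧ n + j = k + i ∧
    ∀ i' j', (i', j') ∈ shape n l r s t → n + j' = k + i' → i' ≤ i

/-- The `i`-th position whose entry is prescribed: for `i ≤ n - r` where the `i`-th NE-diagonal ends
after the deletion of its bottom `s_i` entries (none if `i > l`), and for `i > n - r`
where the `i`-th SE-diagonal ends after the deletion of its bottom `t_i` entries. -/
def endPos (n l r : ℕ) (s t : ℕ → ℕ) (i : ℕ) : ℕ × ℕ :=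
  if i ≤ n - r then (n - (if i ≤ l then s i else 0), i) else (n - t i, i - t i)

/-- The deletions prescribed by `s` do not interfere with those prescribed by `t`: each of the `n`
truncated diagonals ends in an entry of the array (the ends are not deleted by the other
family), and these `n` entries are distinct. -/
def NoInterference (n l r : ℕ) (s t : ℕ → ℕ) : Prop :=
  (∀ i ∈ Finset.Icc 1 n, endPos n l r s t i ∈ shape n l r s t) ∧
    Set.InjOn (endPos n l r s t) (Set.Icc 1 n)

/-- `(i, j)` is a regular position: it has a SW neighbour and a SE neighbour. -/
def IsRegular (n l r : ℕ) (s t : ℕ → ℕ) (i j : ℕ) : Prop :=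
  (i, j) ∈ shape n l r s t ∧ (i + 1, j) ∈ shape n l r s t ∧ (i + 1, j + 1) ∈ shape n l r s t

/-- `M` is an `(s,t)`-tree of order `n`. An array on the shape is encoded as a function on all pairs
that vanishes off the shape. -/
structure IsTree (n l r : ℕ) (s t : ℕ → ℕ) (M : ℕ → ℕ → ℤ) : Prop where
  eq_zero : ∀ i j, (i, j) ∉ shape n l r s t → M i j = 0
  le_left : ∀ i j, IsRegular n l r s t i j → M (i + 1) j ≤ M i j
  le_right : ∀ i j, IsRegular n l r s t i j → M i j ≤ M (i + 1) (j + 1)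
  distinct : ∀ i j, IsRegular n l r s t i j → IsRegular n l r s t i (j + 1) →
    M i j ≠ M i (j + 1)

/-- The `(s,t)`-trees of order `n` such that the bottom entry of the `k`-th NE-diagonal is `b_k` for
`1 ≤ k ≤ n - r` and that of the `k`-th SE-diagonal is `b_k` for `n - r + 1 ≤ k ≤ n`. -/
def trees (n l r : ℕ) (s t : ℕ → ℕ) (b : ℕ → ℤ) : Set (ℕ → ℕ → ℤ) :=
  {M | IsTree n l r s t M ∧
    (∀ k i j, 1 ≤ k → k ≤ n - r → IsBottomNE n l r s t k i j → M i j = b k) ∧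
    (∀ k i j, n - r + 1 ≤ k → k ≤ n → IsBottomSE n l r s t k i j → M i j = b k)}

open Classical in
/-- The number of regular entries equal to their SE neighbour. -/
noncomputable def inv (n l r : ℕ) (s t : ℕ → ℕ) (M : ℕ → ℕ → ℤ) : ℕ :=
  ((shape n l r s t).filter fun p =>
    IsRegular n l r s t p.1 p.2 ∧ M p.1 p.2 = M (p.1 + 1) (p.2 + 1)).card

open Classical in
/-- The number of regular entries equal to their SW neighbour. -/
noncomputable def inv' (n l r : ℕ) (s t : ℕ → ℕ) (M : ℕ → ℕ → ℤ) : ℕ :=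
  ((shape n l r s t).filter fun p =>
    IsRegular n l r s t p.1 p.2 ∧ M p.1 p.2 = M (p.1 + 1) p.2).card

open Classical in
/-- The number of regular entries equal to their SE neighbour, where the SE neighbour is not the
bottom entry of a SE-diagonal with number in `J`. -/
noncomputable def invExc (n l r : ℕ) (s t : ℕ → ℕ) (J : Finset ℕ) (M : ℕ → ℕ → ℤ) : ℕ :=
  ((shape n l r s t).filter fun p =>
    IsRegular n l r s t p.1 p.2 ∧ M p.1 p.2 = M (p.1 + 1) (p.2 + 1) ∧
      ¬ ∃ k ∈ J, IsBottomSE n l r s t k (p.1 + 1) (p.2 + 1)).card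

open Classical in
/-- The number of regular entries equal to their SW neighbour, where the SW neighbour is not the
bottom entry of a NE-diagonal with number in `I`. -/
noncomputable def invExc' (n l r : ℕ) (s t : ℕ → ℕ) (I : Finset ℕ) (M : ℕ → ℕ → ℤ) : ℕ :=
  ((shape n l r s t).filter fun p =>
    IsRegular n l r s t p.1 p.2 ∧ M p.1 p.2 = M (p.1 + 1) p.2 ∧
      ¬ ∃ k ∈ I, IsBottomNE n l r s t k (p.1 + 1) p.2).card

/-- `I ⊆ {1} ∪ {i | s_{i-1} > s_i}`. -/
def IsExcNE (l : ℕ) (s : ℕ → ℕ) (I : Finset ℕ) : Prop :=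
  ∀ i ∈ I, i = 1 ∨ (2 ≤ i ∧ i ≤ l ∧ s (i - 1) > s i)

/-- `J ⊆ {j | t_j < t_{j+1}} ∪ {n}`. -/
def IsExcSE (n r : ℕ) (t : ℕ → ℕ) (J : Finset ℕ) : Prop :=
  ∀ j ∈ J, (n - r + 1 ≤ j ∧ j + 1 ≤ n ∧ t j < t (j + 1)) ∨ j = n

end Trees

end STTrees

namespace STTrees

open MvPolynomial

/-! ### A commutative algebra of operators, changes of variables, evaluation -/

section Operators

variable {R : Type*} [CommRing R]

/-! The trees are counted row by row. Row N is completed to a sequence z_1, …, z_N: the places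
deleted at its two ends hold the prescribed bottom entries of diagonals that have already ended. A
row x above z then agrees with z at the left end, agrees with z moved by one place at the right end,
and interlaces with z in the `width` free places between (`box`). The factors u, v and the ban on
equal neighbours involve only z and x, so the weighted count `treeSum` obeys a recursion in N. It
has to be shown that the polynomials `treePoly`, built from the operators of the first N rows, the
Strict product and a determinant `detD` of binomials, obey the same recursion at the relevant
integer points.

Write P_i = v + (1 - v) E_i and Q_i = u + (1 - u) E_i⁻¹ (`opP`, `opQ`); these are the operators that
get inverted. The Gelfand–Tsetlin product is a Vandermonde determinant in binomial form. Expanding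
it along its column of ones gives an alternating sum over r of polynomials that lack x_r. On such a
polynomial Strict_{x_r, x_p} acts as P_p, Strict_{x_q, x_r} acts as Q_q, and a difference in x_r
gives zero. Hence a factor -P_j⁻¹ Δ_j at the left end kills the term r = j and turns P_j into -Δ_j
in the surviving terms; the right end is similar. A further P⁻¹ or Q⁻¹, coming from an exceptional
entry, cancels the outermost remaining P or Q, which replaces v or u by 1 for that entry. What is
left is an alternating sum `phi` over the free range only, applied to an antidifference `antiPoly`
of the polynomial with one row less (`treePoly_succ`, `fwdProd_smul_antiPoly`).

It remains to see that `phi` computes the weighted sum over one row (`rowSum_eq_phi_of_strict`). By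
induction on the number of free entries, the sum over the last one telescopes. Its lower boundary
term is Strict_{x_j, x_{j+1}} of the previous `phi` on the diagonal x_j = x_{j+1}. One part vanishes
there, because Strict_{x_j, x_{j+1}} E_{x_j} makes the polynomial antisymmetric (`Anti`,
`anti_opStrictProd_detC`); the other part is the next term of the alternating sum. The argument
lowers bounds by one and so needs strictly increasing z. For u = v = 1 and weakly increasing z it is
replaced by inclusion–exclusion over the last two free entries, together with the fact that no tree
has three equal consecutive entries in the undeleted part of its bottom row
(`rowSum_eq_phi_of_weak`, `treeSum_eq_zero_of_triple`).

For a prescribed top entry, raising the lower index in the last column by d only changes the weight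
of a one-row tree from 1 to (x - min choose d); binomial inversion over d then isolates x = a
(`sum_topWeight`). -/

theorem shift_commute (c d : R) (i j : ℕ) : shift c i * shift d j = shift d j * shift c i := by
  have h : ((aeval (Function.update X i (X i + C c)) :
      MvPolynomial ℕ R →ₐ[R] MvPolynomial ℕ R).comp
        (aeval (Function.update X j (X j + C d)))) =
      ((aeval (Function.update X j (X j + C d)) :
      MvPolynomial ℕ R →ₐ[R] MvPolynomial ℕ R).comp
        (aeval (Function.update X i (X i + C c)))) := by
    ext k : 1
    by_cases hi : k = i <;> by_cases hj : k = j <;>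
      · simp only [AlgHom.comp_apply, aeval_X, Function.update_apply, hi, hj, if_true, if_false,
          map_add, algHom_C, algebraMap_eq]
        try split_ifs <;> simp_all [add_right_comm]
  exact congrArg AlgHom.toLinearMap h

/-- The shift operators, as a set. -/
def shiftSet (R : Type*) [CommRing R] : Set (Module.End R (MvPolynomial ℕ R)) :=
  {a | ∃ c i, a = shift c i}

/-- The double centralizer of the shift operators. -/
noncomputable def opAlg (R : Type*) [CommRing R] :
    Subalgebra R (Module.End R (MvPolynomial ℕ R)) :=
  Subalgebra.centralizer R (Set.centralizer (shiftSet R))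

/-- A commutative algebra of operators that contains the shifts and is closed under inverses. -/
abbrev Op (R : Type*) [CommRing R] := ↥(opAlg R)

/-- The shifts commute with one another, so their double centralizer is commutative. Finite products
and `ring` thereby become available for all operators that occur. -/
theorem op_comm (a b : Op R) : a * b = b * a := by
  apply Subtype.ext
  refine Set.centralizer_centralizer_comm_of_comm (S := shiftSet R) ?_ _ a.2 _ b.2
  rintro _ ⟨c, i, rfl⟩ _ ⟨d, j, rfl⟩
  exact shift_commute c d i j

noncomputable instance : CommRing (Op R) :=
  { (inferInstance : Ring (Op R)) with mul_comm := op_comm }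

noncomputable instance : Algebra R (Op R) := inferInstanceAs (Algebra R (opAlg R))

theorem op_smul (a : Op R) (p : MvPolynomial ℕ R) :
    a • p = (a : Module.End R (MvPolynomial ℕ R)) p := rfl

/-- Whatever commutes with a commutes with its inverse; so the inverted operators join the
commutative algebra without a series expansion. -/
theorem inv_mem_opAlg {a b : Module.End R (MvPolynomial ℕ R)} (ha : a ∈ opAlg R)
    (hab : a * b = 1) (hba : b * a = 1) : b ∈ opAlg R := by
  intro z hz
  have h := ha z hz
  calc z * b = (b * a) * z * b := by rw [hba, one_mul]
    _ = b * (z * a) * b := by rw [h, mul_assoc b a z]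
    _ = b * z * (a * b) := by simp only [mul_assoc]
    _ = b * z := by rw [hab, mul_one]

/-- The shift `p(xᵢ) ↦ p(xᵢ + c)`. -/
noncomputable def sh (c : R) (i : ℕ) : Op R :=
  ⟨shift c i, fun _ hz => (hz _ ⟨c, i, rfl⟩).symm⟩

/-- The forward difference. -/
noncomputable def fwd (i : ℕ) : Op R := sh 1 i - 1

/-- The backward difference. -/
noncomputable def bwd (i : ℕ) : Op R := 1 - sh (-1) i

/-- `v + (1 - v) E`. -/
noncomputable def opP (v : R) (i : ℕ) : Op R := 1 + (1 - v) • fwd i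

/-- `u + (1 - u) E⁻¹`. -/
noncomputable def opQ (u : R) (i : ℕ) : Op R := 1 + (u - 1) • bwd i

theorem fwdInv_mem (v : R) (i : ℕ) : fwdInv v i ∈ opAlg R := by
  refine inv_mem_opAlg (a := 1 + (1 - v) • fwdDiff i) (opP v i).2 ?_ ?_
  · exact (isUnit_fwd v i).mul_val_inv
  · exact (isUnit_fwd v i).val_inv_mul

theorem bwdInv_mem (u : R) (i : ℕ) : bwdInv u i ∈ opAlg R := by
  refine inv_mem_opAlg (a := 1 + (u - 1) • bwdDiff i) (opQ u i).2 ?_ ?_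
  · exact (isUnit_bwd u i).mul_val_inv
  · exact (isUnit_bwd u i).val_inv_mul

/-- The inverse of `opP`. -/
noncomputable def opPinv (v : R) (i : ℕ) : Op R := ⟨fwdInv v i, fwdInv_mem v i⟩

/-- The inverse of `opQ`. -/
noncomputable def opQinv (u : R) (i : ℕ) : Op R := ⟨bwdInv u i, bwdInv_mem u i⟩

theorem opP_mul_opPinv (v : R) (i : ℕ) : opP v i * opPinv v i = 1 :=
  Subtype.ext (isUnit_fwd v i).mul_val_inv

theorem opQ_mul_opQinv (u : R) (i : ℕ) : opQ u i * opQinv u i = 1 :=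
  Subtype.ext (isUnit_bwd u i).mul_val_inv

/-- `Strict_{xᵢ, xⱼ}`. -/
noncomputable def opStrict (u v : R) (i j : ℕ) : Op R :=
  u • sh 1 j + v • sh (-1) i + (1 - u - v) • (sh (-1) i * sh 1 j)

theorem sh_zero (i : ℕ) : sh (0 : R) i = 1 := by
  apply Subtype.ext
  have : (aeval (Function.update X i (X i + C (0 : R))) :
      MvPolynomial ℕ R →ₐ[R] MvPolynomial ℕ R) = AlgHom.id R _ := by
    ext k : 1
    simp
  exact congrArg AlgHom.toLinearMap this

theorem sh_mul_sh (c d : R) (i : ℕ) : sh c i * sh d i = sh (c + d) i := by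
  apply Subtype.ext
  have : (aeval (Function.update X i (X i + C c)) :
      MvPolynomial ℕ R →ₐ[R] MvPolynomial ℕ R).comp (aeval (Function.update X i (X i + C d))) =
      aeval (Function.update X i (X i + C (c + d))) := by
    ext k : 1
    by_cases h : k = i
    · subst h
      simp [add_assoc]
    · simp [Function.update_of_ne h]
  exact congrArg AlgHom.toLinearMap this

theorem sh_one_mul_sh_neg_one (i : ℕ) : sh (1 : R) i * sh (-1) i = 1 := by
  rw [sh_mul_sh, add_neg_cancel, sh_zero]

theorem bwd_mul_sh (i : ℕ) : bwd i * sh (1 : R) i = fwd i := by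
  rw [bwd, sub_mul, one_mul, mul_comm, sh_one_mul_sh_neg_one, fwd]

/-- `f` transforms the operator `a` into the operator `b`. -/
def Inter (f : ℕ → ℕ) (a b : Op R) : Prop :=
  ∀ p : MvPolynomial ℕ R, rename f (a • p) = b • rename f p

namespace Inter

variable {f : ℕ → ℕ} {a b c d : Op R}

theorem shift (hf : Function.Injective f) (c : R) (i : ℕ) : Inter f (sh c i) (sh c (f i)) := by
  intro p
  have : (rename f : MvPolynomial ℕ R →ₐ[R] MvPolynomial ℕ R).comp
      (aeval (Function.update X i (X i + C c))) =
      (aeval (Function.update X (f i) (X (f i) + C c)) :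
        MvPolynomial ℕ R →ₐ[R] MvPolynomial ℕ R).comp (rename f) := by
    ext k : 1
    by_cases h : k = i
    · subst h
      simp
    · simp [Function.update_of_ne h, Function.update_of_ne (hf.ne h)]
  exact congrArg (fun g => g p) this

theorem one : Inter f (1 : Op R) 1 := fun p => by rw [one_smul, one_smul]

theorem add (h : Inter f a b) (h' : Inter f c d) : Inter f (a + c) (b + d) := fun p => by
  rw [add_smul, add_smul, map_add, h, h']

theorem sub (h : Inter f a b) (h' : Inter f c d) : Inter f (a - c) (b - d) := fun p => by
  rw [sub_smul, sub_smul, map_sub, h, h']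

theorem neg (h : Inter f a b) : Inter f (-a) (-b) := fun p => by
  rw [neg_smul, neg_smul, map_neg, h]

theorem smul (x : R) (h : Inter f a b) : Inter f (x • a) (x • b) := fun p => by
  rw [smul_assoc, smul_assoc, map_smul, h]

theorem mul (h : Inter f a b) (h' : Inter f c d) : Inter f (a * c) (b * d) := fun p => by
  rw [mul_smul, mul_smul, h, h']

theorem prod {ι : Type*} (s : Finset ι) (x y : ι → Op R) (h : ∀ i ∈ s, Inter f (x i) (y i)) :
    Inter f (∏ i ∈ s, x i) (∏ i ∈ s, y i) := by
  classical
  induction s using Finset.induction_on with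
  | empty => simpa using Inter.one
  | insert i s hi ih =>
    rw [Finset.prod_insert hi, Finset.prod_insert hi]
    exact (h i (Finset.mem_insert_self i s)).mul
      (ih fun j hj => h j (Finset.mem_insert_of_mem hj))

/-- Uniqueness of inverses transports them along f, so no formula for them is needed. -/
theorem inv (h : Inter f a b) (hac : a * c = 1) (hbd : b * d = 1) : Inter f c d := fun p => by
  have h1 := h (c • p)
  rw [← mul_smul, hac, one_smul] at h1
  rw [h1, ← mul_smul, mul_comm, hbd, one_smul]

theorem fwd (hf : Function.Injective f) (i : ℕ) : Inter f (fwd i : Op R) (fwd (f i)) :=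
  (Inter.shift hf 1 i).sub .one

theorem bwd (hf : Function.Injective f) (i : ℕ) : Inter f (bwd i : Op R) (bwd (f i)) :=
  Inter.one.sub (Inter.shift hf (-1) i)

theorem opP (hf : Function.Injective f) (v : R) (i : ℕ) : Inter f (opP v i) (opP v (f i)) :=
  Inter.one.add ((Inter.fwd hf i).smul _)

theorem opQ (hf : Function.Injective f) (v : R) (i : ℕ) : Inter f (opQ v i) (opQ v (f i)) :=
  Inter.one.add ((Inter.bwd hf i).smul _)

theorem opPinv (hf : Function.Injective f) (v : R) (i : ℕ) :
    Inter f (opPinv v i) (opPinv v (f i)) :=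
  (Inter.opP hf v i).inv (opP_mul_opPinv v i) (opP_mul_opPinv v _)

theorem opQinv (hf : Function.Injective f) (v : R) (i : ℕ) :
    Inter f (opQinv v i) (opQinv v (f i)) :=
  (Inter.opQ hf v i).inv (opQ_mul_opQinv v i) (opQ_mul_opQinv v _)

theorem opStrict (hf : Function.Injective f) (u v : R) (i j : ℕ) :
    Inter f (opStrict u v i j) (opStrict u v (f i) (f j)) :=
  (((Inter.shift hf 1 j).smul _).add ((Inter.shift hf (-1) i).smul _)).add
    (((Inter.shift hf (-1) i).mul (Inter.shift hf 1 j)).smul _)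

end Inter

/-- The polynomial does not depend on `x_r`. -/
def IndepVar (r : ℕ) (p : MvPolynomial ℕ R) : Prop := sh (1 : R) r • p = p

namespace IndepVar

variable {r : ℕ} {p : MvPolynomial ℕ R}

theorem smul (h : IndepVar r p) (a : Op R) : IndepVar r (a • p) := by
  rw [IndepVar, ← mul_smul, mul_comm, mul_smul, h]

theorem neg_shift (h : IndepVar r p) : sh (-1 : R) r • p = p := by
  conv_lhs => rw [← h]
  rw [← mul_smul, mul_comm, sh_one_mul_sh_neg_one, one_smul]

theorem fwd (h : IndepVar r p) : (fwd r : Op R) • p = 0 := by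
  rw [STTrees.fwd, sub_smul, one_smul, h, sub_self]

theorem bwd (h : IndepVar r p) : (bwd r : Op R) • p = 0 := by
  rw [STTrees.bwd, sub_smul, one_smul, h.neg_shift, sub_self]

theorem opP (h : IndepVar r p) (v : R) : opP v r • p = p := by
  rw [STTrees.opP, add_smul, smul_assoc, h.fwd, smul_zero, add_zero, one_smul]

theorem opQ (h : IndepVar r p) (v : R) : opQ v r • p = p := by
  rw [STTrees.opQ, add_smul, smul_assoc, h.bwd, smul_zero, add_zero, one_smul]

theorem opPinv (h : IndepVar r p) (v : R) : opPinv v r • p = p := by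
  conv_lhs => rw [← h.opP v]
  rw [← mul_smul, mul_comm, opP_mul_opPinv, one_smul]

theorem opQinv (h : IndepVar r p) (v : R) : opQinv v r • p = p := by
  conv_lhs => rw [← h.opQ v]
  rw [← mul_smul, mul_comm, opQ_mul_opQinv, one_smul]

/-- Shifts in the missing variable act as the identity, so Strict collapses to u E + v + (1 - u - v)
E = v + (1 - v) E. The companion lemma for the second variable gives u + (1 - u) E⁻¹ in the same
way. -/
theorem opStrict_left (h : IndepVar r p) (u v : R) (j : ℕ) :
    opStrict u v r j • p = STTrees.opP v j • p := by
  have h1 : (sh (-1) r * sh 1 j : Op R) • p = sh (1 : R) j • p := by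
    rw [mul_comm, mul_smul, h.neg_shift]
  simp only [opStrict, STTrees.opP, STTrees.fwd, add_smul, smul_assoc, h1, h.neg_shift, sub_smul,
    one_smul]
  module

theorem opStrict_right (h : IndepVar r p) (u v : R) (i : ℕ) :
    opStrict u v i r • p = STTrees.opQ u i • p := by
  have h1 : (sh (-1) i * sh 1 r : Op R) • p = sh (-1 : R) i • p := by
    rw [mul_smul, h]
  have h2 : sh (1 : R) r • p = p := h
  simp only [opStrict, STTrees.opQ, STTrees.bwd, add_smul, smul_assoc, h1, h2, sub_smul,
    one_smul]
  module

end IndepVar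

/-- The increasing enumeration of the indices different from `r`. -/
def skip (r j : ℕ) : ℕ := if j < r then j else j + 1

theorem skip_of_lt {r j : ℕ} (h : j < r) : skip r j = j := if_pos h

theorem skip_of_le {r j : ℕ} (h : r ≤ j) : skip r j = j + 1 := if_neg (by omega)

theorem skip_ne (r j : ℕ) : skip r j ≠ r := by
  unfold skip
  split_ifs <;> omega

theorem skip_injective (r : ℕ) : Function.Injective (skip r) := by
  intro i j h
  unfold skip at h
  split_ifs at h <;> omega

theorem indepVar_rename {f : ℕ → ℕ} {r : ℕ} (hf : ∀ j, f j ≠ r) (p : MvPolynomial ℕ R) :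
    IndepVar r (rename f p) := by
  have : (aeval (Function.update X r (X r + C (1 : R))) :
        MvPolynomial ℕ R →ₐ[R] MvPolynomial ℕ R).comp (rename f) = rename f := by
    ext k : 1
    simp [Function.update_of_ne (hf k)]
  exact congrArg (fun g => g p) this

theorem indepVar_skip (r : ℕ) (p : MvPolynomial ℕ R) : IndepVar r (rename (skip r) p) :=
  indepVar_rename (skip_ne r) p

section Eval

theorem evalAt_add (z : ℕ → ℤ) (p q : MvPolynomial ℕ R) :
    evalAt z (p + q) = evalAt z p + evalAt z q := map_add _ _ _

theorem evalAt_sub (z : ℕ → ℤ) (p q : MvPolynomial ℕ R) :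
    evalAt z (p - q) = evalAt z p - evalAt z q := map_sub _ _ _

theorem evalAt_neg (z : ℕ → ℤ) (p : MvPolynomial ℕ R) :
    evalAt z (-p) = -evalAt z p := map_neg _ _

theorem evalAt_smul (z : ℕ → ℤ) (c : R) (p : MvPolynomial ℕ R) :
    evalAt z (c • p) = c * evalAt z p := by
  rw [evalAt, smul_eval]
  rfl

theorem evalAt_sh (z : ℕ → ℤ) (c : ℤ) (i : ℕ) (p : MvPolynomial ℕ R) :
    evalAt z (sh (c : R) i • p) = evalAt (Function.update z i (z i + c)) p := by
  have : (aeval (fun j => (z j : R)) : MvPolynomial ℕ R →ₐ[R] R).comp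
      (aeval (Function.update X i (X i + C (c : R)))) =
      aeval (fun j => ((Function.update z i (z i + c) j : ℤ) : R)) := by
    ext k : 1
    by_cases h : k = i
    · subst h
      simp
    · simp [Function.update_of_ne h]
  exact congrArg (fun g => g p) this

theorem evalAt_sh_one (z : ℕ → ℤ) (i : ℕ) (p : MvPolynomial ℕ R) :
    evalAt z (sh (1 : R) i • p) = evalAt (Function.update z i (z i + 1)) p := by
  simpa using evalAt_sh z 1 i p

theorem evalAt_sh_neg_one (z : ℕ → ℤ) (i : ℕ) (p : MvPolynomial ℕ R) :
    evalAt z (sh (-1 : R) i • p) = evalAt (Function.update z i (z i - 1)) p := by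
  simpa [sub_eq_add_neg] using evalAt_sh z (-1) i p

theorem evalAt_rename (z : ℕ → ℤ) (f : ℕ → ℕ) (p : MvPolynomial ℕ R) :
    evalAt z (rename f p) = evalAt (fun j => z (f j)) p := by
  rw [evalAt, evalAt, eval_rename]
  rfl

/-- Invariance under the unit shift gives invariance under integer translations in both directions,
which suffices at integer points. -/
theorem evalAt_update_of_indepVar {r : ℕ} {p : MvPolynomial ℕ R} (h : IndepVar r p)
    (z : ℕ → ℤ) (c : ℤ) : evalAt (Function.update z r c) p = evalAt z p := by
  have key : ∀ y : ℕ → ℤ, evalAt (Function.update y r (y r + 1)) p = evalAt y p := fun y => by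
    rw [← evalAt_sh_one, h]
  have up : ∀ (y : ℕ → ℤ) (m : ℕ), evalAt (Function.update y r (y r + m)) p = evalAt y p := by
    intro y m
    induction m with
    | zero => simp
    | succ m ih =>
      rw [← ih, ← key (Function.update y r (y r + m))]
      simp [add_assoc]
  rcases le_total (z r) c with hc | hc
  · have := up z (c - z r).toNat
    rwa [Int.toNat_of_nonneg (by omega), add_sub_cancel] at this
  · have := up (Function.update z r c) (z r - c).toNat
    rw [Int.toNat_of_nonneg (by omega)] at this
    simpa using this.symm

end Eval

end Operators
-- The Strict product on polynomials that lack one variable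
section StrictProducts

variable {R : Type*} [CommRing R]

/-- The pairs `p < q` in `{1, …, n}`. -/
def pairs (n : ℕ) : Finset (ℕ × ℕ) :=
  (Finset.Icc 1 n ×ˢ Finset.Icc 1 n).filter fun x => x.1 < x.2

theorem mem_pairs {n : ℕ} {x : ℕ × ℕ} : x ∈ pairs n ↔ 1 ≤ x.1 ∧ x.1 < x.2 ∧ x.2 ≤ n := by
  simp only [pairs, Finset.mem_filter, Finset.mem_product, Finset.mem_Icc]
  omega

/-- `∏_{1 ≤ p < q ≤ n} Strict_{x_q, x_p}` as an element of the commutative algebra. -/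
noncomputable def opStrictProd (u v : R) (n : ℕ) : Op R :=
  ∏ x ∈ pairs n, opStrict u v x.2 x.1

/-- A pair has r as its larger element, or as its smaller element, or avoids r; the last kind is the
image of a pair under `skip r`. -/
theorem prod_pairs_skip {A : Type*} [CommMonoid A] (f : ℕ → ℕ → A) {M r : ℕ} (h1 : 1 ≤ r)
    (h2 : r ≤ M + 1) :
    ∏ x ∈ pairs (M + 1), f x.2 x.1 =
      (∏ i ∈ Finset.Ico 1 r, f r i) * (∏ i ∈ Finset.Ioc r (M + 1), f i r) *
        ∏ x ∈ pairs M, f (skip r x.2) (skip r x.1) := by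
  classical
  have e : pairs (M + 1) = ((Finset.Ico 1 r).image (fun i => (i, r)) ∪
      (Finset.Ioc r (M + 1)).image (fun i => (r, i))) ∪
      (pairs M).image (fun x => (skip r x.1, skip r x.2)) := by
    ext ⟨a, b⟩
    simp only [Finset.mem_union, Finset.mem_image, mem_pairs, Finset.mem_Ico, Finset.mem_Ioc,
      Prod.mk.injEq, Prod.exists]
    constructor
    · intro h
      by_cases ha : a = r
      · exact Or.inl (Or.inr ⟨b, by omega, by omega, rfl⟩)
      by_cases hb : b = r
      · exact Or.inl (Or.inl ⟨a, by omega, rfl, by omega⟩)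
      refine Or.inr ⟨if a < r then a else a - 1, if b < r then b else b - 1, ?_, ?_, ?_⟩
      · split_ifs <;> omega
      · unfold skip
        split_ifs <;> omega
      · unfold skip
        split_ifs <;> omega
    · rintro ((⟨i, h, rfl, rfl⟩ | ⟨i, h, rfl, rfl⟩) | ⟨i, j, h, rfl, rfl⟩)
      · omega
      · omega
      · unfold skip
        split_ifs <;> omega
  rw [e, Finset.prod_union, Finset.prod_union, Finset.prod_image, Finset.prod_image,
    Finset.prod_image]
  · intro x _ y _ h
    simp only [Prod.mk.injEq] at h
    exact Prod.ext (skip_injective r h.1) (skip_injective r h.2)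
  · intro x _ y _ h
    simpa using h
  · intro x _ y _ h
    simpa using h
  · rw [Finset.disjoint_left]
    simp only [Finset.mem_image, Finset.mem_Ico, Finset.mem_Ioc, not_exists]
    rintro _ ⟨i, hi, rfl⟩ j ⟨hj, h⟩
    simp only [Prod.mk.injEq] at h
    omega
  · rw [Finset.disjoint_left]
    simp only [Finset.mem_image, Finset.mem_union, not_exists]
    rintro _ (⟨i, hi, rfl⟩ | ⟨i, hi, rfl⟩) j ⟨hj, h⟩
    · exact skip_ne r _ (Prod.ext_iff.1 h).2
    · exact skip_ne r _ (Prod.ext_iff.1 h).1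

/-- The operators a i and b i agree only on the class P. Stability of P under all operators allows
the exchange one factor at a time. -/
theorem prod_smul_congr {ι : Type*} (s : Finset ι) (a b : ι → Op R) (P : MvPolynomial ℕ R → Prop)
    (hP : ∀ (c : Op R) y, P y → P (c • y)) (h : ∀ i ∈ s, ∀ y, P y → a i • y = b i • y)
    (y : MvPolynomial ℕ R) (hy : P y) : (∏ i ∈ s, a i) • y = (∏ i ∈ s, b i) • y := by
  classical
  induction s using Finset.induction_on with
  | empty => simp
  | insert i s hi ih =>
    rw [Finset.prod_insert hi, Finset.prod_insert hi, mul_smul, mul_smul,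
      ih fun j hj => h j (Finset.mem_insert_of_mem hj)]
    exact h i (Finset.mem_insert_self i s) _ (hP _ _ hy)

/-- Factors involving r collapse to P or Q since x_r is absent; the others form the Strict product
in M variables, carried along by the renumbering. -/
theorem opStrictProd_smul_rename_skip (u v : R) {M r : ℕ} (h1 : 1 ≤ r) (h2 : r ≤ M + 1)
    (p : MvPolynomial ℕ R) :
    opStrictProd u v (M + 1) • rename (skip r) p =
      ((∏ i ∈ Finset.Ico 1 r, opP v i) * ∏ i ∈ Finset.Ioc r (M + 1), opQ u i) •
        rename (skip r) (opStrictProd u v M • p) := by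
  have hI : Inter (skip r) (opStrictProd u v M)
      (∏ x ∈ pairs M, opStrict u v (skip r x.2) (skip r x.1)) :=
    Inter.prod _ _ _ fun x _ => Inter.opStrict (skip_injective r) u v _ _
  rw [opStrictProd, prod_pairs_skip (fun a b => opStrict u v a b) h1 h2, mul_smul, ← hI, mul_smul,
    mul_smul]
  have hind := indepVar_skip r (opStrictProd u v M • p)
  rw [prod_smul_congr (Finset.Ioc r (M + 1)) _ (opQ u) (IndepVar r) (fun c y hy => hy.smul c)
    (fun i _ y hy => hy.opStrict_right u v i) _ hind]
  rw [prod_smul_congr (Finset.Ico 1 r) _ (opP v) (IndepVar r) (fun c y hy => hy.smul c)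
    (fun i _ y hy => hy.opStrict_left u v i) _ (hind.smul _)]

end StrictProducts

/-! ### Binomial determinants: differences, Laplace expansion, antisymmetry -/

section Determinants

variable {R : Type*} [CommRing R] [Algebra ℚ R]

theorem map_binom (f : MvPolynomial ℕ R →ₐ[R] MvPolynomial ℕ R) (y : MvPolynomial ℕ R) (k : ℕ) :
    f (binom y k) = binom (f y) k := by
  rw [binom, binom, map_rat_smul, map_prod]
  simp

theorem binom_zero (y : MvPolynomial ℕ R) : binom y 0 = 1 := by simp [binom]

/-- Pascal's rule, which makes `detC` an antidifference of `detD` in all variables at once. -/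
theorem binom_add_one_sub (y : MvPolynomial ℕ R) (k : ℕ) :
    binom (y + 1) (k + 1) - binom y (k + 1) = binom y k := by
  have h : ∏ m ∈ Finset.range (k + 1), (y + 1 - (m : MvPolynomial ℕ R)) -
      ∏ m ∈ Finset.range (k + 1), (y - (m : MvPolynomial ℕ R)) =
      ((k : ℚ) + 1) • ∏ m ∈ Finset.range k, (y - (m : MvPolynomial ℕ R)) := by
    rw [Finset.prod_range_succ', Finset.prod_range_succ]
    have : ∀ m : ℕ, y + 1 - ((m + 1 : ℕ) : MvPolynomial ℕ R) = y - m := fun m => by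
      push_cast
      ring
    simp only [this, Nat.cast_zero, sub_zero]
    rw [Algebra.smul_def, map_add, map_natCast, map_one]
    ring
  rw [binom, binom, ← smul_sub, h, smul_smul, binom, Nat.factorial_succ]
  congr 1
  push_cast
  have : (k : ℚ) + 1 ≠ 0 := by positivity
  field_simp

/-- The shifted variable `xᵢ + i - min - 1`. -/
noncomputable def shiftedVar (R : Type*) [CommRing R] (mn : ℤ) (i : ℕ) : MvPolynomial ℕ R :=
  X i + ((((i : ℤ) - mn - 1 : ℤ)) : MvPolynomial ℕ R)

/-- `det ((xᵢ + i - min - 1) choose (j - 1 + d [j = n]))`. -/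
noncomputable def detD (R : Type*) [CommRing R] [Algebra ℚ R] (n d : ℕ) (mn : ℤ) :
    MvPolynomial ℕ R :=
  (Matrix.of fun i j : Fin n =>
    binom (shiftedVar R mn ((i : ℕ) + 1)) ((j : ℕ) + if (j : ℕ) + 1 = n then d else 0)).det

/-- `det ((xᵢ + i - min - 1) choose (j + d [j = n]))`. -/
noncomputable def detC (R : Type*) [CommRing R] [Algebra ℚ R] (n d : ℕ) (mn : ℤ) :
    MvPolynomial ℕ R :=
  (Matrix.of fun i j : Fin n =>
    binom (shiftedVar R mn ((i : ℕ) + 1)) ((j : ℕ) + (if (j : ℕ) + 1 = n then d else 0) + 1)).det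

/-- The shift as an algebra homomorphism. -/
noncomputable def shHom (c : R) (i : ℕ) : MvPolynomial ℕ R →ₐ[R] MvPolynomial ℕ R :=
  aeval (Function.update X i (X i + C c))

omit [Algebra ℚ R] in
theorem sh_smul_eq_shHom (c : R) (i : ℕ) (p : MvPolynomial ℕ R) : sh c i • p = shHom c i p := rfl

omit [Algebra ℚ R] in
theorem prod_sh_smul (s : Finset ℕ) (p : MvPolynomial ℕ R) :
    (∏ i ∈ s, sh (1 : R) i) • p = aeval (fun k => X k + if k ∈ s then 1 else 0) p := by
  classical
  induction s using Finset.induction_on generalizing p with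
  | empty => simp
  | insert i s hi ih =>
    rw [Finset.prod_insert hi, mul_comm, mul_smul, ih, sh_smul_eq_shHom]
    have : ((aeval fun k => X k + if k ∈ s then 1 else 0) :
        MvPolynomial ℕ R →ₐ[R] MvPolynomial ℕ R).comp (shHom 1 i) =
        aeval fun k => X k + if k ∈ insert i s then 1 else 0 := by
      ext k : 1
      by_cases h : k = i
      · subst h
        simp [shHom, hi]
      · simp [shHom, h]
    exact congrArg (fun g => g p) this

/-- The first column consists of ones. Deleting row r gives the variables after r a row number
smaller by one, and x_{i+1} + (i + 1) = (x_{i+1} + 1) + i accounts for the shifts E_i with i > r. -/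
theorem detD_laplace {M : ℕ} (hM : 1 ≤ M) (d : ℕ) (mn : ℤ) :
    detD R (M + 1) d mn = ∑ r ∈ Finset.Icc 1 (M + 1), (-1 : Op R) ^ (r - 1) •
      (∏ i ∈ Finset.Ioc r (M + 1), sh (1 : R) i) • rename (skip r) (detC R M d mn) := by
  rw [detD, Matrix.det_succ_column_zero]
  have hr : Finset.Icc 1 (M + 1) = (Finset.range (M + 1)).map (addRightEmbedding 1) := by
    ext a
    simp only [Finset.mem_Icc, Finset.mem_map, Finset.mem_range, addRightEmbedding_apply]
    exact ⟨fun h => ⟨a - 1, by omega, by omega⟩, by rintro ⟨b, hb, rfl⟩; omega⟩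
  rw [hr, Finset.sum_map, ← Fin.sum_univ_eq_sum_range
    (fun r => (-1 : Op R) ^ (addRightEmbedding 1 r - 1) •
      (∏ i ∈ Finset.Ioc (addRightEmbedding 1 r) (M + 1), sh (1 : R) i) •
        rename (skip (addRightEmbedding 1 r)) (detC R M d mn))]
  refine Finset.sum_congr rfl fun i _ => ?_
  -- Here M ≥ 1 matters: the first column is not the last one, so it does not contain d.
  have h0 : (0 : ℕ) + 1 ≠ M + 1 := by omega
  have hA0 : ∀ y : MvPolynomial ℕ R, binom y (((0 : Fin M.succ) : ℕ) +
      if ((0 : Fin M.succ) : ℕ) + 1 = M + 1 then d else 0) = 1 := by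
    intro y
    rw [if_neg (by simpa using h0), Fin.val_zero, add_zero, binom_zero]
  simp only [Matrix.of_apply, addRightEmbedding_apply, Nat.add_sub_cancel]
  rw [hA0, mul_one]
  have hs : ∀ y : MvPolynomial ℕ R, (-1 : Op R) ^ (i : ℕ) • y = (-1) ^ (i : ℕ) * y := by
    intro y
    rcases Nat.even_or_odd (i : ℕ) with h | h <;> simp [h.neg_one_pow]
  rw [hs, prod_sh_smul, detC, AlgHom.map_det, AlgHom.map_det]
  congr 2
  ext1 a b
  simp only [Matrix.submatrix_apply, Matrix.of_apply, AlgHom.mapMatrix_apply, Matrix.map_apply,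
    map_binom, shiftedVar, map_add, rename_X, map_intCast, aeval_X, Fin.val_succ]
  have hb : ((b : ℕ) + 1 + if (b : ℕ) + 1 + 1 = M + 1 then d else 0) =
      (b : ℕ) + (if (b : ℕ) + 1 = M then d else 0) + 1 := by
    simp only [Nat.add_right_cancel_iff]
    omega
  rw [hb]
  congr 1
  have hle : (a : ℕ) + 2 ≤ M + 1 := by omega
  by_cases hlt : (a : ℕ) < (i : ℕ)
  · rw [Fin.succAbove_of_castSucc_lt _ _ (by exact hlt), skip_of_lt (by omega), if_neg (by
      simp only [Finset.mem_Ioc]; omega), Fin.val_castSucc, add_zero]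
  · rw [Fin.succAbove_of_le_castSucc _ _ (by
      rw [Fin.le_def, Fin.val_castSucc]; omega), skip_of_le (by omega), if_pos (by
      simp only [Finset.mem_Ioc]; omega), Fin.val_succ]
    push_cast
    ring

/-- Each difference concerns the variable of a single row. By linearity of the determinant in that
row, Pascal's rule lowers the indices there by one. -/
theorem prod_fwd_smul_det {n : ℕ} (mn : ℤ) (e : Fin n → ℕ) (s : Finset (Fin n)) :
    (∏ i ∈ s, (fwd ((i : ℕ) + 1) : Op R)) •
      (Matrix.of fun i j : Fin n => binom (shiftedVar R mn ((i : ℕ) + 1)) (e j + 1)).det =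
      (Matrix.of fun i j : Fin n => if i ∈ s then binom (shiftedVar R mn ((i : ℕ) + 1)) (e j)
        else binom (shiftedVar R mn ((i : ℕ) + 1)) (e j + 1)).det := by
  classical
  induction s using Finset.induction_on with
  | empty => simp
  | insert k s hk ih =>
    rw [Finset.prod_insert hk, mul_smul, ih, fwd, sub_smul, one_smul, sub_eq_iff_eq_add,
      sh_smul_eq_shHom, AlgHom.map_det]
    set A := (Matrix.of fun i j : Fin n => if i ∈ insert k s then
      binom (shiftedVar R mn ((i : ℕ) + 1)) (e j)
        else binom (shiftedVar R mn ((i : ℕ) + 1)) (e j + 1)) with hA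
    set A' := (Matrix.of fun i j : Fin n => if i ∈ s then
      binom (shiftedVar R mn ((i : ℕ) + 1)) (e j)
        else binom (shiftedVar R mn ((i : ℕ) + 1)) (e j + 1)) with hA'
    have h1 : A = A.updateRow k (A k) := (Matrix.updateRow_eq_self A k).symm
    have h2 : A' = A.updateRow k (A' k) := by
      ext1 i j
      by_cases hi : i = k
      · subst hi
        simp
      · simp [hA, hA', hi]
    rw [h2]
    nth_rw 2 [h1]
    rw [← Matrix.det_updateRow_add]
    congr 1
    ext1 i j
    have hself : shHom (1 : R) (k + 1) (shiftedVar R mn ((k : ℕ) + 1)) =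
        shiftedVar R mn ((k : ℕ) + 1) + 1 := by
      simp [shiftedVar, shHom]
      ring
    by_cases hi : i = k
    · subst hi
      simp only [AlgHom.mapMatrix_apply, Matrix.map_apply, Matrix.updateRow_self, hA, hA',
        Matrix.of_apply, if_neg hk, Finset.mem_insert_self, if_true, map_binom, hself,
        Pi.add_apply]
      rw [← sub_eq_iff_eq_add, binom_add_one_sub]
    · have hne : (i : ℕ) + 1 ≠ (k : ℕ) + 1 := by
        simpa [Fin.ext_iff] using hi
      have hoth : shHom (1 : R) (k + 1) (shiftedVar R mn ((i : ℕ) + 1)) =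
          shiftedVar R mn ((i : ℕ) + 1) := by
        simp [shiftedVar, shHom, Function.update_of_ne hne]
      simp only [AlgHom.mapMatrix_apply, Matrix.map_apply, Matrix.updateRow_ne hi, hA,
        Matrix.of_apply, Finset.mem_insert, hi, false_or]
      split_ifs <;> rw [map_binom, hoth]

theorem prod_Icc_one_eq_prod_fin {A : Type*} [CommMonoid A] (n : ℕ) (f : ℕ → A) :
    ∏ i ∈ Finset.Icc 1 n, f i = ∏ i : Fin n, f (i + 1) := by
  rw [Fin.prod_univ_eq_prod_range (fun i => f (i + 1)), Finset.range_eq_Ico,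
    Finset.prod_Ico_add' f 0 n 1]
  rfl

theorem prod_fwd_smul_detC (n d : ℕ) (mn : ℤ) :
    (∏ i ∈ Finset.Icc 1 n, (fwd i : Op R)) • detC R n d mn = detD R n d mn := by
  rw [prod_Icc_one_eq_prod_fin, detC, prod_fwd_smul_det]
  simp [detD]

/-- `Strict_{x_j, x_{j+1}} E_{x_j} p` is antisymmetric in `x_j, x_{j+1}`. -/
def Anti (u v : R) (j : ℕ) (p : MvPolynomial ℕ R) : Prop :=
  rename (Equiv.swap j (j + 1)) (opStrict u v j (j + 1) • sh (1 : R) j • p) =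
    -(opStrict u v j (j + 1) • sh (1 : R) j • p)

theorem comp_swap_of_eq {j : ℕ} {z : ℕ → ℤ} (hz : z j = z (j + 1)) :
    (fun k => z (Equiv.swap j (j + 1) k)) = z := by
  funext k
  by_cases hk : k = j
  · rw [hk, Equiv.swap_apply_left, hz]
  by_cases hk' : k = j + 1
  · rw [hk', Equiv.swap_apply_right, hz]
  · rw [Equiv.swap_apply_of_ne_of_ne hk hk']

/-- At a point fixed by the transposition the value equals its own negative, and 2 is invertible in
a ℚ-algebra. -/
theorem Anti.eval {u v : R} {j : ℕ} {p : MvPolynomial ℕ R} (h : Anti u v j p) {z : ℕ → ℤ}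
    (hz : z j = z (j + 1)) : evalAt z (opStrict u v j (j + 1) • sh (1 : R) j • p) = 0 := by
  set y := opStrict u v j (j + 1) • sh (1 : R) j • p with hy
  have h' := evalAt_rename z (Equiv.swap j (j + 1)) y
  rw [comp_swap_of_eq hz, hy, h, ← hy, evalAt_neg] at h'
  have h2 : (2 : ℚ) • evalAt z y = 0 := by
    rw [two_smul]
    nth_rw 1 [← h']
    exact neg_add_cancel _
  exact (smul_eq_zero_iff_right (two_ne_zero)).1 h2

omit [Algebra ℚ R] in
theorem Anti.smul {u v : R} {j : ℕ} {p : MvPolynomial ℕ R} (h : Anti u v j p) {a : Op R}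
    (ha : Inter (Equiv.swap j (j + 1)) a a) : Anti u v j (a • p) := by
  have : opStrict u v j (j + 1) • sh (1 : R) j • a • p =
      a • opStrict u v j (j + 1) • sh (1 : R) j • p := by
    rw [smul_comm _ a, smul_comm _ a]
  rw [Anti, this, ha, h, smul_neg]

omit [Algebra ℚ R] in
theorem Anti.add {u v : R} {j : ℕ} {p q : MvPolynomial ℕ R} (h : Anti u v j p)
    (h' : Anti u v j q) : Anti u v j (p + q) := by
  rw [Anti, smul_add, smul_add, map_add, h, h', neg_add]

omit [Algebra ℚ R] in
theorem Anti.rename_skip {u v : R} {j r : ℕ} {p : MvPolynomial ℕ R} (h : Anti u v j p)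
    (hr : r ≤ j) : Anti u v (j + 1) (rename (skip r) p) := by
  have i1 := Inter.opStrict (skip_injective r) u v j (j + 1)
  have i2 := Inter.shift (R := R) (skip_injective r) 1 j
  rw [skip_of_le hr] at i1 i2
  rw [skip_of_le (by omega)] at i1
  rw [Anti, ← i2, ← i1, ← map_neg, ← h, rename_rename, rename_rename]
  congr 2
  funext k
  simp only [Function.comp_apply, Equiv.swap_apply_def, skip]
  split_ifs <;> omega

omit [Algebra ℚ R] in
-- Exchanging the neighbours j and j + 1 preserves the order of every other pair, so it merely
-- permutes the factors.
theorem inter_swap_rest (u v : R) {n j : ℕ} (h1 : 1 ≤ j) (h2 : j + 1 ≤ n) :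
    Inter (Equiv.swap j (j + 1)) (∏ x ∈ (pairs n).erase (j, j + 1), opStrict u v x.2 x.1)
      (∏ x ∈ (pairs n).erase (j, j + 1), opStrict u v x.2 x.1) := by
  set τ := Equiv.swap j (j + 1) with hτ
  have hmem : ∀ x ∈ (pairs n).erase (j, j + 1), (τ x.1, τ x.2) ∈ (pairs n).erase (j, j + 1) := by
    rintro ⟨a, b⟩ hx
    simp only [Finset.mem_erase, mem_pairs, ne_eq, Prod.mk.injEq, hτ, Equiv.swap_apply_def] at hx ⊢
    split_ifs <;> omega
  have e : ∏ x ∈ (pairs n).erase (j, j + 1), opStrict u v x.2 x.1 =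
      ∏ x ∈ (pairs n).erase (j, j + 1), opStrict u v (τ x.2) (τ x.1) := by
    refine Finset.prod_nbij' (fun x => (τ x.1, τ x.2)) (fun x => (τ x.1, τ x.2)) hmem hmem ?_ ?_ ?_
    · intro x _
      simp [hτ]
    · intro x _
      simp [hτ]
    · intro x _
      simp [hτ]
  conv => arg 3; rw [e]
  exact Inter.prod _ _ _ fun x _ => Inter.opStrict τ.injective u v _ _

/-- After E_{j+1}⁻¹ the arguments in rows j and j + 1 are x_j + j - min - 1 and x_{j+1} + j - min -
1. Exchanging the variables therefore exchanges two rows. -/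
theorem rename_swap_detC (M d : ℕ) (mn : ℤ) {j : ℕ} (h1 : 1 ≤ j) (h2 : j + 1 ≤ M) :
    rename (Equiv.swap j (j + 1)) (sh (-1 : R) (j + 1) • detC R M d mn) =
      -(sh (-1 : R) (j + 1) • detC R M d mn) := by
  obtain ⟨i, rfl⟩ : ∃ i, j = i + 1 := ⟨j - 1, by omega⟩
  have ha : i < M := by omega
  have hb : i + 1 < M := by omega
  rw [sh_smul_eq_shHom, detC, AlgHom.map_det, AlgHom.map_det]
  set A := (shHom (-1 : R) (i + 1 + 1)).mapMatrix (Matrix.of fun i j : Fin M =>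
    binom (shiftedVar R mn ((i : ℕ) + 1))
      ((j : ℕ) + (if (j : ℕ) + 1 = M then d else 0) + 1)) with hA
  have key := Matrix.det_permute (Equiv.swap (⟨i, ha⟩ : Fin M) ⟨i + 1, hb⟩) A
  rw [Equiv.Perm.sign_swap (by simp)] at key
  have e : (rename (Equiv.swap (i + 1) (i + 1 + 1))).mapMatrix A =
      A.submatrix (Equiv.swap (⟨i, ha⟩ : Fin M) ⟨i + 1, hb⟩) id := by
    ext1 a b
    simp only [hA, AlgHom.mapMatrix_apply, Matrix.map_apply, Matrix.of_apply, Matrix.submatrix_apply,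
      map_binom, id]
    congr 1
    have hval : ∀ a : Fin M, (a : ℕ) = i ∨ (a : ℕ) = i + 1 ∨ ((a : ℕ) ≠ i ∧ (a : ℕ) ≠ i + 1) := by
      intro a; omega
    rcases hval a with h | h | ⟨h, h'⟩
    · have : a = ⟨i, ha⟩ := Fin.ext h
      subst this
      simp [shiftedVar, shHom]
      ring
    · have : a = ⟨i + 1, hb⟩ := Fin.ext h
      subst this
      simp [shiftedVar, shHom]
      ring
    · rw [Equiv.swap_apply_of_ne_of_ne (by simpa [Fin.ext_iff] using h)
        (by simpa [Fin.ext_iff] using h')]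
      simp [shiftedVar, shHom, h']
      rw [Equiv.swap_apply_of_ne_of_ne (by omega) (by omega)]
  rw [e, key]
  simp

/-- The polynomial in question factors as Strict_{x_j, x_{j+1}} Strict_{x_{j+1}, x_j}, times E_j
E_{j+1}, times the remaining Strict factors, applied to E_{j+1}⁻¹ `detC`. The operators are
symmetric in x_j, x_{j+1} and the last polynomial is antisymmetric. -/
theorem anti_opStrictProd_detC (u v : R) (M d : ℕ) (mn : ℤ) {j : ℕ} (h1 : 1 ≤ j)
    (h2 : j + 1 ≤ M) : Anti u v j (opStrictProd u v M • detC R M d mn) := by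
  set τ := Equiv.swap j (j + 1) with hτ
  set rest := ∏ x ∈ (pairs M).erase (j, j + 1), opStrict u v x.2 x.1 with hrest
  have hprod : opStrictProd u v M = opStrict u v (j + 1) j * rest := by
    rw [opStrictProd, hrest, Finset.mul_prod_erase (pairs M) (fun x => opStrict u v x.2 x.1)
      (a := (j, j + 1)) (by simp only [mem_pairs]; omega)]
  set y := opStrict u v j (j + 1) • sh (1 : R) j • opStrictProd u v M • detC R M d mn with hy
  have hy2 : y = ((opStrict u v j (j + 1) * opStrict u v (j + 1) j) *
      (sh (1 : R) j * sh 1 (j + 1)) * rest) • sh (-1 : R) (j + 1) • detC R M d mn := by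
    have hc : detC R M d mn = sh (1 : R) (j + 1) • sh (-1 : R) (j + 1) • detC R M d mn := by
      rw [← mul_smul, sh_one_mul_sh_neg_one, one_smul]
    have comm : ∀ {A : Type _} [CommRing A] (a b c e f r : A),
        a * (c * (b * r * (e * f))) = a * b * (c * e) * r * f := fun a b c e f r => by ring
    calc y = opStrict u v j (j + 1) • sh (1 : R) j • (opStrict u v (j + 1) j * rest) •
          sh (1 : R) (j + 1) • sh (-1 : R) (j + 1) • detC R M d mn := by rw [hy, hprod, ← hc]
      _ = (opStrict u v j (j + 1) * (sh (1 : R) j * (opStrict u v (j + 1) j * rest *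
          (sh (1 : R) (j + 1) * sh (-1 : R) (j + 1))))) • detC R M d mn := by
        simp only [mul_smul]
      _ = _ := by rw [comm, mul_smul]
  have hj : τ j = j + 1 := by simp [hτ]
  have hj' : τ (j + 1) = j := by simp [hτ]
  have i1 := (Inter.opStrict τ.injective u v j (j + 1)).mul
    (Inter.opStrict τ.injective u v (j + 1) j)
  have i2 := (Inter.shift (R := R) τ.injective 1 j).mul (Inter.shift τ.injective 1 (j + 1))
  rw [hj, hj', mul_comm (opStrict u v (j + 1) j)] at i1
  rw [hj, hj', mul_comm (sh 1 (j + 1))] at i2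
  change rename τ y = -y
  rw [hy2, (i1.mul i2).mul (inter_swap_rest u v h1 h2), rename_swap_detC M d mn h1 h2, smul_neg]

end Determinants

/-! ### The Gelfand–Tsetlin product as a binomial determinant -/

section GelfandTsetlin

variable {R : Type*} [CommRing R] [Algebra ℚ R]

theorem prod_fin_Ioi_eq_prod_range {A : Type*} [CommMonoid A] (n : ℕ) (g : ℕ → ℕ → A) :
    ∏ i : Fin n, ∏ j ∈ Finset.Ioi i, g i j =
      ∏ j ∈ Finset.range n, ∏ i ∈ Finset.range j, g i j := by
  induction n generalizing g with
  | zero => simp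
  | succ n ih =>
    rw [Fin.prod_univ_succ, Fin.prod_Ioi_zero (fun j => g ((0 : Fin (n + 1)) : ℕ) j)]
    have h1 : ∏ i : Fin n, ∏ j ∈ Finset.Ioi i.succ, g (i.succ : Fin (n + 1)) j =
        ∏ i : Fin n, ∏ j ∈ Finset.Ioi i, g (i + 1) (j + 1) := by
      refine Finset.prod_congr rfl fun i _ => ?_
      rw [Fin.prod_Ioi_succ (fun j : Fin (n + 1) => g (i.succ : Fin (n + 1)) j) i]
      rfl
    rw [h1, ih (fun i j => g (i + 1) (j + 1)), Finset.prod_range_succ', Finset.prod_range_zero,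
      mul_one]
    have h2 : ∏ j : Fin n, g ((0 : Fin (n + 1)) : ℕ) (j.succ : Fin (n + 1)) =
        ∏ j ∈ Finset.range n, g 0 (j + 1) :=
      Fin.prod_univ_eq_prod_range (fun j => g 0 (j + 1)) n
    rw [h2, ← Finset.prod_mul_distrib]
    refine Finset.prod_congr rfl fun j _ => ?_
    rw [Finset.prod_range_succ', mul_comm]

theorem prod_range_natCast_sub (j : ℕ) :
    ∏ i ∈ Finset.range j, (((j + 1 : ℕ) : ℚ) - ((i + 1 : ℕ) : ℚ))⁻¹ = (j.factorial : ℚ)⁻¹ := by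
  rw [Finset.prod_inv_distrib, ← Finset.prod_range_add_one_eq_factorial, ← Finset.prod_range_reflect]
  rw [Nat.cast_prod]
  congr 1
  refine Finset.prod_congr rfl fun i hi => ?_
  have hi := Finset.mem_range.1 hi
  rw [show j - 1 - i + 1 = j - i by omega, Nat.cast_sub hi.le]
  push_cast
  ring

/-- Up to the factor 1/j! the columns are monic polynomials of degree j, so this is a Vandermonde
determinant. -/
theorem det_binom (n : ℕ) (y : Fin n → MvPolynomial ℕ R) :
    (Matrix.of fun i j : Fin n => binom (y i) j).det =
      (∏ j : Fin n, algebraMap ℚ (MvPolynomial ℕ R) ((j : ℕ).factorial : ℚ)⁻¹) *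
        ∏ i : Fin n, ∏ j ∈ Finset.Ioi i, (y j - y i) := by
  -- Over the zero ring the degree of a monic polynomial is lost, so that case is treated apart.
  rcases subsingleton_or_nontrivial (MvPolynomial ℕ R) with hs | hs
  · exact Subsingleton.elim _ _
  set q : ℕ → Polynomial (MvPolynomial ℕ R) := fun k =>
    (descPochhammer ℤ k).map (Int.castRingHom _) with hq
  have hev : ∀ (x : MvPolynomial ℕ R) (k : ℕ), (q k).eval x =
      ∏ m ∈ Finset.range k, (x - (m : MvPolynomial ℕ R)) := by
    intro x k
    rw [hq]
    simp only
    rw [descPochhammer_map, descPochhammer_eval_eq_prod_range]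
  rw [← Matrix.det_vandermonde, Matrix.det_eval_matrixOfPolynomials_eq_det_vandermonde y
    (fun j => q j), ← Matrix.det_mul_row]
  · congr 1
    ext1 i j
    simp only [Matrix.of_apply, hev, binom, Algebra.smul_def]
  · intro i
    rw [hq]
    simp only
    rw [(monic_descPochhammer ℤ i).natDegree_map, descPochhammer_natDegree]
  · intro i
    exact (monic_descPochhammer ℤ i).map _

/-- Only differences of the arguments enter the Vandermonde product, so the translation by mn is
arbitrary. -/
theorem GT_eq_detD (n : ℕ) (mn : ℤ) : GT R n = detD R n 0 mn := by
  have h : detD R n 0 mn = (Matrix.of fun i j : Fin n =>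
      binom (shiftedVar R mn ((i : ℕ) + 1)) j).det := by
    simp [detD]
  rw [h, det_binom, prod_fin_Ioi_eq_prod_range n
    (fun i j => shiftedVar R mn (j + 1) - shiftedVar R mn (i + 1)), GT]
  have h1 : ∏ j ∈ Finset.Icc 1 n, ∏ i ∈ Finset.Ico 1 j,
      ((j : ℚ) - (i : ℚ))⁻¹ • (X j - X i + (j : MvPolynomial ℕ R) - (i : MvPolynomial ℕ R)) =
      ∏ j ∈ Finset.range n, ∏ i ∈ Finset.range j, (((j + 1 : ℕ) : ℚ) - ((i + 1 : ℕ) : ℚ))⁻¹ •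
        (X (j + 1) - X (i + 1) + ((j + 1 : ℕ) : MvPolynomial ℕ R)
          - ((i + 1 : ℕ) : MvPolynomial ℕ R)) := by
    rw [prod_Icc_one_eq_prod_fin, Fin.prod_univ_eq_prod_range (fun j => ∏ i ∈ Finset.Ico 1 (j + 1),
      (((j + 1 : ℕ) : ℚ) - (i : ℚ))⁻¹ • (X (j + 1) - X i + ((j + 1 : ℕ) : MvPolynomial ℕ R)
        - (i : MvPolynomial ℕ R)))]
    refine Finset.prod_congr rfl fun j _ => ?_
    rw [Finset.prod_Ico_eq_prod_range]
    refine Finset.prod_congr rfl fun i _ => ?_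
    rw [add_comm 1 i]
  rw [h1, Fin.prod_univ_eq_prod_range (fun j => algebraMap ℚ (MvPolynomial ℕ R)
    ((j.factorial : ℚ)⁻¹)), ← Finset.prod_mul_distrib]
  refine Finset.prod_congr rfl fun j _ => ?_
  rw [← prod_range_natCast_sub, map_prod, ← Finset.prod_mul_distrib]
  refine Finset.prod_congr rfl fun i _ => ?_
  rw [Algebra.smul_def, shiftedVar, shiftedVar]
  congr 1
  push_cast
  ring

end GelfandTsetlin

/-! ### Rows that interlace with a given row -/

section Boxes

open Classical in
/-- The rows `x` above a row `z`, where the entries `x_p, …, x_{p+k-1}` interlace with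
`z_p, …, z_{p+k}` and the other entries are copied from `z`. -/
noncomputable def box (p : ℕ) : ℕ → (ℕ → ℤ) → Finset (ℕ → ℤ)
  | 0, z => {fun j => z (skip p j)}
  | k + 1, z => (Finset.Icc (z (p + k)) (z (p + k + 1))).biUnion fun t =>
      box p k (Function.update z (p + k + 1) t)

/-- The recursion stores the last free entry t in z at place p + k + 1. The smaller box copies that
place into x_{p+k}, so the update records t, while the bounds of the earlier entries are untouched.
-/
theorem mem_box {p k : ℕ} {z x : ℕ → ℤ} : x ∈ box p k z ↔ (∀ j < p, x j = z j) ∧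
    (∀ j, p ≤ j → j < p + k → z j ≤ x j ∧ x j ≤ z (j + 1)) ∧ ∀ j, p + k ≤ j → x j = z (j + 1) := by
  induction k generalizing z with
  | zero =>
    simp only [box, Finset.mem_singleton, add_zero]
    constructor
    · rintro rfl
      refine ⟨fun j hj => by simp only [skip_of_lt hj], fun j h1 h2 => by omega,
        fun j hj => by simp only [skip_of_le hj]⟩
    · rintro ⟨h1, -, h3⟩
      funext j
      by_cases hj : j < p
      · rw [skip_of_lt hj, h1 j hj]
      · rw [skip_of_le (by omega), h3 j (by omega)]
  | succ k ih =>
    classical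
    simp only [box, Finset.mem_biUnion, Finset.mem_Icc, ih]
    constructor
    · rintro ⟨t, ht, h1, h2, h3⟩
      refine ⟨fun j hj => ?_, fun j hj hj' => ?_, fun j hj => ?_⟩
      · rw [h1 j hj, Function.update_of_ne (by omega)]
      · rcases Nat.lt_or_ge j (p + k) with h | h
        · have := h2 j hj h
          rwa [Function.update_of_ne (by omega), Function.update_of_ne (by omega)] at this
        · obtain rfl : j = p + k := by omega
          rw [h3 _ le_rfl, Function.update_self]
          exact ht
      · rw [h3 j (by omega), Function.update_of_ne (by omega)]
    · rintro ⟨h1, h2, h3⟩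
      refine ⟨x (p + k), h2 _ (by omega) (by omega), fun j hj => ?_, fun j hj hj' => ?_,
        fun j hj => ?_⟩
      · rw [h1 j hj, Function.update_of_ne (by omega)]
      · rw [Function.update_of_ne (by omega), Function.update_of_ne (by omega)]
        exact h2 j hj (by omega)
      · rcases Nat.lt_or_ge (p + k) j with h | h
        · rw [h3 j (by omega), Function.update_of_ne (by omega)]
        · obtain rfl : j = p + k := by omega
          rw [Function.update_self]

theorem box_apply_last {p k : ℕ} {z x : ℕ → ℤ} (h : x ∈ box p k z) : x (p + k) = z (p + k + 1) :=
  (mem_box.1 h).2.2 _ le_rfl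

theorem sum_box_succ {A : Type*} [AddCommMonoid A] (p k : ℕ) (z : ℕ → ℤ) (f : (ℕ → ℤ) → A) :
    ∑ x ∈ box p (k + 1) z, f x = ∑ t ∈ Finset.Icc (z (p + k)) (z (p + k + 1)),
      ∑ x ∈ box p k (Function.update z (p + k + 1) t), f x := by
  classical
  rw [box, Finset.sum_biUnion]
  intro t _ t' _ h
  rw [Function.onFun, Finset.disjoint_left]
  intro x hx hx'
  apply h
  have h1 := box_apply_last hx
  have h2 := box_apply_last hx'
  rw [Function.update_self] at h1 h2
  rw [← h1, h2]

theorem box_between {p k N : ℕ} {z x : ℕ → ℤ} (h : x ∈ box p k z)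
    (hz : ∀ i, 1 ≤ i → i < N → z i ≤ z (i + 1)) (i : ℕ) (h1 : 1 ≤ i) (h2 : i < N) :
    z i ≤ x i ∧ x i ≤ z (i + 1) := by
  obtain ⟨ha, hb, hc⟩ := mem_box.1 h
  rcases Nat.lt_or_ge i p with hi | hi
  · rw [ha i hi]
    exact ⟨le_rfl, hz i h1 h2⟩
  rcases Nat.lt_or_ge i (p + k) with hi' | hi'
  · exact hb i hi hi'
  · rw [hc i hi']
    exact ⟨hz i h1 h2, le_rfl⟩

theorem box_mono {p k N : ℕ} {z x : ℕ → ℤ} (h : x ∈ box p k z)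
    (hz : ∀ i, 1 ≤ i → i < N → z i ≤ z (i + 1)) (i : ℕ) (h1 : 1 ≤ i) (h2 : i + 1 < N) :
    x i ≤ x (i + 1) :=
  (box_between h hz i h1 (by omega)).2.trans (box_between h hz (i + 1) (by omega) h2).1

/-- Removing the largest possible value of the last free entry amounts to lowering its bound. -/
theorem sum_box_ne_last {A : Type*} [Ring A] (p k : ℕ) (z : ℕ → ℤ) (f : (ℕ → ℤ) → A) :
    ∑ x ∈ box p (k + 1) z, (if x (p + k) = z (p + k + 1) then 0 else f x) =
      ∑ x ∈ box p (k + 1) (Function.update z (p + k + 1) (z (p + k + 1) - 1)), f x := by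
  rw [sum_box_succ, sum_box_succ, Function.update_self, Function.update_of_ne (by omega)]
  simp only [Function.update_idem]
  have hsub : Finset.Icc (z (p + k)) (z (p + k + 1) - 1) ⊆
      Finset.Icc (z (p + k)) (z (p + k + 1)) := Finset.Icc_subset_Icc_right (by omega)
  rw [← Finset.sum_subset hsub]
  · refine Finset.sum_congr rfl fun t ht => Finset.sum_congr rfl fun x hx => ?_
    have h1 := box_apply_last hx
    rw [Function.update_self] at h1
    rw [if_neg]
    have := (Finset.mem_Icc.1 ht).2
    omega
  · intro t ht ht'
    refine Finset.sum_eq_zero fun x hx => ?_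
    have h1 := box_apply_last hx
    rw [Function.update_self] at h1
    rw [if_pos]
    rw [Finset.mem_Icc] at ht ht'
    omega

/-- The terms with the largest possible value of the last free entry. -/
theorem sum_box_eq_last {A : Type*} [Ring A] (p k : ℕ) (z : ℕ → ℤ) (f : (ℕ → ℤ) → A)
    (hz : z (p + k) ≤ z (p + k + 1)) :
    ∑ x ∈ box p (k + 1) z, (if x (p + k) = z (p + k + 1) then f x else 0) =
      ∑ x ∈ box p k z, f x := by
  rw [sum_box_succ, Finset.sum_eq_single (z (p + k + 1))]
  · rw [Function.update_eq_self]
    refine Finset.sum_congr rfl fun x hx => ?_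
    rw [if_pos (box_apply_last hx)]
  · intro t _ ht
    refine Finset.sum_eq_zero fun x hx => ?_
    have h1 := box_apply_last hx
    rw [Function.update_self] at h1
    rw [if_neg (by rwa [h1])]
  · intro h
    exact absurd (Finset.mem_Icc.2 ⟨hz, le_rfl⟩) h

end Boxes

/-! ### Weights of a row and their recursion -/

section RowWeights

variable {R : Type*} [CommRing R]

/-- The weight of `x_p, …, x_{p+k-1}` above `z_p, …, z_{p+k-1}`; the factor of `x_p = z_p`
is `lam` instead of `v`. -/
def rowV (u v lam : R) (p : ℕ) : ℕ → (ℕ → ℤ) → (ℕ → ℤ) → R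
  | 0, _, _ => 1
  | 1, z, x => if x p = z p then lam else 1
  | k + 2, z, x => rowV u v lam p (k + 1) z x * ((if x (p + k) = z (p + k + 1) then u else 1) *
      (if x (p + k + 1) = z (p + k + 1) then v else 1) *
      (if x (p + k) = x (p + k + 1) then 0 else 1))

theorem rowV_update (u v lam : R) (p : ℕ) {k i : ℕ} (hi : p + k ≤ i) (z x : ℕ → ℤ) (t : ℤ) :
    rowV u v lam p k (Function.update z i t) x = rowV u v lam p k z x := by
  induction k using Nat.strong_induction_on with
  | _ k ih =>
    match k with
    | 0 => rfl
    | 1 => simp only [rowV, Function.update_of_ne (show p ≠ i by omega)]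
    | k + 2 =>
      simp only [rowV, Function.update_of_ne (show p + k + 1 ≠ i by omega)]
      rw [ih (k + 1) (by omega) (by omega)]

/-- The weighted sum over the rows in a box. -/
noncomputable def rowSum (u v lam : R) (p k : ℕ) (f : (ℕ → ℤ) → R) (z : ℕ → ℤ) : R :=
  ∑ x ∈ box p k z, rowV u v lam p k z x * f x

theorem rowSum_ne_last (u v lam : R) (p k : ℕ) (f : (ℕ → ℤ) → R) (z : ℕ → ℤ) :
    ∑ x ∈ box p (k + 1) z, (if x (p + k) = z (p + k + 1) then 0 else
      rowV u v lam p (k + 1) z x * f x) =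
      rowSum u v lam p (k + 1) f (Function.update z (p + k + 1) (z (p + k + 1) - 1)) := by
  rw [sum_box_ne_last, rowSum]
  refine Finset.sum_congr rfl fun x _ => ?_
  rw [rowV_update _ _ _ _ (by omega)]

theorem rowSum_zero (u v lam : R) (p : ℕ) (f : (ℕ → ℤ) → R) (z : ℕ → ℤ) :
    rowSum u v lam p 0 f z = f fun j => z (skip p j) := by
  simp [rowSum, box, rowV]

theorem rowSum_one (u v lam : R) (p : ℕ) (f : (ℕ → ℤ) → R) (z : ℕ → ℤ) :
    rowSum u v lam p 1 f z = ∑ t ∈ Finset.Icc (z p) (z (p + 1)),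
      (lam + (1 - lam) * (if t = z p then 0 else 1)) *
        rowSum u v lam p 0 f (Function.update z (p + 1) t) := by
  rw [rowSum, sum_box_succ]
  refine Finset.sum_congr rfl fun t _ => ?_
  rw [rowSum, Finset.mul_sum]
  refine Finset.sum_congr rfl fun x hx => ?_
  have h1 := box_apply_last hx
  rw [add_zero, Function.update_self] at h1
  simp only [rowV, h1]
  split_ifs <;> ring

/-- Let S be the sum for fixed last entry t, and S' the sum with the bound z_{p+k+1} lowered by one,
which excludes x_{p+k} = z_{p+k+1}. If t > z_{p+k+1}, the excluded rows get the factor u, giving u S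
+ (1 - u) S'. If t = z_{p+k+1}, they are forbidden and the others get v, giving v S'. -/
theorem rowSum_add_two (u v lam : R) (p k : ℕ) (f : (ℕ → ℤ) → R) (z : ℕ → ℤ) :
    rowSum u v lam p (k + 2) f z = ∑ t ∈ Finset.Icc (z (p + k + 1)) (z (p + k + 2)),
      (u * (if t = z (p + k + 1) then 0 else 1) *
        rowSum u v lam p (k + 1) f (Function.update z (p + k + 2) t) +
      (v + (1 - u - v) * (if t = z (p + k + 1) then 0 else 1)) *
        rowSum u v lam p (k + 1) f (Function.update (Function.update z (p + k + 2) t) (p + k + 1)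
          (z (p + k + 1) - 1))) := by
  rw [rowSum, sum_box_succ]
  refine Finset.sum_congr rfl fun t ht => ?_
  have h2 := rowSum_ne_last u v lam p k f (Function.update z (p + k + 2) t)
  rw [Function.update_of_ne (by omega)] at h2
  rw [← h2, rowSum, Finset.mul_sum, Finset.mul_sum, ← Finset.sum_add_distrib]
  refine Finset.sum_congr rfl fun x hx => ?_
  have h1 := box_apply_last hx
  have h3 := ((mem_box.1 hx).2.1 (p + k) (by omega) (by omega)).2
  rw [← add_assoc, Function.update_self] at h1
  rw [add_assoc, Function.update_of_ne (by omega)] at h3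
  rw [rowV_update _ _ _ _ (by omega)]
  simp only [rowV, h1]
  have h4 := (Finset.mem_Icc.1 ht).1
  by_cases ha : x (p + k) = z (p + k + 1) <;> by_cases hb : t = z (p + k + 1)
  · simp [ha, hb]
  · simp [ha, hb, Ne.symm hb]
    ring
  · simp [ha, hb]
    ring
  · have : x (p + k) ≠ t := by omega
    simp [ha, hb, this]
    ring

end RowWeights

/-! ### The alternating sums `phi` and their boundary terms -/

section RowPolynomials

variable {R : Type*} [CommRing R]

/-- `opP`, with `lam` instead of `v` for the index `p`. -/
noncomputable def opPfl (v lam : R) (p i : ℕ) : Op R := if i = p then opP lam p else opP v i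

/-- The summand where `x_{p+k}` is omitted. -/
noncomputable def theta (v lam : R) (p k : ℕ) (B : MvPolynomial ℕ R) : MvPolynomial ℕ R :=
  ((-1 : Op R) ^ k * ∏ i ∈ Finset.Ico p (p + k), opPfl v lam p i) • rename (skip (p + k)) B

/-- The polynomial that computes `rowSum` for the summand with antidifference `B`. -/
noncomputable def phi (u v lam : R) (p : ℕ) : ℕ → MvPolynomial ℕ R → MvPolynomial ℕ R
  | 0, B => theta v lam p 0 B
  | k + 1, B => (sh 1 (p + k + 1) * opQ u (p + k)) • phi u v lam p k B + theta v lam p (k + 1) B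

theorem indepVar_theta (v lam : R) (p k : ℕ) (B : MvPolynomial ℕ R) :
    IndepVar (p + k) (theta v lam p k B) := (indepVar_skip _ _).smul _

theorem theta_smul (v lam : R) (p k : ℕ) {a b : Op R} (h : Inter (skip (p + k)) a b)
    (B : MvPolynomial ℕ R) : theta v lam p k (a • B) = b • theta v lam p k B := by
  rw [theta, theta, h, smul_comm]

theorem phi_smul (u v lam : R) (p k : ℕ) {a b : Op R}
    (h : ∀ r, r ≤ p + k → Inter (skip r) a b) (B : MvPolynomial ℕ R) :
    phi u v lam p k (a • B) = b • phi u v lam p k B := by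
  induction k with
  | zero => exact theta_smul v lam p 0 (h _ le_rfl) B
  | succ k ih =>
    rw [phi, phi, ih fun r hr => h r (by omega), theta_smul v lam p (k + 1) (h _ le_rfl), smul_add,
      smul_comm]

/-- Every index omitted in `phi` is at most p + k, so the variable x_j with j ≥ p + k is always
renumbered to x_{j+1}. -/
theorem phi_fwd (u v lam : R) {p k j : ℕ} (hj : p + k ≤ j) (B : MvPolynomial ℕ R) :
    phi u v lam p k ((fwd j : Op R) • B) = (fwd (j + 1) : Op R) • phi u v lam p k B := by
  refine phi_smul u v lam p k (fun r hr => ?_) B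
  have := Inter.fwd (R := R) (skip_injective r) j
  rwa [skip_of_le (by omega)] at this

theorem swap_of_lt {i j : ℕ} (h : i < j) : Equiv.swap j (j + 1) i = i :=
  Equiv.swap_apply_of_ne_of_ne (by omega) (by omega)

theorem inter_swap_opPfl (v lam : R) (p : ℕ) {i j : ℕ} (h : i < j) :
    Inter (Equiv.swap j (j + 1)) (opPfl v lam p i) (opPfl v lam p i) := by
  unfold opPfl
  split_ifs with hi
  · subst hi
    have := Inter.opP (Equiv.swap j (j + 1)).injective lam i
    rwa [swap_of_lt h] at this
  · have := Inter.opP (Equiv.swap j (j + 1)).injective v i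
    rwa [swap_of_lt h] at this

theorem inter_neg_one_pow (f : ℕ → ℕ) (k : ℕ) : Inter f ((-1 : Op R) ^ k) ((-1) ^ k) := by
  induction k with
  | zero => simpa using Inter.one
  | succ k ih =>
    rw [pow_succ]
    exact ih.mul Inter.one.neg

theorem anti_theta {u v lam : R} {p k j : ℕ} {B : MvPolynomial ℕ R} (h : Anti u v j B)
    (hj : p + k ≤ j) : Anti u v (j + 1) (theta v lam p k B) := by
  refine (h.rename_skip hj).smul ((inter_neg_one_pow _ k).mul (Inter.prod _ _ _ fun i hi => ?_))
  exact inter_swap_opPfl v lam p (by have := (Finset.mem_Ico.1 hi).2; omega)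

theorem anti_phi {u v lam : R} {p k j : ℕ} {B : MvPolynomial ℕ R} (h : Anti u v j B)
    (hj : p + k ≤ j) : Anti u v (j + 1) (phi u v lam p k B) := by
  induction k with
  | zero => exact anti_theta h hj
  | succ k ih =>
    refine ((ih (by omega)).smul ?_).add (anti_theta h hj)
    have i1 := Inter.shift (R := R) (Equiv.swap (j + 1) (j + 1 + 1)).injective 1 (p + k + 1)
    have i2 := Inter.opQ (Equiv.swap (j + 1) (j + 1 + 1)).injective u (p + k)
    rw [swap_of_lt (by omega)] at i1 i2
    exact i1.mul i2

/-- The transposition moves the omitted index from p + k to p + k + 1 and carries P_{p+k+1} to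
P_{p+k}, exactly the factor that the next term has in addition; the sign comes from (-1)^k. The
first factor carries `lam`, hence the case k = 0. -/
theorem rename_swap_theta (v lam : R) (p k : ℕ) (B : MvPolynomial ℕ R) :
    rename (Equiv.swap (p + k) (p + k + 1))
      ((if k = 0 then opP lam (p + k + 1) else opP v (p + k + 1)) • theta v lam p k B) =
      -theta v lam p (k + 1) B := by
  have i1 : Inter (Equiv.swap (p + k) (p + k + 1))
      (if k = 0 then opP lam (p + k + 1) else opP v (p + k + 1))
      (opPfl v lam p (p + k)) := by
    have h1 := Inter.opP (Equiv.swap (p + k) (p + k + 1)).injective lam (p + k + 1)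
    have h2 := Inter.opP (Equiv.swap (p + k) (p + k + 1)).injective v (p + k + 1)
    rw [Equiv.swap_apply_right] at h1 h2
    by_cases hk : k = 0
    · subst hk
      simpa [opPfl] using h1
    · simpa [opPfl, hk] using h2
  have i2 : Inter (Equiv.swap (p + k) (p + k + 1))
      ((-1 : Op R) ^ k * ∏ i ∈ Finset.Ico p (p + k), opPfl v lam p i)
      ((-1 : Op R) ^ k * ∏ i ∈ Finset.Ico p (p + k), opPfl v lam p i) :=
    (inter_neg_one_pow _ k).mul (Inter.prod _ _ _ fun i hi =>
      inter_swap_opPfl v lam p (Finset.mem_Ico.1 hi).2)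
  have hren : rename (Equiv.swap (p + k) (p + k + 1)) (rename (skip (p + k)) B) =
      rename (skip (p + (k + 1))) B := by
    rw [rename_rename]
    congr 2
    funext i
    simp only [Function.comp_apply, Equiv.swap_apply_def, skip]
    split_ifs <;> omega
  rw [theta, i1, i2, hren, theta, ← add_assoc p k 1, Finset.prod_Ico_succ_top (by omega),
    ← mul_smul, ← neg_smul]
  congr 1
  rw [pow_succ]
  ring

/-- The value of `theta` on the diagonal. -/
theorem evalAt_theta_succ (v lam : R) (p k : ℕ) (B : MvPolynomial ℕ R) {z : ℕ → ℤ}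
    (hz : z (p + k) = z (p + k + 1)) : evalAt z (theta v lam p (k + 1) B) =
      -evalAt z ((if k = 0 then opP lam (p + k + 1) else opP v (p + k + 1)) •
        theta v lam p k B) := by
  rw [← neg_eq_iff_eq_neg, ← evalAt_neg, ← rename_swap_theta, evalAt_rename, comp_swap_of_eq hz]

/-- Start of the recursion: with one free entry there is no pair of neighbours, so the lower
boundary term involves P with `lam` instead of Strict. -/
theorem evalAt_phi_one (u v lam : R) (p : ℕ) (B : MvPolynomial ℕ R) (z : ℕ → ℤ) :
    evalAt z (phi u v lam p 1 B) = evalAt z (sh (1 : R) (p + 1) • phi u v lam p 0 B) -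
      evalAt (Function.update z (p + 1) (z p)) (opP lam (p + 1) • phi u v lam p 0 B) := by
  have h1 := evalAt_update_of_indepVar (indepVar_theta v lam p 1 B) z (z p)
  have h0 : phi u v lam p 1 B =
    (sh 1 (p + 0 + 1) * opQ u (p + 0)) • phi u v lam p 0 B + theta v lam p 1 B := rfl
  rw [h0, evalAt_add, ← h1, evalAt_theta_succ v lam p 0 B (by simp), mul_smul]
  have h2 : opQ u (p + 0) • phi u v lam p 0 B = phi u v lam p 0 B :=
    (indepVar_theta v lam p 0 B).opQ u
  rw [h2, if_pos rfl, sub_eq_add_neg]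
  rfl

variable [Algebra ℚ R]

/-- The form produced by telescoping the last free entry: an upper boundary term minus a Strict term
on the diagonal. The diagonal term is the new summand `theta`, up to sign. -/
theorem evalAt_phi_add_two (u v lam : R) (p k : ℕ) {B : MvPolynomial ℕ R}
    (hB : Anti u v (p + k) B) (z : ℕ → ℤ) :
    evalAt z (phi u v lam p (k + 2) B) =
      evalAt z ((sh (1 : R) (p + k + 2) * opQ u (p + k + 1)) • phi u v lam p (k + 1) B) -
      evalAt (Function.update z (p + k + 2) (z (p + k + 1)))
        (opStrict u v (p + k + 1) (p + k + 2) • phi u v lam p (k + 1) B) := by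
  set z' := Function.update z (p + k + 2) (z (p + k + 1)) with hz'
  have hdiag : z' (p + k + 1) = z' (p + k + 1 + 1) := by
    rw [hz', Function.update_of_ne (by omega)]
    exact (Function.update_self (p + k + 2) (z (p + k + 1)) z).symm
  have h1 := evalAt_update_of_indepVar (indepVar_theta v lam p (k + 2) B) z (z (p + k + 1))
  -- The part inherited from `phi` with k entries carries the factor E_{p+k+1}, so antisymmetry
  -- kills it on the diagonal.
  have h2 : evalAt z' (opStrict u v (p + k + 1) (p + k + 2) •
      (sh 1 (p + k + 1) * opQ u (p + k)) • phi u v lam p k B) = 0 := by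
    have ha : Anti u v (p + k + 1) (opQ u (p + k) • phi u v lam p k B) := by
      refine (anti_phi hB le_rfl).smul ?_
      have i2 := Inter.opQ (Equiv.swap (p + k + 1) (p + k + 1 + 1)).injective u (p + k)
      rwa [swap_of_lt (by omega)] at i2
    rw [mul_smul]
    exact ha.eval hdiag
  -- The remaining `theta` lacks x_{p+k+1}, so Strict acts on it as P_{p+k+2}.
  have h3 : evalAt z' (opStrict u v (p + k + 1) (p + k + 2) • phi u v lam p (k + 1) B) =
      evalAt z' (opP v (p + (k + 1) + 1) • theta v lam p (k + 1) B) := by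
    rw [phi, smul_add, evalAt_add, h2, zero_add]
    congr 1
    exact (indepVar_theta v lam p (k + 1) B).opStrict_left u v _
  rw [h3]
  have h4 := evalAt_theta_succ v lam p (k + 1) B hdiag
  rw [if_neg (by omega)] at h4
  rw [phi, evalAt_add, ← h1]
  rw [show p + (k + 2) = p + k + 2 by omega, ← hz', h4, sub_eq_add_neg]
  rfl

end RowPolynomials

/-! ### Telescoping, and evaluation of the basic operators -/

section RowSums

variable {R : Type*} [CommRing R]

theorem sum_Icc_telescope {X Y : ℤ} (h : X ≤ Y) (g : ℤ → R) :
    ∑ t ∈ Finset.Icc X Y, (g (t + 1) - g t) = g (Y + 1) - g X := by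
  obtain ⟨m, rfl⟩ : ∃ m : ℕ, Y = X + m := ⟨(Y - X).toNat, by omega⟩
  clear h
  induction m with
  | zero => simp
  | succ m ih =>
    have : Finset.Icc X (X + (m + 1 : ℕ)) = insert (X + (m : ℤ) + 1) (Finset.Icc X (X + m)) := by
      ext a
      simp only [Finset.mem_Icc, Finset.mem_insert]
      omega
    rw [this, Finset.sum_insert (by simp), ih]
    push_cast
    rw [← add_assoc]
    ring

theorem sum_Icc_ne_left {X Y : ℤ} (h : X ≤ Y) (g : ℤ → R) :
    ∑ t ∈ Finset.Icc X Y, (if t = X then 0 else 1) * g t = (∑ t ∈ Finset.Icc X Y, g t) - g X := by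
  have : ∀ t ∈ Finset.Icc X Y, (if t = X then 0 else 1) * g t = g t - if t = X then g t else 0 := by
    intro t _
    split_ifs <;> simp
  rw [Finset.sum_congr rfl this, Finset.sum_sub_distrib, Finset.sum_ite_eq' (Finset.Icc X Y) X g,
    if_pos (Finset.mem_Icc.2 ⟨le_rfl, h⟩)]

theorem evalAt_opQ (u : R) (i : ℕ) (p : MvPolynomial ℕ R) (z : ℕ → ℤ) :
    evalAt z (opQ u i • p) =
      u * evalAt z p + (1 - u) * evalAt (Function.update z i (z i - 1)) p := by
  have h : (bwd i : Op R) • p = p - sh (-1 : R) i • p := by rw [bwd, sub_smul, one_smul]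
  rw [opQ, add_smul, smul_assoc, one_smul, evalAt_add, evalAt_smul, h, evalAt_sub,
    evalAt_sh_neg_one]
  ring

theorem evalAt_opP (v : R) (i : ℕ) (p : MvPolynomial ℕ R) (z : ℕ → ℤ) :
    evalAt z (opP v i • p) =
      v * evalAt z p + (1 - v) * evalAt (Function.update z i (z i + 1)) p := by
  have h : (fwd i : Op R) • p = sh (1 : R) i • p - p := by rw [fwd, sub_smul, one_smul]
  rw [opP, add_smul, smul_assoc, one_smul, evalAt_add, evalAt_smul, h, evalAt_sub,
    evalAt_sh_one]
  ring

theorem evalAt_fwd (i : ℕ) (p : MvPolynomial ℕ R) (z : ℕ → ℤ) :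
    evalAt z ((fwd i : Op R) • p) = evalAt (Function.update z i (z i + 1)) p - evalAt z p := by
  rw [fwd, sub_smul, one_smul, evalAt_sub, evalAt_sh_one]

theorem evalAt_opStrict (u v : R) {i j : ℕ} (hij : i ≠ j) (p : MvPolynomial ℕ R) (z : ℕ → ℤ) :
    evalAt z (opStrict u v i j • p) =
      u * evalAt (Function.update z j (z j + 1)) p +
      v * evalAt (Function.update z i (z i - 1)) p +
      (1 - u - v) * evalAt (Function.update (Function.update z j (z j + 1)) i (z i - 1)) p := by
  rw [opStrict, add_smul, add_smul, smul_assoc, smul_assoc, smul_assoc, mul_smul, evalAt_add,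
    evalAt_add, evalAt_smul, evalAt_smul, evalAt_smul, evalAt_sh_neg_one, evalAt_sh_neg_one,
    evalAt_sh_one, evalAt_sh_one, Function.update_of_ne hij.symm, Function.update_comm hij]

end RowSums

/-! ### Row sums are values of the row polynomials -/

section RowSums

variable {R : Type*} [CommRing R]

/-- The forward differences in `x_p, …, x_{p+k-1}`. -/
noncomputable def fwdProd (R : Type*) [CommRing R] (p k : ℕ) : Op R :=
  ∏ j ∈ Finset.Ico p (p + k), fwd j

theorem fwdProd_succ_smul (p k : ℕ) (B : MvPolynomial ℕ R) :
    fwdProd R p (k + 1) • B = fwdProd R p k • (fwd (p + k) : Op R) • B := by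
  rw [fwdProd, ← add_assoc, Finset.prod_Ico_succ_top (by omega), mul_smul, fwdProd]

theorem Anti.fwd {u v : R} {i j : ℕ} {B : MvPolynomial ℕ R} (h : Anti u v j B) (hi : j + 1 < i) :
    Anti u v j ((fwd i : Op R) • B) := by
  refine h.smul ?_
  have := Inter.fwd (R := R) (Equiv.swap j (j + 1)).injective i
  rwa [Equiv.swap_apply_of_ne_of_ne (by omega) (by omega)] at this

variable [Algebra ℚ R]

omit [Algebra ℚ R] in
/-- The sum over one further entry, for the step of `rowSum_eq_phi_of_strict`. -/
theorem sum_strict_step (u v : R) {X Y : ℤ} (hXY : X ≤ Y) (g h : ℤ → R) :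
    ∑ t ∈ Finset.Icc X Y, (u * (if t = X then 0 else 1) * (g (t + 1) - g t) +
      (v + (1 - u - v) * (if t = X then 0 else 1)) * (h (t + 1) - h t)) =
    u * g (Y + 1) + (1 - u) * h (Y + 1) -
      (u * g (X + 1) + v * h X + (1 - u - v) * h (X + 1)) := by
  have e : ∀ t ∈ Finset.Icc X Y, (u * (if t = X then 0 else 1) * (g (t + 1) - g t) +
      (v + (1 - u - v) * (if t = X then 0 else 1)) * (h (t + 1) - h t)) =
      u * ((if t = X then 0 else 1) * (g (t + 1) - g t)) + v * (h (t + 1) - h t) +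
      (1 - u - v) * ((if t = X then 0 else 1) * (h (t + 1) - h t)) := fun t _ => by ring
  rw [Finset.sum_congr rfl e, Finset.sum_add_distrib, Finset.sum_add_distrib, ← Finset.mul_sum,
    ← Finset.mul_sum, ← Finset.mul_sum, sum_Icc_ne_left hXY, sum_Icc_ne_left hXY,
    sum_Icc_telescope hXY, sum_Icc_telescope hXY]
  ring

omit [Algebra ℚ R] in
theorem rowSum_eq_phi_zero (u v lam : R) (p : ℕ) (B : MvPolynomial ℕ R) (z : ℕ → ℤ) :
    rowSum u v lam p 0 (fun x => evalAt x (fwdProd R p 0 • B)) z =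
      evalAt z (phi u v lam p 0 B) := by
  rw [rowSum_zero, phi, theta, add_zero, pow_zero, one_mul, Finset.Ico_self, Finset.prod_empty,
    one_smul, evalAt_rename, fwdProd, add_zero, Finset.Ico_self, Finset.prod_empty, one_smul]

omit [Algebra ℚ R] in
theorem rowSum_eq_phi_one (u v lam : R) (p : ℕ) (B : MvPolynomial ℕ R) (z : ℕ → ℤ)
    (hz : z p ≤ z (p + 1)) :
    rowSum u v lam p 1 (fun x => evalAt x (fwdProd R p 1 • B)) z =
      evalAt z (phi u v lam p 1 B) := by
  rw [rowSum_one, evalAt_phi_one, evalAt_sh_one, evalAt_opP, Function.update_self,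
    Function.update_idem]
  simp only [fwdProd_succ_smul p 0 B, add_zero, rowSum_eq_phi_zero]
  have hG : phi u v lam p 0 ((fwd p : Op R) • B) = (fwd (p + 1) : Op R) • phi u v lam p 0 B :=
    phi_fwd u v lam le_rfl B
  rw [hG]
  simp only [evalAt_fwd, Function.update_self, Function.update_idem]
  set g : ℤ → R := fun t => evalAt (Function.update z (p + 1) t) (phi u v lam p 0 B) with hg
  have e : ∀ t ∈ Finset.Icc (z p) (z (p + 1)),
      (lam + (1 - lam) * (if t = z p then 0 else 1)) * (g (t + 1) - g t) =
      lam * (g (t + 1) - g t) + (1 - lam) * ((if t = z p then 0 else 1) * (g (t + 1) - g t)) :=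
    fun t _ => by ring
  change ∑ t ∈ Finset.Icc (z p) (z (p + 1)),
      (lam + (1 - lam) * (if t = z p then 0 else 1)) * (g (t + 1) - g t) =
    g (z (p + 1) + 1) - (lam * g (z p) + (1 - lam) * g (z p + 1))
  rw [Finset.sum_congr rfl e, Finset.sum_add_distrib, ← Finset.mul_sum, ← Finset.mul_sum,
    sum_Icc_ne_left hz, sum_Icc_telescope hz]
  ring

theorem evalAt_phi_add_two' (u v lam : R) (p k : ℕ) {B : MvPolynomial ℕ R}
    (hB : Anti u v (p + k) B) (z : ℕ → ℤ) (g h : ℤ → R)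
    (hg : g = fun t => evalAt (Function.update z (p + k + 2) t) (phi u v lam p (k + 1) B))
    (hh : h = fun t => evalAt (Function.update (Function.update z (p + k + 2) t) (p + k + 1)
      (z (p + k + 1) - 1)) (phi u v lam p (k + 1) B)) :
    evalAt z (phi u v lam p (k + 2) B) =
      u * g (z (p + k + 2) + 1) + (1 - u) * h (z (p + k + 2) + 1) -
      (u * g (z (p + k + 1) + 1) + v * h (z (p + k + 1)) +
        (1 - u - v) * h (z (p + k + 1) + 1)) := by
  rw [evalAt_phi_add_two u v lam p k hB, mul_smul, evalAt_sh_one, evalAt_opQ,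
    evalAt_opStrict _ _ (by omega)]
  simp only [Function.update_self, Function.update_idem,
    Function.update_of_ne (show p + k + 1 ≠ p + k + 2 by omega), hg, hh]

/-- The sum over the last entry telescopes because its dependence is a forward difference;
`evalAt_phi_add_two` identifies the boundary terms. The last inequality is only required weakly,
since the induction lowers that upper bound by one. -/
theorem rowSum_eq_phi_of_strict (u v lam : R) (p k : ℕ) (B : MvPolynomial ℕ R)
    (hB : ∀ j, p ≤ j → j + 1 < p + k → Anti u v j B) (z : ℕ → ℤ)
    (h1 : ∀ i, p ≤ i → i + 1 < p + k → z i < z (i + 1))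
    (h2 : ∀ i, p ≤ i → i + 1 = p + k → z i ≤ z (i + 1)) :
    rowSum u v lam p k (fun x => evalAt x (fwdProd R p k • B)) z =
      evalAt z (phi u v lam p k B) := by
  induction k using Nat.strong_induction_on generalizing B z with
  | _ k ih =>
    match k with
    | 0 => exact rowSum_eq_phi_zero u v lam p B z
    | 1 => exact rowSum_eq_phi_one u v lam p B z (h2 p le_rfl rfl)
    | k + 2 =>
      have hle : z (p + k + 1) ≤ z (p + k + 2) := h2 (p + k + 1) (by omega) (by omega)
      obtain ⟨g, hg⟩ : ∃ g : ℤ → R, g = fun t => evalAt (Function.update z (p + k + 2) t)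
        (phi u v lam p (k + 1) B) := ⟨_, rfl⟩
      obtain ⟨h, hh⟩ : ∃ h : ℤ → R, h = fun t => evalAt (Function.update
        (Function.update z (p + k + 2) t) (p + k + 1) (z (p + k + 1) - 1))
        (phi u v lam p (k + 1) B) := ⟨_, rfl⟩
      rw [rowSum_add_two, evalAt_phi_add_two' u v lam p k
        (hB (p + k) (by omega) (by omega)) z g h hg hh, ← sum_strict_step u v hle g h]
      refine Finset.sum_congr rfl fun t _ => ?_
      rw [hg, hh]
      simp only [fwdProd_succ_smul p (k + 1) B]
      have hG : ∀ j, p ≤ j → j + 1 < p + (k + 1) →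
          Anti u v j ((fwd (p + (k + 1)) : Op R) • B) := fun j hj hj' =>
        (hB j hj (by omega)).fwd (by omega)
      -- Strictness is used here: it gives z_{p+k} ≤ z_{p+k+1} - 1, so the induction hypothesis also
      -- covers the lowered bound.
      have hz := h1 (p + k) (by omega) (by omega)
      rw [ih (k + 1) (by omega) _ hG, ih (k + 1) (by omega) _ hG, phi_fwd u v lam le_rfl,
        evalAt_fwd, evalAt_fwd]
      · have hne : p + (k + 1) + 1 ≠ p + k + 1 := by omega
        rw [Function.update_of_ne hne, Function.update_comm hne.symm]
        simp only [← add_assoc, Function.update_self, Function.update_idem]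
      · intro i hi hi'
        rw [Function.update_of_ne (by omega), Function.update_of_ne (by omega),
          Function.update_of_ne (by omega), Function.update_of_ne (by omega)]
        exact h1 i hi (by omega)
      · intro i hi hi'
        obtain rfl : i = p + k := by omega
        rw [Function.update_self, Function.update_of_ne (by omega),
          Function.update_of_ne (by omega)]
        omega
      · intro i hi hi'
        rw [Function.update_of_ne (by omega), Function.update_of_ne (by omega)]
        exact h1 i hi (by omega)
      · intro i hi hi'
        obtain rfl : i = p + k := by omega
        rw [Function.update_of_ne (by omega), Function.update_of_ne (by omega)]
        omega

omit [Algebra ℚ R] in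
theorem opQ_one (i : ℕ) : opQ (1 : R) i = 1 := by rw [opQ, sub_self, zero_smul, add_zero]

omit [Algebra ℚ R] in
theorem opP_one (i : ℕ) : opP (1 : R) i = 1 := by rw [opP, sub_self, zero_smul, add_zero]

omit [Algebra ℚ R] in
-- For u = 1 no Q occurs, the new summand lacks x_{p+k+1}, and the backward difference of E is the
-- forward difference.
theorem bwd_smul_phi_succ (lam : R) (v : R) (p k : ℕ) (G : MvPolynomial ℕ R) :
    (bwd (p + k + 1) : Op R) • phi 1 v lam p (k + 1) G =
      (fwd (p + k + 1) : Op R) • phi 1 v lam p k G := by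
  rw [phi, opQ_one, mul_one, smul_add, ← mul_smul, bwd_mul_sh]
  have := (indepVar_theta v lam p (k + 1) G).bwd
  rw [← add_assoc] at this
  rw [this, add_zero]

/-- The recursion of the row polynomials for `u = v = 1`. -/
theorem evalAt_phi_weak_step (p k : ℕ) {B : MvPolynomial ℕ R}
    (hB : Anti 1 1 (p + k) B) (z : ℕ → ℤ) (hz : z (p + k + 1) ≤ z (p + k + 2)) :
    evalAt z (phi (1 : R) 1 1 p (k + 2) B) =
      ∑ t ∈ Finset.Icc (z (p + k + 1)) (z (p + k + 2)), evalAt (Function.update z (p + k + 2) t)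
        (phi 1 1 1 p (k + 1) ((fwd (p + k + 1) : Op R) • B)) -
      evalAt (Function.update z (p + k + 2) (z (p + k + 1)))
        (phi 1 1 1 p k ((fwd (p + k) : Op R) • (fwd (p + k + 1) : Op R) • B)) := by
  rw [evalAt_phi_add_two' 1 1 1 p k hB z _ _ rfl rfl]
  set z' := Function.update z (p + k + 2) (z (p + k + 1)) with hz'
  rw [phi_fwd 1 1 1 le_rfl, ← bwd_smul_phi_succ]
  have hG : phi 1 1 1 p (k + 1) ((fwd (p + k + 1) : Op R) • B) =
    (fwd (p + k + 2) : Op R) • phi 1 1 1 p (k + 1) B := phi_fwd 1 1 1 le_rfl B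
  rw [hG, bwd, sub_smul, one_smul, evalAt_sub, evalAt_sh_neg_one]
  simp only [evalAt_fwd, Function.update_self, Function.update_idem, hz',
    Function.update_of_ne (show p + k + 1 ≠ p + k + 2 by omega),
    Function.update_of_ne (show p + k + 2 ≠ p + k + 1 by omega),
    Function.update_comm (show p + k + 1 ≠ p + k + 2 by omega)]
  rw [sum_Icc_telescope hz
    (fun t => evalAt (Function.update z (p + k + 2) t) (phi 1 1 1 p (k + 1) B))]
  ring

omit [Algebra ℚ R] in
/-- The recursion of the row sums for `u = v = 1`. -/
theorem rowSum_weak_step (p k : ℕ) (f : (ℕ → ℤ) → R) (z : ℕ → ℤ)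
    (h1 : z (p + k) ≤ z (p + k + 1)) (h2 : z (p + k + 1) ≤ z (p + k + 2))
    (hf : ∀ x ∈ box p k (Function.update z (p + k + 2) (z (p + k + 1))), ∀ j, p ≤ j →
      j + 2 < p + k + 2 → x j = x (j + 1) → x (j + 1) = x (j + 2) → f x = 0) :
    rowSum 1 1 1 p (k + 2) f z =
      ∑ t ∈ Finset.Icc (z (p + k + 1)) (z (p + k + 2)),
        rowSum 1 1 1 p (k + 1) f (Function.update z (p + k + 2) t) -
      rowSum 1 1 1 p k f (Function.update z (p + k + 2) (z (p + k + 1))) := by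
  set X := z (p + k + 1) with hX
  set z' := Function.update z (p + k + 2) X with hz'
  have hX' : z' (p + k + 1) = X := Function.update_of_ne (by omega) _ _
  have hlow := rowSum_ne_last 1 1 1 p k f z'
  rw [hX'] at hlow
  -- The forbidden rows have both last free entries equal to X. They are all rows with last entry X
  -- minus those whose preceding entry is smaller than X.
  have hT : rowSum 1 1 1 p k f z' = rowSum 1 1 1 p (k + 1) f z' -
      rowSum 1 1 1 p (k + 1) f (Function.update z' (p + k + 1) (X - 1)) := by
    rw [← hlow, rowSum, rowSum, ← Finset.sum_sub_distrib]
    have e : ∀ x ∈ box p (k + 1) z', (rowV 1 1 1 p (k + 1) z' x * f x -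
        if x (p + k) = X then 0 else rowV 1 1 1 p (k + 1) z' x * f x) =
        if x (p + k) = z' (p + k + 1) then rowV 1 1 1 p (k + 1) z' x * f x else 0 := by
      intro x _
      rw [hX']
      split_ifs <;> simp
    rw [Finset.sum_congr rfl e, sum_box_eq_last]
    · refine Finset.sum_congr rfl fun x hx => ?_
      match k with
      | 0 => simp [rowV]
      | k + 1 =>
        -- The shorter row sum does not ban this equality, but here it forces three equal entries,
        -- where f vanishes.
        by_cases hc : x (p + k) = x (p + k + 1)
        · have ha : x (p + k + 1) = X := by
            rw [(mem_box.1 hx).2.2 _ (by omega)]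
            exact hX'
          have hb : x (p + k + 2) = X := by
            rw [(mem_box.1 hx).2.2 _ (by omega), show p + k + 2 + 1 = p + (k + 1) + 2 by omega,
              hz']
            exact Function.update_self (p + (k + 1) + 2) X z
          rw [hf x hx (p + k) (by omega) (by omega) hc (by rw [ha, hb]), mul_zero, mul_zero]
        · simp [rowV, hc]
    · rw [hX', hz', Function.update_of_ne (by omega)]
      exact h1
  rw [hT, rowSum_add_two, ← hX]
  have e : ∀ t ∈ Finset.Icc X (z (p + k + 2)),
      (1 * (if t = X then 0 else 1) *
        rowSum 1 1 1 p (k + 1) f (Function.update z (p + k + 2) t) +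
      (1 + (1 - 1 - 1) * (if t = X then 0 else 1)) *
        rowSum 1 1 1 p (k + 1) f (Function.update (Function.update z (p + k + 2) t) (p + k + 1)
          (X - 1))) =
      rowSum 1 1 1 p (k + 1) f (Function.update z (p + k + 2) t) -
        if t = X then rowSum 1 1 1 p (k + 1) f (Function.update z (p + k + 2) t) -
          rowSum 1 1 1 p (k + 1) f (Function.update (Function.update z (p + k + 2) t) (p + k + 1)
            (X - 1)) else 0 := by
    intro t _
    split_ifs <;> ring
  rw [Finset.sum_congr rfl e, Finset.sum_sub_distrib, Finset.sum_ite_eq',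
    if_pos (Finset.mem_Icc.2 ⟨le_rfl, h2⟩)]

/-- With equalities in z a lowered bound may fall below its neighbour, which rules out the strict
argument. Instead both sides satisfy the inclusion–exclusion recursion that subtracts the rows whose
last two free entries coincide. -/
theorem rowSum_eq_phi_of_weak (p k N : ℕ) (hp : 1 ≤ p) (hN : p + k ≤ N) (B : MvPolynomial ℕ R)
    (hB : ∀ j, p ≤ j → j + 1 < p + k → Anti (1 : R) 1 j B) (z : ℕ → ℤ)
    (hz : ∀ i, 1 ≤ i → i < N → z i ≤ z (i + 1))
    (hf : ∀ x : ℕ → ℤ, (∀ i, 1 ≤ i → i + 1 < N → x i ≤ x (i + 1)) → ∀ j, p ≤ j → j + 2 < p + k →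
      x j = x (j + 1) → x (j + 1) = x (j + 2) → evalAt x (fwdProd R p k • B) = 0) :
    rowSum 1 1 1 p k (fun x => evalAt x (fwdProd R p k • B)) z =
      evalAt z (phi 1 1 1 p k B) := by
  induction k using Nat.strong_induction_on generalizing B z with
  | _ k ih =>
    match k with
    | 0 => exact rowSum_eq_phi_zero 1 1 1 p B z
    | 1 => exact rowSum_eq_phi_one 1 1 1 p B z (hz p hp (by omega))
    | k + 2 =>
      have hz' : ∀ t ∈ Finset.Icc (z (p + k + 1)) (z (p + k + 2)), ∀ i, 1 ≤ i → i < N →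
          Function.update z (p + k + 2) t i ≤ Function.update z (p + k + 2) t (i + 1) := by
        intro t ht i hi hi'
        rw [Finset.mem_Icc] at ht
        have := hz i hi hi'
        simp only [Function.update_apply]
        split_ifs with ha hb
        · omega
        · subst ha
          omega
        · obtain rfl : i = p + k + 1 := by omega
          omega
        · exact this
      have hle := hz (p + k + 1) (by omega) (by omega)
      have hX : z (p + k + 1) ∈ Finset.Icc (z (p + k + 1)) (z (p + k + 2)) :=
        Finset.mem_Icc.2 ⟨le_rfl, hle⟩
      rw [rowSum_weak_step p k _ z (hz _ (by omega) (by omega)) hle,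
        evalAt_phi_weak_step p k (hB (p + k) (by omega) (by omega)) z hle]
      · congr 1
        · refine Finset.sum_congr rfl fun t ht => ?_
          simp only [fwdProd_succ_smul p (k + 1) B] at hf ⊢
          exact ih (k + 1) (by omega) (by omega) _
            (fun j hj hj' => (hB j hj (by omega)).fwd (by omega)) _ (hz' t ht)
            fun x hx j hj hj' => hf x hx j hj (by omega)
        · simp only [fwdProd_succ_smul p (k + 1) B, fwdProd_succ_smul p k] at hf ⊢
          exact ih k (by omega) (by omega) _
            (fun j hj hj' => ((hB j hj (by omega)).fwd (by omega)).fwd (by omega)) _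
            (hz' _ hX) fun x hx j hj hj' => hf x hx j hj (by omega)
      · intro x hx j hj hj'
        exact hf x (box_mono hx (hz' _ hX)) j hj (by omega)

/-- The weight of the free entries `x_p, …, x_{p+k-1}` above `z_p, …, z_{p+k}`; the factors of
`x_p = z_p` and `x_{p+k-1} = z_{p+k}` are `lam` and `mu` instead of `v` and `u`. -/
def rowW {R : Type*} [CommRing R] (u v lam mu : R) (p : ℕ) : ℕ → (ℕ → ℤ) → (ℕ → ℤ) → R
  | 0, _, _ => 1
  | k + 1, z, x => rowV u v lam p (k + 1) z x * if x (p + k) = z (p + k + 1) then mu else 1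

omit [Algebra ℚ R] in
theorem sum_rowW_zero (u v lam mu : R) (p : ℕ) (f : (ℕ → ℤ) → R) (z : ℕ → ℤ) :
    ∑ x ∈ box p 0 z, rowW u v lam mu p 0 z x * f x = rowSum u v lam p 0 f z := rfl

omit [Algebra ℚ R] in
theorem sum_rowW_succ (u v lam mu : R) (p k : ℕ) (f : (ℕ → ℤ) → R) (z : ℕ → ℤ) :
    ∑ x ∈ box p (k + 1) z, rowW u v lam mu p (k + 1) z x * f x =
      mu * rowSum u v lam p (k + 1) f z + (1 - mu) *
        rowSum u v lam p (k + 1) f (Function.update z (p + k + 1) (z (p + k + 1) - 1)) := by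
  rw [← rowSum_ne_last, rowSum, Finset.mul_sum, Finset.mul_sum, ← Finset.sum_add_distrib]
  refine Finset.sum_congr rfl fun x _ => ?_
  rw [rowW]
  split_ifs <;> ring

/-- Weighting x_{p+k-1} = z_{p+k} by mu gives mu times the sum plus (1 - mu) times the sum with
z_{p+k} lowered by one, which is the action of Q with parameter mu. For k = 0 this operator acts
trivially. -/
theorem sum_rowW_of_strict (u v lam mu : R) (p k : ℕ) (B : MvPolynomial ℕ R)
    (hB : ∀ j, p ≤ j → j + 1 < p + k → Anti u v j B) (z : ℕ → ℤ)
    (hz : ∀ i, p ≤ i → i < p + k → z i < z (i + 1)) :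
    ∑ x ∈ box p k z, rowW u v lam mu p k z x * evalAt x (fwdProd R p k • B) =
      evalAt z (opQ mu (p + k) • phi u v lam p k B) := by
  match k with
  | 0 =>
    have : opQ mu (p + 0) • phi u v lam p 0 B = phi u v lam p 0 B :=
      (indepVar_theta v lam p 0 B).opQ mu
    rw [sum_rowW_zero u v lam mu p (fun x => evalAt x (fwdProd R p 0 • B)), rowSum_eq_phi_zero, this]
  | k + 1 =>
    rw [sum_rowW_succ u v lam mu p k (fun x => evalAt x (fwdProd R p (k + 1) • B)), evalAt_opQ,
      rowSum_eq_phi_of_strict u v lam p (k + 1) B hB z (fun i hi hi' => hz i hi (by omega))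
        (fun i hi hi' => (hz i hi (by omega)).le),
      rowSum_eq_phi_of_strict u v lam p (k + 1) B hB]
    · rfl
    · intro i hi hi'
      rw [Function.update_of_ne (by omega), Function.update_of_ne (by omega)]
      exact hz i hi (by omega)
    · intro i hi hi'
      obtain rfl : i = p + k := by omega
      have := hz (p + k) hi (by omega)
      rw [Function.update_self, Function.update_of_ne (by omega)]
      omega

theorem sum_rowW_of_weak (p k N : ℕ) (hp : 1 ≤ p) (hN : p + k ≤ N) (B : MvPolynomial ℕ R)
    (hB : ∀ j, p ≤ j → j + 1 < p + k → Anti (1 : R) 1 j B) (z : ℕ → ℤ)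
    (hz : ∀ i, 1 ≤ i → i < N → z i ≤ z (i + 1))
    (hf : ∀ x : ℕ → ℤ, (∀ i, 1 ≤ i → i + 1 < N → x i ≤ x (i + 1)) → ∀ j, p ≤ j → j + 2 < p + k →
      x j = x (j + 1) → x (j + 1) = x (j + 2) → evalAt x (fwdProd R p k • B) = 0) :
    ∑ x ∈ box p k z, rowW (1 : R) 1 1 1 p k z x * evalAt x (fwdProd R p k • B) =
      evalAt z (opQ (1 : R) (p + k) • phi 1 1 1 p k B) := by
  rw [opQ_one, one_smul, ← rowSum_eq_phi_of_weak p k N hp hN B hB z hz hf]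
  match k with
  | 0 => rfl
  | k + 1 =>
    rw [sum_rowW_succ 1 1 1 1 p k (fun x => evalAt x (fwdProd R p (k + 1) • B))]
    ring

end RowSums

/-! ### Deletions and exceptional entries, recorded row by row -/

/-- The numbers of deleted entries at the left and right ends of the rows, and the rows
whose leftmost or rightmost entry is exceptional. -/
structure RowData where
  /-- the number of entries deleted at the left of a row -/
  left : ℕ → ℕ
  /-- the number of entries deleted at the right of a row -/
  right : ℕ → ℕ
  /-- the leftmost entry of the row is exceptional -/
  exL : ℕ → Prop
  /-- the rightmost entry of the row is exceptional -/
  exR : ℕ → Prop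

/-- The rows `1, …, n` are nonempty, the deletions increase, and exceptional entries are bottom
entries. -/
structure RowData.Admissible (D : RowData) (n : ℕ) : Prop where
  lt : ∀ i, 1 ≤ i → i ≤ n → D.left i + D.right i < i
  left_le : ∀ i, 1 ≤ i → i < n → D.left i ≤ D.left (i + 1)
  right_le : ∀ i, 1 ≤ i → i < n → D.right i ≤ D.right (i + 1)
  exL : ∀ i, 1 ≤ i → i < n → D.exL i → D.left i < D.left (i + 1)
  exR : ∀ i, 1 ≤ i → i < n → D.exR i → D.right i < D.right (i + 1)

theorem RowData.Admissible.mono {D : RowData} {m n : ℕ} (h : D.Admissible n) (hmn : m ≤ n) :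
    D.Admissible m :=
  ⟨fun i h1 h2 => h.lt i h1 (by omega), fun i h1 h2 => h.left_le i h1 (by omega),
    fun i h1 h2 => h.right_le i h1 (by omega), fun i h1 h2 => h.exL i h1 (by omega),
    fun i h1 h2 => h.exR i h1 (by omega)⟩

theorem RowData.Admissible.left_mono {D : RowData} {n i j : ℕ} (h : D.Admissible n) (h1 : 1 ≤ i)
    (hij : i ≤ j) (hj : j ≤ n) : D.left i ≤ D.left j := by
  induction j, hij using Nat.le_induction with
  | base => exact le_rfl
  | succ j hij ih => exact (ih (by omega)).trans (h.left_le j (by omega) (by omega))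

theorem RowData.Admissible.right_mono {D : RowData} {n i j : ℕ} (h : D.Admissible n) (h1 : 1 ≤ i)
    (hij : i ≤ j) (hj : j ≤ n) : D.right i ≤ D.right j := by
  induction j, hij using Nat.le_induction with
  | base => exact le_rfl
  | succ j hij ih => exact (ih (by omega)).trans (h.right_le j (by omega) (by omega))

/-! ### The operator recursion from M rows to M + 1 rows -/

section Operators

variable {R : Type*} [CommRing R]

/-- The unrolled recursion, in the shape in which the Laplace expansion delivers it. -/
theorem phi_eq_sum (u v lam : R) (p k : ℕ) (B : MvPolynomial ℕ R) :
    phi u v lam p k B = ∑ r ∈ Finset.Icc p (p + k),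
      ((-1 : Op R) ^ (r - p) * (∏ i ∈ Finset.Ico p r, opPfl v lam p i) *
        (∏ i ∈ Finset.Ioc r (p + k), sh 1 i) * ∏ i ∈ Finset.Ico r (p + k), opQ u i) •
          rename (skip r) B := by
  induction k with
  | zero =>
    rw [add_zero, Finset.Icc_self, Finset.sum_singleton]
    simp [phi, theta]
  | succ k ih =>
    rw [phi, ih, ← add_assoc, Finset.sum_Icc_succ_top (by omega), Finset.smul_sum]
    congr 1
    · refine Finset.sum_congr rfl fun r hr => ?_
      have hr := Finset.mem_Icc.1 hr
      rw [← mul_smul, Finset.prod_Ioc_succ_top (by omega), Finset.prod_Ico_succ_top (by omega)]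
      congr 1
      ring
    · rw [theta, ← add_assoc]
      simp [Nat.add_assoc]

open Classical in
/-- The factor of the operator that belongs to the left end of a row. -/
noncomputable def rowOpL (D : RowData) (v : R) (i : ℕ) : Op R :=
  (∏ j ∈ Finset.Ico 1 (D.left i + 1), -(opPinv v j * fwd j)) *
    if D.exL i then opPinv v (D.left i + 1) else 1

open Classical in
/-- The factor of the operator that belongs to the right end of row `i`, in a triangle with
`N` rows. -/
noncomputable def rowOpR (D : RowData) (u : R) (N i : ℕ) : Op R :=
  (∏ j ∈ Finset.Ioc (N - D.right i) N, opQinv u j * bwd j) *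
    if D.exR i then opQinv u (N - D.right i) else 1

open Classical in
/-- The weight of an entry equal to the leftmost entry of row `i`. -/
noncomputable def RowData.lam (D : RowData) (v : R) (i : ℕ) : R := if D.exL i then 1 else v

open Classical in
/-- The weight of an entry equal to the rightmost entry of row `i`. -/
noncomputable def RowData.mu (D : RowData) (u : R) (i : ℕ) : R := if D.exR i then 1 else u

/-- The operator contains a difference in the absent variable x_r. -/
theorem rowOpL_smul_eq_zero (D : RowData) (v : R) {i r : ℕ} (h1 : 1 ≤ r) (h2 : r ≤ D.left i)
    {y : MvPolynomial ℕ R} (hy : IndepVar r y) : rowOpL D v i • y = 0 := by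
  rw [rowOpL, ← Finset.mul_prod_erase _ _ (Finset.mem_Ico.2 ⟨h1, Nat.lt_succ_of_le h2⟩),
    show ∀ a b c d : Op R, -(a * b) * c * d = (-(a * c * d)) * b from fun a b c d => by ring,
    mul_smul, hy.fwd, smul_zero]

theorem rowOpR_smul_eq_zero (D : RowData) (u : R) {N i r : ℕ} (h1 : N - D.right i < r)
    (h2 : r ≤ N) {y : MvPolynomial ℕ R} (hy : IndepVar r y) : rowOpR D u N i • y = 0 := by
  rw [rowOpR, ← Finset.mul_prod_erase _ _ (Finset.mem_Ioc.2 ⟨h1, h2⟩),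
    show ∀ a b c d : Op R, a * b * c * d = (a * c * d) * b from fun a b c d => by ring,
    mul_smul, hy.bwd, smul_zero]

/-- Each P_j⁻¹ cancels P_j and leaves -Δ_j. In an exceptional row the extra P⁻¹ cancels the next P,
which is P with parameter 1; if r = left + 1 there is no such P, but then P⁻¹ acts trivially on y.
-/
theorem rowOpL_smul (D : RowData) (v : R) {i r : ℕ} (hr : D.left i + 1 ≤ r)
    {y : MvPolynomial ℕ R} (hy : IndepVar r y) :
    (rowOpL D v i * ∏ j ∈ Finset.Ico 1 r, opP v j) • y =
      ((-1 : Op R) ^ D.left i * (∏ j ∈ Finset.Ico 1 (D.left i + 1), fwd j) *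
        ∏ j ∈ Finset.Ico (D.left i + 1) r, opPfl v (D.lam v i) (D.left i + 1) j) • y := by
  classical
  set p := D.left i + 1 with hp
  have h1 : (∏ j ∈ Finset.Ico 1 p, -(opPinv v j * fwd j)) * ∏ j ∈ Finset.Ico 1 p, opP v j =
      (-1 : Op R) ^ D.left i * ∏ j ∈ Finset.Ico 1 p, fwd j := by
    have : (-1 : Op R) ^ D.left i = ∏ j ∈ Finset.Ico 1 p, (-1) := by
      rw [Finset.prod_const, Nat.card_Ico, hp, Nat.add_sub_cancel]
    rw [this, ← Finset.prod_mul_distrib, ← Finset.prod_mul_distrib]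
    refine Finset.prod_congr rfl fun j _ => ?_
    rw [show ∀ a b c : Op R, -(a * b) * c = -1 * b * (c * a) from fun a b c => by ring]
    rw [opP_mul_opPinv, mul_one]
  have hcongr : ∀ a : ℕ → Op R, ∏ j ∈ Finset.Ico (p + 1) r, opPfl v (D.lam v i) p j =
      ∏ j ∈ Finset.Ico (p + 1) r, opP v j := fun _ => Finset.prod_congr rfl fun j hj => by
    rw [opPfl, if_neg (by have := (Finset.mem_Ico.1 hj).1; omega)]
  have h2 : ((if D.exL i then opPinv v p else 1) * ∏ j ∈ Finset.Ico p r, opP v j) • y =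
      (∏ j ∈ Finset.Ico p r, opPfl v (D.lam v i) p j) • y := by
    rcases hr.eq_or_lt with h | h
    · rw [← h, Finset.Ico_self, Finset.prod_empty, Finset.prod_empty, mul_one, one_smul]
      split_ifs
      · rw [← h] at hy
        exact hy.opPinv v
      · rw [one_smul]
    · rw [Finset.prod_eq_prod_Ico_succ_bot h, Finset.prod_eq_prod_Ico_succ_bot h,
        hcongr fun _ => 1]
      congr 1
      rw [opPfl, if_pos rfl, RowData.lam]
      split_ifs
      · rw [opP_one, one_mul, ← mul_assoc, mul_comm (opPinv v p), opP_mul_opPinv, one_mul]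
      · rw [one_mul]
  calc (rowOpL D v i * ∏ j ∈ Finset.Ico 1 r, opP v j) • y
      = (((∏ j ∈ Finset.Ico 1 p, -(opPinv v j * fwd j)) * ∏ j ∈ Finset.Ico 1 p, opP v j) *
        ((if D.exL i then opPinv v p else 1) * ∏ j ∈ Finset.Ico p r, opP v j)) • y := by
        rw [← Finset.prod_Ico_consecutive _ (show 1 ≤ p by omega) hr, rowOpL]
        congr 1
        simp only [← hp]
        ring
    _ = _ := by rw [mul_smul, h2, h1, mul_smul _ (∏ j ∈ Finset.Ico p r, _)]

/-- Beyond q = N - right the Q_j cancel and the backward difference of E_j becomes a forward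
difference. Since Q_r fixes y, the product of the Q_j over (r, q] may be replaced by the one over
[r, q) with Q_q kept apart, where an exceptional Q_q⁻¹ changes its parameter to 1. -/
theorem rowOpR_smul (D : RowData) (u : R) {N i r : ℕ} (hr : r ≤ N - D.right i)
    {y : MvPolynomial ℕ R} (hy : IndepVar r y) :
    (rowOpR D u N i * ((∏ j ∈ Finset.Ioc r N, opQ u j) * ∏ j ∈ Finset.Ioc r N, sh 1 j)) • y =
      ((∏ j ∈ Finset.Ioc (N - D.right i) N, fwd j) * (opQ (D.mu u i) (N - D.right i) *
        ((∏ j ∈ Finset.Ioc r (N - D.right i), sh 1 j) *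
          ∏ j ∈ Finset.Ico r (N - D.right i), opQ u j))) • y := by
  classical
  set q := N - D.right i with hq
  have hqN : q ≤ N := by omega
  have h1 : (∏ j ∈ Finset.Ioc q N, opQinv u j * bwd j) * ((∏ j ∈ Finset.Ioc q N, opQ u j) *
      ∏ j ∈ Finset.Ioc q N, sh 1 j) = ∏ j ∈ Finset.Ioc q N, fwd j := by
    rw [← Finset.prod_mul_distrib, ← Finset.prod_mul_distrib]
    refine Finset.prod_congr rfl fun j _ => ?_
    rw [← bwd_mul_sh]
    rw [show ∀ a b c d : Op R, a * b * (c * d) = b * d * (c * a) from fun a b c d => by ring,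
      opQ_mul_opQinv, mul_one]
  have h2 : ((if D.exR i then opQinv u q else 1) * ∏ j ∈ Finset.Ioc r q, opQ u j) • y =
      (opQ (D.mu u i) q * ∏ j ∈ Finset.Ico r q, opQ u j) • y := by
    rcases hr.eq_or_lt with h | h
    · rw [← h, Finset.Ioc_self, Finset.Ico_self, Finset.prod_empty, mul_one,
        mul_one, hy.opQ]
      split_ifs
      · exact hy.opQinv u
      · rw [one_smul]
    · obtain ⟨q', hq'⟩ : ∃ q', q = q' + 1 := ⟨q - 1, by omega⟩
      have e1 : Finset.Ico r q = insert r (Finset.Ioo r q) := by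
        ext a
        simp only [Finset.mem_Ico, Finset.mem_insert, Finset.mem_Ioo]
        omega
      have e2 : Finset.Ioc r q = insert q (Finset.Ioo r q) := by
        ext a
        simp only [Finset.mem_Ioc, Finset.mem_insert, Finset.mem_Ioo]
        omega
      rw [e1, e2, Finset.prod_insert (by simp), Finset.prod_insert (by simp),
        show ∀ a b c : Op R, a * (b * c) = (a * c) * b from fun a b c => by ring,
        mul_smul _ (opQ u q), ← mul_smul, mul_comm (opQ u r), ← mul_assoc, mul_smul _ (opQ u r),
        hy.opQ]
      congr 1
      rw [RowData.mu]
      split_ifs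
      · rw [opQ_one, one_mul]
        rw [show ∀ a b c : Op R, a * b * c = b * (c * a) from fun a b c => by ring,
          opQ_mul_opQinv, mul_one]
      · ring
  have hs : ∀ f : ℕ → Op R, ∏ j ∈ Finset.Ioc r N, f j =
      (∏ j ∈ Finset.Ioc r q, f j) * ∏ j ∈ Finset.Ioc q N, f j := fun f =>
    (Finset.prod_Ioc_consecutive f hr hqN).symm
  have h1' : rowOpR D u N i * ((∏ j ∈ Finset.Ioc r N, opQ u j) * ∏ j ∈ Finset.Ioc r N, sh 1 j) =
      ((∏ j ∈ Finset.Ioc q N, fwd j) * ∏ j ∈ Finset.Ioc r q, sh 1 j) *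
        ((if D.exR i then opQinv u q else 1) * ∏ j ∈ Finset.Ioc r q, opQ u j) := by
    rw [hs, hs, ← h1, rowOpR]
    simp only [← hq]
    ring
  rw [h1', mul_smul, h2, ← mul_smul]
  congr 1
  ring

/-- The operator of the left ends of the first `N` rows. -/
noncomputable def opL (D : RowData) (v : R) (N : ℕ) : Op R := ∏ i ∈ Finset.Icc 1 N, rowOpL D v i

/-- The operator of the right ends of the first `M` rows, in a triangle with `N` rows. -/
noncomputable def opR (D : RowData) (u : R) (N M : ℕ) : Op R :=
  ∏ i ∈ Finset.Icc 1 M, rowOpR D u N i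

/-- The left operators of the first M rows only involve variables up to left (M + 1). This includes
an exceptional index left i + 1, because then the deletion grows in the next row. -/
theorem inter_opL {D : RowData} {M : ℕ} (hD : D.Admissible (M + 1)) (v : R) {f : ℕ → ℕ}
    (hf : Function.Injective f) (hfix : ∀ j, j ≤ D.left (M + 1) → f j = j) :
    Inter f (opL D v M) (opL D v M) := by
  refine Inter.prod _ _ _ fun i hi => ?_
  have hi := Finset.mem_Icc.1 hi
  have hle := hD.left_mono hi.1 (show i ≤ M + 1 by omega) le_rfl
  refine Inter.mul (Inter.prod _ _ _ fun j hj => ?_) ?_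
  · have hj := Finset.mem_Ico.1 hj
    have h1 := Inter.opPinv hf v j
    have h2 := Inter.fwd (R := R) hf j
    rw [hfix j (by omega)] at h1 h2
    exact (h1.mul h2).neg
  · split_ifs with hex
    · have h1 := hD.exL i hi.1 (by omega) hex
      have h2 := hD.left_mono (show 1 ≤ i + 1 by omega) (show i + 1 ≤ M + 1 by omega) le_rfl
      have h3 := Inter.opPinv hf v (D.left i + 1)
      rwa [hfix _ (by omega)] at h3
    · exact Inter.one

/-- The right operators only involve variables from M + 1 - right (M + 1) on. The case c = 0 serves
transpositions of free variables, c = 1 the renumbering by `skip`. -/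
theorem inter_opR {D : RowData} {M : ℕ} (hD : D.Admissible (M + 1)) (u : R) {f : ℕ → ℕ}
    (hf : Function.Injective f) (c : ℕ) (hfix : ∀ j, M + 1 - D.right (M + 1) ≤ j → f j = j + c) :
    Inter f (opR D u M M) (opR D u (M + c) M) := by
  refine Inter.prod _ _ _ fun i hi => ?_
  have hi := Finset.mem_Icc.1 hi
  have hle := hD.right_mono hi.1 (show i ≤ M + 1 by omega) le_rfl
  have hlt := hD.lt i hi.1 (by omega)
  refine Inter.mul ?_ ?_
  · have e : ∏ j ∈ Finset.Ioc (M + c - D.right i) (M + c), opQinv u j * bwd j =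
        ∏ j ∈ Finset.Ioc (M - D.right i) M, opQinv u (j + c) * bwd (j + c) := by
      rw [show M + c - D.right i = M - D.right i + c by omega]
      refine Finset.prod_nbij' (fun j => j - c) (fun j => j + c) ?_ ?_ ?_ ?_ ?_
      all_goals simp only [Finset.mem_Ioc]
      · omega
      · omega
      · intro j hj
        omega
      · intro j hj
        omega
      · intro j hj
        rw [Nat.sub_add_cancel (by omega)]
    rw [e]
    refine Inter.prod _ _ _ fun j hj => ?_
    have hj := Finset.mem_Ioc.1 hj
    have h1 := Inter.opQinv hf u j
    have h2 := Inter.bwd (R := R) hf j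
    rw [hfix j (by omega)] at h1 h2
    exact h1.mul h2
  · split_ifs with hex
    · have h1 := hD.exR i hi.1 (by omega) hex
      have h2 := hD.right_mono (show 1 ≤ i + 1 by omega) (show i + 1 ≤ M + 1 by omega) le_rfl
      have h3 := Inter.opQinv hf u (M - D.right i)
      rwa [hfix _ (by omega), show M - D.right i + c = M + c - D.right i by omega] at h3
    · exact Inter.one

variable [Algebra ℚ R]

/-- The polynomial that computes the weighted number of trees with `N` rows. -/
noncomputable def treePoly (D : RowData) (u v : R) (d : ℕ) (mn : ℤ) (N : ℕ) : MvPolynomial ℕ R :=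
  (opL D v N * opR D u N N * opStrictProd u v N) • detD R N d mn

/-- The antidifference of `treePoly` in the variables of the free entries of row `M`. -/
noncomputable def antiPoly (D : RowData) (u v : R) (d : ℕ) (mn : ℤ) (M : ℕ) : MvPolynomial ℕ R :=
  ((∏ j ∈ Finset.Ico 1 (D.left (M + 1) + 1), fwd j) *
    (∏ j ∈ Finset.Ico (M + 1 - D.right (M + 1)) (M + 1), fwd j) *
    (opL D v M * opR D u M M)) • opStrictProd u v M • detC R M d mn

/-- Both x_j and x_{j+1} are free in row M, so the remaining operators do not touch them and
preserve the antisymmetry. -/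
theorem anti_antiPoly {D : RowData} {M : ℕ} (hD : D.Admissible (M + 1)) (u v : R) (d : ℕ) (mn : ℤ)
    (j : ℕ) (h1 : D.left (M + 1) + 1 ≤ j) (h2 : j + 1 < M + 1 - D.right (M + 1)) :
    Anti u v j (antiPoly D u v d mn M) := by
  refine (anti_opStrictProd_detC u v M d mn (by omega) (by omega)).smul ?_
  have hinj := (Equiv.swap j (j + 1)).injective
  have hfix : ∀ i, i < j ∨ j + 1 < i → Equiv.swap j (j + 1) i = i := fun i hi =>
    Equiv.swap_apply_of_ne_of_ne (by omega) (by omega)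
  refine Inter.mul (Inter.mul (Inter.prod _ _ _ fun i hi => ?_) (Inter.prod _ _ _ fun i hi => ?_))
    (Inter.mul (inter_opL hD v hinj fun i hi => hfix i (by omega))
      (inter_opR hD u hinj 0 fun i hi => hfix i (by omega)))
  · have hi := Finset.mem_Ico.1 hi
    have := Inter.fwd (R := R) hinj i
    rwa [hfix i (by omega)] at this
  · have hi := Finset.mem_Ico.1 hi
    have := Inter.fwd (R := R) hinj i
    rwa [hfix i (by omega)] at this

/-- The differences in the deleted and in the free places together form all M differences, which
turn `detC` into `detD`. -/
theorem fwdProd_smul_antiPoly (D : RowData) (u v : R) (d : ℕ) (mn : ℤ) (M k : ℕ)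
    (hk : D.left (M + 1) + 1 + k + D.right (M + 1) = M + 1) :
    fwdProd R (D.left (M + 1) + 1) k • antiPoly D u v d mn M = treePoly D u v d mn M := by
  have e : D.left (M + 1) + 1 + k = M + 1 - D.right (M + 1) := by omega
  rw [treePoly, ← prod_fwd_smul_detC, show Finset.Icc 1 M = Finset.Ico 1 (M + 1) from rfl,
    ← Finset.prod_Ico_consecutive _ (show 1 ≤ D.left (M + 1) + 1 by omega)
      (show D.left (M + 1) + 1 ≤ M + 1 by omega),
    ← Finset.prod_Ico_consecutive _ (show D.left (M + 1) + 1 ≤ M + 1 - D.right (M + 1) by omega)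
      (show M + 1 - D.right (M + 1) ≤ M + 1 by omega), antiPoly, fwdProd, e]
  simp only [← mul_smul]
  congr 1
  ring

/-- In the Laplace expansion the operators of row M + 1 kill every term whose omitted variable is
outside the free range and its right neighbour. In the other terms they cancel against the collapsed
Strict factors and leave the differences contained in `antiPoly`. -/
theorem treePoly_succ {D : RowData} {M : ℕ} (hM : 1 ≤ M) (hD : D.Admissible (M + 1)) (u v : R)
    (d : ℕ) (mn : ℤ) (k : ℕ) (hk : D.left (M + 1) + 1 + k + D.right (M + 1) = M + 1) :
    treePoly D u v d mn (M + 1) = opQ (D.mu u (M + 1)) (D.left (M + 1) + 1 + k) •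
      phi u v (D.lam v (M + 1)) (D.left (M + 1) + 1) k (antiPoly D u v d mn M) := by
  set p := D.left (M + 1) + 1 with hp
  have hq : p + k = M + 1 - D.right (M + 1) := by omega
  set Y := opStrictProd u v M • detC R M d mn with hY
  have hterm : ∀ r ∈ Finset.Icc 1 (M + 1), (opL D v (M + 1) * opR D u (M + 1) (M + 1) *
      opStrictProd u v (M + 1)) • (-1 : Op R) ^ (r - 1) •
        (∏ i ∈ Finset.Ioc r (M + 1), sh (1 : R) i) • rename (skip r) (detC R M d mn) =
      ((-1 : Op R) ^ (r - 1) * (opL D v M * opR D u (M + 1) M)) •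
        ((rowOpL D v (M + 1) * ∏ i ∈ Finset.Ico 1 r, opP v i) *
        (rowOpR D u (M + 1) (M + 1) * ((∏ i ∈ Finset.Ioc r (M + 1), opQ u i) *
          ∏ i ∈ Finset.Ioc r (M + 1), sh 1 i))) • rename (skip r) Y := by
    intro r hr
    have hr := Finset.mem_Icc.1 hr
    rw [mul_smul _ (opStrictProd u v (M + 1)), smul_comm (opStrictProd u v (M + 1)),
      smul_comm (opStrictProd u v (M + 1)), opStrictProd_smul_rename_skip u v hr.1 hr.2]
    rw [opL, opR, Finset.prod_Icc_succ_top (by omega), Finset.prod_Icc_succ_top (by omega),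
      ← opL, ← opR]
    simp only [← mul_smul]
    congr 1
    ring
  rw [treePoly, detD_laplace hM, Finset.smul_sum, Finset.sum_congr rfl hterm, phi_eq_sum,
    Finset.smul_sum]
  have hsub : Finset.Icc p (p + k) ⊆ Finset.Icc 1 (M + 1) := fun r hr => by
    simp only [Finset.mem_Icc] at hr ⊢
    omega
  rw [← Finset.sum_subset hsub]
  · refine Finset.sum_congr rfl fun r hr => ?_
    have hr := Finset.mem_Icc.1 hr
    have hind := indepVar_skip r Y
    have hs : rename (skip r) (antiPoly D u v d mn M) =
        ((∏ j ∈ Finset.Ico 1 p, fwd j) * (∏ j ∈ Finset.Ioc (p + k) (M + 1), fwd j) *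
          (opL D v M * opR D u (M + 1) M)) • rename (skip r) Y := by
      have e : ∏ j ∈ Finset.Ioc (p + k) (M + 1), (fwd j : Op R) =
          ∏ j ∈ Finset.Ico (M + 1 - D.right (M + 1)) (M + 1), fwd (j + 1) := by
        rw [← hq, Finset.prod_Ico_add' (fun j => (fwd j : Op R))]
        refine Finset.prod_congr ?_ fun _ _ => rfl
        ext a
        simp only [Finset.mem_Ioc, Finset.mem_Ico]
        omega
      rw [antiPoly, e]
      refine Inter.mul (Inter.mul (Inter.prod _ _ _ fun i hi => ?_)
        (Inter.prod _ _ _ fun i hi => ?_))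
        (Inter.mul (inter_opL hD v (skip_injective r) fun i hi => skip_of_lt (by omega))
          (inter_opR hD u (skip_injective r) 1 fun i hi => skip_of_le (by omega))) _
      · have hi := Finset.mem_Ico.1 hi
        have := Inter.fwd (R := R) (skip_injective r) i
        rwa [skip_of_lt (by omega)] at this
      · have hi := Finset.mem_Ico.1 hi
        have := Inter.fwd (R := R) (skip_injective r) i
        rwa [skip_of_le (by omega)] at this
    have hR := rowOpR_smul D u (N := M + 1) (i := M + 1) (r := r) (by omega) hind
    have hL := rowOpL_smul D v (i := M + 1) (r := r) (by omega) hind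
    rw [← hq] at hR
    rw [mul_smul (_ * _) (rowOpR D u (M + 1) (M + 1) * _), hR,
      smul_comm (rowOpL D v (M + 1) * ∏ i ∈ Finset.Ico 1 r, opP v i) _ (rename (skip r) Y), hL, hs]
    -- The left factors -Δ_j contribute the sign (-1)^left, and p = left + 1.
    have hsign : (-1 : Op R) ^ (r - 1) * (-1) ^ D.left (M + 1) = (-1) ^ (r - p) := by
      rw [← pow_add, show r - 1 + D.left (M + 1) = (r - p) + 2 * D.left (M + 1) by omega, pow_add,
        pow_mul]
      simp
    rw [← hsign, ← hp]
    simp only [← mul_smul]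
    congr 1
    ring
  -- Terms with r < p vanish by the left differences, terms with r > p + k by the right ones.
  · intro r hr hr'
    have hr := Finset.mem_Icc.1 hr
    rw [Finset.mem_Icc] at hr'
    have hind := indepVar_skip r Y
    rcases Nat.lt_or_ge r p with h | h
    · rw [mul_assoc (rowOpL D v (M + 1)), mul_smul (rowOpL D v (M + 1)),
        rowOpL_smul_eq_zero D v hr.1 (by omega) (hind.smul _), smul_zero]
    · rw [mul_smul (rowOpL D v (M + 1) * _), mul_smul (rowOpR D u (M + 1) (M + 1)),
        rowOpR_smul_eq_zero D u (by omega) hr.2 (hind.smul _), smul_zero, smul_zero]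

end Operators

/-! ### Induction on the number of rows -/

section Master

variable {R : Type*} [CommRing R]

/-- The number of free entries in the row above row `N`. -/
def RowData.width (D : RowData) (N : ℕ) : ℕ := N - D.right N - (D.left N + 1)

theorem RowData.Admissible.left_add_width {D : RowData} {n N : ℕ} (h : D.Admissible n) (h1 : 1 ≤ N)
    (h2 : N ≤ n) : D.left N + 1 + D.width N + D.right N = N := by
  have := h.lt N h1 h2
  unfold RowData.width
  omega

/-- The weight of the row `x` above the row `z`, the latter with number `N`. -/
noncomputable def stepWeight (D : RowData) (u v : R) (N : ℕ) (z x : ℕ → ℤ) : R :=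
  rowW u v (D.lam v N) (D.mu u N) (D.left N + 1) (D.width N) z x

/-- The weighted number of arrays with bottom row `z`, row by row; `φ` is the weight of the top
entry. -/
noncomputable def treeSum (D : RowData) (u v : R) (φ : ℤ → R) : ℕ → (ℕ → ℤ) → R
  | 0, _ => 1
  | 1, z => φ (z 1)
  | M + 2, z => ∑ x ∈ box (D.left (M + 2) + 1) (D.width (M + 2)) z,
      stepWeight D u v (M + 2) z x * treeSum D u v φ (M + 1) x

theorem rowV_eq_zero (u v lam : R) (p k : ℕ) {z x : ℕ → ℤ} {j : ℕ} (h1 : p ≤ j)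
    (h2 : j + 1 < p + k) (h : x j = x (j + 1)) : rowV u v lam p k z x = 0 := by
  induction k using Nat.strong_induction_on with
  | _ k ih =>
    match k with
    | 0 => omega
    | 1 => omega
    | k + 2 =>
      rw [rowV]
      by_cases hj : j = p + k
      · subst hj
        rw [if_pos h, mul_zero, mul_zero]
      · rw [ih (k + 1) (by omega) (by omega), zero_mul]

theorem rowW_eq_zero (u v lam mu : R) (p k : ℕ) {z x : ℕ → ℤ} {j : ℕ} (h1 : p ≤ j)
    (h2 : j + 1 < p + k) (h : x j = x (j + 1)) : rowW u v lam mu p k z x = 0 := by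
  match k with
  | 0 => omega
  | k + 1 => rw [rowW, rowV_eq_zero u v lam p (k + 1) h1 h2 h, zero_mul]

/-- Two neighbours with a copied entry among them are strictly ordered because z is; for two free
neighbours interlacing gives a weak inequality, made strict by `hd`. -/
theorem box_strictMono {p k N : ℕ} {z x : ℕ → ℤ} (h : x ∈ box p k z)
    (hz : ∀ i, 1 ≤ i → i < N → z i < z (i + 1))
    (hd : ∀ j, p ≤ j → j + 1 < p + k → x j ≠ x (j + 1)) (i : ℕ) (h1 : 1 ≤ i) (h2 : i + 1 < N) :
    x i < x (i + 1) := by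
  have hz' : ∀ i, 1 ≤ i → i < N → z i ≤ z (i + 1) := fun i h1 h2 => (hz i h1 h2).le
  have ha := box_between h hz' i h1 (by omega)
  have hb := box_between h hz' (i + 1) (by omega) h2
  obtain ⟨m1, m2, m3⟩ := mem_box.1 h
  rcases Nat.lt_or_ge i p with hi | hi
  · have := hz i h1 (by omega)
    rw [m1 i hi]
    omega
  rcases Nat.lt_or_ge (i + 1) (p + k) with hi' | hi'
  · have := hd i hi hi'
    omega
  · have := hz (i + 1) (by omega) h2
    rw [m3 (i + 1) hi']
    omega

variable [Algebra ℚ R]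

/-- The weight `(x - min) choose d` of a top entry `x`. -/
noncomputable def topWeight (R : Type*) [CommRing R] [Algebra ℚ R] (d : ℕ) (mn : ℤ) (x : ℤ) : R :=
  evalAt (fun _ => x) (binom (shiftedVar R mn 1) d)

theorem evalAt_detD_one (d : ℕ) (mn : ℤ) (z : ℕ → ℤ) :
    evalAt z (detD R 1 d mn) = topWeight R d mn (z 1) := by
  have h : detD R 1 d mn = binom (shiftedVar R mn 1) d := by
    rw [detD, Matrix.det_fin_one]
    simp
  have hr : rename (fun _ => 1) (binom (shiftedVar R mn 1) d) = binom (shiftedVar R mn 1) d := by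
    rw [map_binom]
    congr 1
    simp [shiftedVar]
  rw [h, ← hr, evalAt_rename, topWeight]

omit [Algebra ℚ R] in
theorem opPinv_one (i : ℕ) : opPinv (1 : R) i = 1 := by
  have := opP_mul_opPinv (1 : R) i
  rwa [opP_one, one_mul] at this

omit [Algebra ℚ R] in
theorem opQinv_one (i : ℕ) : opQinv (1 : R) i = 1 := by
  have := opQ_mul_opQinv (1 : R) i
  rwa [opQ_one, one_mul] at this

omit [Algebra ℚ R] in
theorem indepVar_one (r : ℕ) : IndepVar r (1 : MvPolynomial ℕ R) := by
  rw [IndepVar, sh_smul_eq_shHom, map_one]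

/-- In a single row only the operators of exceptional entries survive. They fix the constant
obtained for d = 0 and are trivial for v = 1 or u = 1; otherwise the top entry must not be
exceptional. -/
theorem treePoly_one {D : RowData} (hD : D.Admissible 1) (u v : R) (d : ℕ) (mn : ℤ)
    (htop : d = 0 ∨ ((D.exL 1 → v = 1) ∧ (D.exR 1 → u = 1))) :
    treePoly D u v d mn 1 = detD R 1 d mn := by
  classical
  have h0 := hD.lt 1 le_rfl le_rfl
  have hl : D.left 1 = 0 := by omega
  have hr : D.right 1 = 0 := by omega
  have hs : opStrictProd u v 1 = 1 := by
    rw [opStrictProd, show pairs 1 = ∅ from Finset.eq_empty_of_forall_notMem fun x hx => by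
        rw [mem_pairs] at hx
        omega,
      Finset.prod_empty]
  have hL : opL D v 1 = if D.exL 1 then opPinv v 1 else 1 := by
    rw [opL, Finset.Icc_self, Finset.prod_singleton, rowOpL, hl]
    simp
  have hR : opR D u 1 1 = if D.exR 1 then opQinv u 1 else 1 := by
    rw [opR, Finset.Icc_self, Finset.prod_singleton, rowOpR, hr]
    simp
  rw [treePoly, hs, hL, hR, mul_one]
  rcases htop with rfl | ⟨h1, h2⟩
  · have : detD R 1 0 mn = 1 := by
      rw [detD, Matrix.det_fin_one]
      simp [binom_zero]
    rw [this, mul_smul]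
    have i1 := indepVar_one (R := R) 1
    split_ifs <;> simp only [i1.opPinv, i1.opQinv, one_smul]
  · have e1 : (if D.exL 1 then opPinv v 1 else 1) = 1 := by
      split_ifs with h
      · rw [h1 h, opPinv_one]
      · rfl
    have e2 : (if D.exR 1 then opQinv u 1 else 1) = 1 := by
      split_ifs with h
      · rw [h2 h, opQinv_one]
      · rfl
    rw [e1, e2, mul_one, one_smul]

theorem sum_box_treePoly {D : RowData} {M : ℕ} (hD : D.Admissible (M + 2)) (u v : R) (d : ℕ)
    (mn : ℤ) (z : ℕ → ℤ) (hz : ∀ i, 1 ≤ i → i < M + 2 → z i < z (i + 1)) :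
    ∑ x ∈ box (D.left (M + 2) + 1) (D.width (M + 2)) z,
      stepWeight D u v (M + 2) z x * evalAt x (treePoly D u v d mn (M + 1)) =
      evalAt z (treePoly D u v d mn (M + 2)) := by
  have hk := hD.left_add_width (show 1 ≤ M + 2 by omega) le_rfl
  rw [treePoly_succ (M := M + 1) (by omega) hD u v d mn _ hk,
    ← fwdProd_smul_antiPoly D u v d mn (M + 1) _ hk]
  exact sum_rowW_of_strict u v _ _ _ _ _
    (fun j h1 h2 => anti_antiPoly hD u v d mn j h1 (by
      change j + 1 < D.left (M + 2) + 1 + D.width (M + 2) at h2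
      change j + 1 < M + 2 - D.right (M + 2)
      omega)) z
    (fun i h1 h2 => hz i (le_trans (Nat.le_add_left 1 _) h1) (by
      change i < D.left (M + 2) + 1 + D.width (M + 2) at h2
      omega))

/-- The induction hypothesis needs strictly increasing rows. A row above z either is of this kind or
has equal free neighbours and weight zero. -/
theorem evalAt_treePoly_of_strict {D : RowData} (u v : R) (d : ℕ) (mn : ℤ) {N : ℕ} (hN : 1 ≤ N)
    (hD : D.Admissible N) (htop : d = 0 ∨ ((D.exL 1 → v = 1) ∧ (D.exR 1 → u = 1)))
    (z : ℕ → ℤ) (hz : ∀ i, 1 ≤ i → i < N → z i < z (i + 1)) :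
    evalAt z (treePoly D u v d mn N) = treeSum D u v (topWeight R d mn) N z := by
  induction N, hN using Nat.le_induction generalizing z with
  | base => rw [treePoly_one hD u v d mn htop, evalAt_detD_one, treeSum]
  | succ N hN ih =>
    obtain ⟨M, rfl⟩ : ∃ M, N = M + 1 := ⟨N - 1, by omega⟩
    rw [← sum_box_treePoly hD u v d mn z hz, treeSum]
    refine Finset.sum_congr rfl fun x hx => ?_
    by_cases hd : ∀ j, D.left (M + 2) + 1 ≤ j → j + 1 < D.left (M + 2) + 1 + D.width (M + 2) →
        x j ≠ x (j + 1)
    · rw [ih (hD.mono (by omega)) x fun i h1 h2 => box_strictMono hx hz hd i h1 (by omega)]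
    · push Not at hd
      obtain ⟨j, h1, h2, h⟩ := hd
      rw [stepWeight, rowW_eq_zero _ _ _ _ _ _ h1 h2 h, zero_mul, zero_mul]

omit [Algebra ℚ R] in
-- Interlacing forces the two neighbours above the triple to equal the common value, and such
-- equality is forbidden.
theorem treeSum_eq_zero_of_triple {D : RowData} (u v : R) (φ : ℤ → R) {N j : ℕ}
    (hD : D.Admissible N) (h1 : D.left N + 1 ≤ j) (h2 : j + 2 ≤ N - D.right N) {z : ℕ → ℤ}
    (h : z j = z (j + 1)) (h' : z (j + 1) = z (j + 2)) : treeSum D u v φ N z = 0 := by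
  obtain ⟨M, rfl⟩ : ∃ M, N = M + 2 := ⟨N - 2, by omega⟩
  rw [treeSum]
  refine Finset.sum_eq_zero fun x hx => ?_
  have hk := hD.left_add_width (show 1 ≤ M + 2 by omega) le_rfl
  obtain ⟨-, m2, -⟩ := mem_box.1 hx
  have ha := m2 j h1 (by omega)
  have hb := m2 (j + 1) (by omega) (by omega)
  rw [stepWeight, rowW_eq_zero _ _ _ _ _ _ h1 (j := j) (by omega), zero_mul]
  have h2 : z (j + 1 + 1) = z (j + 2) := rfl
  omega

/-- The induction hypothesis is used twice: for the summands, and to see that the polynomial of the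
previous row vanishes on triples. -/
theorem evalAt_treePoly_of_weak {D : RowData} (d : ℕ) (mn : ℤ) {N : ℕ} (hN : 1 ≤ N)
    (hD : D.Admissible N) (z : ℕ → ℤ) (hz : ∀ i, 1 ≤ i → i < N → z i ≤ z (i + 1)) :
    evalAt z (treePoly D (1 : R) 1 d mn N) = treeSum D 1 1 (topWeight R d mn) N z := by
  induction N, hN using Nat.le_induction generalizing z with
  | base => rw [treePoly_one hD 1 1 d mn (Or.inr ⟨fun _ => rfl, fun _ => rfl⟩), evalAt_detD_one,
      treeSum]
  | succ N hN ih =>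
    obtain ⟨M, rfl⟩ : ∃ M, N = M + 1 := ⟨N - 1, by omega⟩
    have hk := hD.left_add_width (show 1 ≤ M + 2 by omega) le_rfl
    have hlam : D.lam (1 : R) (M + 2) = 1 := by simp [RowData.lam]
    have hmu : D.mu (1 : R) (M + 2) = 1 := by simp [RowData.mu]
    have hD' : D.Admissible (M + 1) := hD.mono (by omega)
    rw [treePoly_succ (M := M + 1) (by omega) hD 1 1 d mn _ hk, hlam, hmu,
      ← sum_rowW_of_weak (D.left (M + 2) + 1) (D.width (M + 2)) (M + 2) (by omega) (by omega) _
        (fun j h1 h2 => anti_antiPoly hD 1 1 d mn j h1 (by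
          change j + 1 < M + 2 - D.right (M + 2)
          omega)) z hz,
      fwdProd_smul_antiPoly D 1 1 d mn (M + 1) _ hk, treeSum]
    · refine Finset.sum_congr rfl fun x hx => ?_
      rw [ih hD' x fun i h1 h2 => box_mono hx hz i h1 (by omega), stepWeight, hlam, hmu]
    · intro x hx j h1 h2 h h'
      rw [fwdProd_smul_antiPoly D 1 1 d mn (M + 1) _ hk,
        ih hD' x fun i h1 h2 => hx i h1 (by omega)]
      have h3 : D.left (M + 1) ≤ D.left (M + 2) := hD.left_le (M + 1) (by omega) (by omega)
      have h4 : D.right (M + 1) ≤ D.right (M + 2) := hD.right_le (M + 1) (by omega) (by omega)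
      exact treeSum_eq_zero_of_triple 1 1 _ hD' (by omega) (by omega) h h'

end Master

/-! ### Arrays as stacks of rows -/

section RowTrees

/-- The array keeps the position `(i, j)`. -/
def RowData.Mem (D : RowData) (N i j : ℕ) : Prop :=
  1 ≤ i ∧ i ≤ N ∧ D.left i < j ∧ j + D.right i ≤ i

/-- The arrays with `N` rows in which the bottom entries of the diagonals are given by `z`. -/
structure IsRowTree (D : RowData) (N : ℕ) (z : ℕ → ℤ) (M : ℕ → ℕ → ℤ) : Prop where
  eq_zero : ∀ i j, ¬ D.Mem N i j → M i j = 0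
  bottom : ∀ j, D.Mem N N j → M N j = z j
  left : ∀ i j, D.Mem N i j → i < N → j ≤ D.left (i + 1) → M i j = z j
  right : ∀ i j, D.Mem N i j → i < N → i < j + D.right (i + 1) → M i j = z (N + j - i)
  interlace : ∀ i j, 1 ≤ i → i < N → D.left (i + 1) < j → j + D.right (i + 1) ≤ i →
    M (i + 1) j ≤ M i j ∧ M i j ≤ M (i + 1) (j + 1)
  distinct : ∀ i j, 1 ≤ i → i < N → D.left (i + 1) < j → j + 1 + D.right (i + 1) ≤ i →
    M i j ≠ M i (j + 1)

/-- The admissible rows above `z` in row `N + 1`. -/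
def upperRows (D : RowData) (N : ℕ) (z : ℕ → ℤ) : Set (ℕ → ℤ) :=
  {x | x ∈ box (D.left N + 1) (D.width N) z ∧
    ∀ j, D.left N + 1 ≤ j → j + 1 < D.left N + 1 + D.width N → x j ≠ x (j + 1)}

open Classical in
/-- The array `M` with the additional row `z`, in row `N`. -/
noncomputable def addRow (D : RowData) (N : ℕ) (z : ℕ → ℤ) (M : ℕ → ℕ → ℤ) : ℕ → ℕ → ℤ :=
  fun i j => if i = N ∧ D.Mem N i j then z j else M i j

theorem addRow_last {D : RowData} {N : ℕ} (z : ℕ → ℤ) (M : ℕ → ℕ → ℤ) {j : ℕ}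
    (h : D.Mem N N j) : addRow D N z M N j = z j := if_pos ⟨rfl, h⟩

theorem addRow_of_ne {D : RowData} {N i : ℕ} (z : ℕ → ℤ) (M : ℕ → ℕ → ℤ) (j : ℕ) (h : i ≠ N) :
    addRow D N z M i j = M i j := if_neg fun h' => h h'.1

theorem isRowTree_addRow {D : RowData} {N : ℕ} (hN : 1 ≤ N) (hD : D.Admissible (N + 1))
    {z x : ℕ → ℤ} {M : ℕ → ℕ → ℤ} (hx : x ∈ upperRows D (N + 1) z) (hM : IsRowTree D N x M) :
    IsRowTree D (N + 1) z (addRow D (N + 1) z M) := by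
  have hk := hD.left_add_width (show 1 ≤ N + 1 by omega) le_rfl
  obtain ⟨hbox, hd⟩ := hx
  obtain ⟨m1, m2, m3⟩ := mem_box.1 hbox
  have hmem : ∀ j, D.left (N + 1) < j → j + D.right (N + 1) ≤ N → D.Mem N N j := fun j h1 h2 =>
    ⟨hN, le_rfl, by have := hD.left_le N hN (by omega); omega,
      by have := hD.right_le N hN (by omega); omega⟩
  refine ⟨fun i j h => ?_, fun j h => addRow_last z M h, fun i j h hi hj => ?_,
    fun i j h hi hj => ?_, fun i j h1 h2 h3 h4 => ?_, fun i j h1 h2 h3 h4 => ?_⟩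
  · by_cases hi : i = N + 1
    · subst hi
      rw [addRow, if_neg fun h' => h h'.2]
      exact hM.eq_zero _ _ fun h' => by have := h'.2.1; omega
    · rw [addRow_of_ne z M j hi]
      exact hM.eq_zero _ _ fun h' => h ⟨h'.1, by have := h'.2.1; omega, h'.2.2⟩
  · rw [addRow_of_ne z M j (by omega)]
    have h' : D.Mem N i j := ⟨h.1, by omega, h.2.2⟩
    have hle := hD.left_mono (show 1 ≤ i + 1 by omega) (show i + 1 ≤ N + 1 by omega) le_rfl
    rw [← m1 j (by omega)]
    by_cases hiN : i = N
    · subst hiN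
      exact hM.bottom j h'
    · exact hM.left i j h' (by omega) hj
  · rw [addRow_of_ne z M j (by omega)]
    have h' : D.Mem N i j := ⟨h.1, by omega, h.2.2⟩
    have hle := hD.right_mono (show 1 ≤ i + 1 by omega) (show i + 1 ≤ N + 1 by omega) le_rfl
    rw [show N + 1 + j - i = N + j - i + 1 by omega, ← m3 (N + j - i) (by omega)]
    by_cases hiN : i = N
    · subst hiN
      rw [Nat.add_sub_cancel_left]
      exact hM.bottom j h'
    · exact hM.right i j h' (by omega) hj
  · rw [addRow_of_ne z M j (show i ≠ N + 1 by omega)]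
    by_cases hiN : i = N
    · subst hiN
      rw [addRow_last z M ⟨by omega, le_rfl, h3, by omega⟩,
        addRow_last z M ⟨by omega, le_rfl, by omega, by omega⟩, hM.bottom j (hmem j h3 h4)]
      exact m2 j (by omega) (by omega)
    · rw [addRow_of_ne z M j (by omega), addRow_of_ne z M _ (by omega)]
      exact hM.interlace i j h1 (by omega) h3 h4
  · rw [addRow_of_ne z M j (show i ≠ N + 1 by omega), addRow_of_ne z M _ (show i ≠ N + 1 by omega)]
    by_cases hiN : i = N
    · subst hiN
      rw [hM.bottom j (hmem j h3 (by omega)), hM.bottom (j + 1) (hmem _ (by omega) (by omega))]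
      exact hd j (by omega) (by omega)
    · exact hM.distinct i j h1 (by omega) h3 h4

open Classical in
/-- The array without its rows after row `N`. -/
noncomputable def removeRow (N : ℕ) (M : ℕ → ℕ → ℤ) : ℕ → ℕ → ℤ :=
  fun i j => if i ≤ N then M i j else 0

theorem exists_of_isRowTree_succ {D : RowData} {N : ℕ} (hN : 1 ≤ N) (hD : D.Admissible (N + 1))
    {z : ℕ → ℤ} {M : ℕ → ℕ → ℤ} (hM : IsRowTree D (N + 1) z M) :
    ∃ x ∈ upperRows D (N + 1) z, ∃ M', IsRowTree D N x M' ∧ addRow D (N + 1) z M' = M := by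
  have hk := hD.left_add_width (show 1 ≤ N + 1 by omega) le_rfl
  set p := D.left (N + 1) + 1 with hp
  set k := D.width (N + 1) with hk'
  -- The row N of M, completed at both ends by the values of z; the right end moves by one place
  -- because SE-diagonals are counted from the right.
  set x : ℕ → ℤ := fun j => if j < p then z j else if j < p + k then M N j else z (j + 1) with hx
  have x1 : ∀ j, j < p → x j = z j := fun j hj => if_pos hj
  have x2 : ∀ j, p ≤ j → j < p + k → x j = M N j := fun j h1 h2 => by
    rw [hx]
    simp only
    rw [if_neg (by omega), if_pos h2]
  have x3 : ∀ j, p + k ≤ j → x j = z (j + 1) := fun j h1 => by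
    rw [hx]
    simp only
    rw [if_neg (by omega), if_neg (by omega)]
  have hrem : ∀ i j, i ≤ N → removeRow N M i j = M i j := fun i j h => if_pos h
  have hmemN : ∀ i j, D.Mem N i j → D.Mem (N + 1) i j := fun i j h =>
    ⟨h.1, by have := h.2.1; omega, h.2.2⟩
  refine ⟨x, ⟨mem_box.2 ⟨x1, fun j h1 h2 => ?_, x3⟩, fun j h1 h2 => ?_⟩, removeRow N M,
    ⟨fun i j h => ?_, fun j h => ?_, fun i j h hi hj => ?_, fun i j h hi hj => ?_,
      fun i j h1 h2 h3 h4 => ?_, fun i j h1 h2 h3 h4 => ?_⟩, ?_⟩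
  · rw [x2 j h1 h2, ← hM.bottom j ⟨by omega, le_rfl, by omega, by omega⟩,
      ← hM.bottom (j + 1) ⟨by omega, le_rfl, by omega, by omega⟩]
    exact hM.interlace N j hN (by omega) (by omega) (by omega)
  · rw [x2 j h1 (by omega), x2 (j + 1) (by omega) h2]
    exact hM.distinct N j hN (by omega) (by omega) (by omega)
  · by_cases hi : i ≤ N
    · rw [hrem i j hi]
      exact hM.eq_zero i j fun h' => h ⟨h'.1, hi, h'.2.2⟩
    · exact if_neg hi
  · rw [hrem N j le_rfl]
    rcases Nat.lt_or_ge j p with h1 | h1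
    · rw [x1 j h1]
      exact hM.left N j (hmemN _ _ h) (by omega) (by omega)
    rcases Nat.lt_or_ge j (p + k) with h2 | h2
    · rw [x2 j h1 h2]
    · rw [x3 j h2, hM.right N j (hmemN _ _ h) (by omega) (by omega)]
      congr 1
      omega
  · have hle := hD.left_mono (show 1 ≤ i + 1 by omega) (show i + 1 ≤ N + 1 by omega) le_rfl
    rw [hrem i j (by omega), x1 j (by omega)]
    exact hM.left i j (hmemN _ _ h) (by omega) hj
  · have hle := hD.right_mono (show 1 ≤ i + 1 by omega) (show i + 1 ≤ N + 1 by omega) le_rfl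
    rw [hrem i j (by omega), x3 _ (by omega), hM.right i j (hmemN _ _ h) (by omega) hj]
    congr 1
    omega
  · rw [hrem i j (by omega), hrem _ j (by omega), hrem _ _ (by omega)]
    exact hM.interlace i j h1 (by omega) h3 h4
  · rw [hrem i j (by omega), hrem _ _ (by omega)]
    exact hM.distinct i j h1 (by omega) h3 h4
  · funext i j
    by_cases h : D.Mem (N + 1) i j
    · by_cases hi : i = N + 1
      · subst hi
        rw [addRow_last _ _ h, hM.bottom j h]
      · rw [addRow_of_ne _ _ _ hi, hrem i j (by have := h.2.1; omega)]
    · rw [addRow, if_neg fun h' => h h'.2, hM.eq_zero i j h, removeRow]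
      split_ifs
      · exact hM.eq_zero i j h
      · rfl

theorem eq_of_addRow_eq {D : RowData} {N : ℕ} {z x x' : ℕ → ℤ} {M M' : ℕ → ℕ → ℤ}
    (hM : IsRowTree D N x M) (hM' : IsRowTree D N x' M')
    (h : addRow D (N + 1) z M = addRow D (N + 1) z M') : M = M' := by
  funext i j
  by_cases hi : i = N + 1
  · rw [hM.eq_zero i j fun h' => by have := h'.2.1; omega,
      hM'.eq_zero i j fun h' => by have := h'.2.1; omega]
  · rw [← addRow_of_ne z M j hi, h, addRow_of_ne z M' j hi]

/-- The array determines x in the free places, and z determines it elsewhere. This makes the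
decomposition by the row above z disjoint. -/
theorem upperRows_eq_of_isRowTree {D : RowData} {N : ℕ} (hN : 1 ≤ N) (hD : D.Admissible (N + 1))
    {z x x' : ℕ → ℤ} {M : ℕ → ℕ → ℤ} (hx : x ∈ upperRows D (N + 1) z)
    (hx' : x' ∈ upperRows D (N + 1) z) (hM : IsRowTree D N x M) (hM' : IsRowTree D N x' M) :
    x = x' := by
  have hk := hD.left_add_width (show 1 ≤ N + 1 by omega) le_rfl
  obtain ⟨m1, -, m3⟩ := mem_box.1 hx.1
  obtain ⟨m1', -, m3'⟩ := mem_box.1 hx'.1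
  funext j
  rcases Nat.lt_or_ge j (D.left (N + 1) + 1) with h1 | h1
  · rw [m1 j h1, m1' j h1]
  rcases Nat.lt_or_ge j (D.left (N + 1) + 1 + D.width (N + 1)) with h2 | h2
  · have hmem : D.Mem N N j := ⟨hN, le_rfl, by have := hD.left_le N hN (by omega); omega,
      by have := hD.right_le N hN (by omega); omega⟩
    rw [← hM.bottom j hmem, ← hM'.bottom j hmem]
  · rw [m3 j h2, m3' j h2]

theorem upperRows_finite (D : RowData) (N : ℕ) (z : ℕ → ℤ) : (upperRows D N z).Finite :=
  (box (D.left N + 1) (D.width N) z).finite_toSet.subset fun _ hx => hx.1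

theorem setOf_isRowTree_succ {D : RowData} {N : ℕ} (hN : 1 ≤ N) (hD : D.Admissible (N + 1))
    (z : ℕ → ℤ) : {M | IsRowTree D (N + 1) z M} =
      ⋃ x ∈ upperRows D (N + 1) z, addRow D (N + 1) z '' {M | IsRowTree D N x M} := by
  ext M
  simp only [Set.mem_ofPred_eq, Set.mem_iUnion, Set.mem_image, exists_prop]
  constructor
  · intro hM
    obtain ⟨x, hx, M', hM', rfl⟩ := exists_of_isRowTree_succ hN hD hM
    exact ⟨x, hx, M', hM', rfl⟩
  · rintro ⟨x, hx, M', hM', rfl⟩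
    exact isRowTree_addRow hN hD hx hM'

theorem setOf_isRowTree_one {D : RowData} (hD : D.Admissible 1) (z : ℕ → ℤ) :
    {M | IsRowTree D 1 z M} = {fun i j => if i = 1 ∧ j = 1 then z 1 else 0} := by
  have h0 := hD.lt 1 le_rfl le_rfl
  have hmem : ∀ i j, D.Mem 1 i j ↔ i = 1 ∧ j = 1 := by
    intro i j
    constructor
    · rintro ⟨h1, h2, h3, h4⟩
      omega
    · rintro ⟨rfl, rfl⟩
      exact ⟨le_rfl, le_rfl, by omega, by omega⟩
  ext M
  simp only [Set.mem_ofPred_eq, Set.mem_singleton_iff]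
  constructor
  · intro hM
    funext i j
    by_cases h : i = 1 ∧ j = 1
    · rw [if_pos h, h.1, h.2, hM.bottom 1 ((hmem 1 1).2 ⟨rfl, rfl⟩)]
    · rw [if_neg h, hM.eq_zero i j ((hmem i j).not.2 h)]
  · rintro rfl
    refine ⟨fun i j h => if_neg ((hmem i j).not.1 h), fun j h => ?_, fun i j h hi => ?_,
      fun i j h hi => ?_, fun i j h1 h2 => ?_, fun i j h1 h2 => ?_⟩
    · obtain ⟨-, rfl⟩ := (hmem _ _).1 h
      simp
    · have := h.1
      omega
    · have := h.1
      omega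
    · omega
    · omega

theorem setOf_isRowTree_finite {D : RowData} {N : ℕ} (hN : 1 ≤ N) (hD : D.Admissible N)
    (z : ℕ → ℤ) : {M | IsRowTree D N z M}.Finite := by
  induction N, hN using Nat.le_induction generalizing z with
  | base =>
    rw [setOf_isRowTree_one hD]
    exact Set.finite_singleton _
  | succ N hN ih =>
    rw [setOf_isRowTree_succ hN hD]
    exact (upperRows_finite D _ z).biUnion fun x _ => (ih (hD.mono (by omega)) x).image _

variable {R : Type*} [CommRing R]

theorem rowV_congr (u v lam : R) (p k : ℕ) {z z' x x' : ℕ → ℤ}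
    (hz : ∀ j, p ≤ j → j < p + k → z j = z' j) (hx : ∀ j, p ≤ j → j < p + k → x j = x' j) :
    rowV u v lam p k z x = rowV u v lam p k z' x' := by
  induction k using Nat.strong_induction_on with
  | _ k ih =>
    match k with
    | 0 => rfl
    | 1 => rw [rowV, rowV, hz p le_rfl (by omega), hx p le_rfl (by omega)]
    | k + 2 =>
      rw [rowV, rowV, ih (k + 1) (by omega) (fun j h1 h2 => hz j h1 (by omega))
        (fun j h1 h2 => hx j h1 (by omega)), hz (p + k + 1) (by omega) (by omega),
        hx (p + k) (by omega) (by omega), hx (p + k + 1) (by omega) (by omega)]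

theorem rowW_congr (u v lam mu : R) (p k : ℕ) {z z' x x' : ℕ → ℤ}
    (hz : ∀ j, p ≤ j → j ≤ p + k → z j = z' j) (hx : ∀ j, p ≤ j → j < p + k → x j = x' j) :
    rowW u v lam mu p k z x = rowW u v lam mu p k z' x' := by
  match k with
  | 0 => rfl
  | k + 1 =>
    rw [rowW, rowW, rowV_congr u v lam p (k + 1) (fun j h1 h2 => hz j h1 h2.le) hx,
      hz (p + k + 1) (by omega) (by omega), hx (p + k) (by omega) (by omega)]

/-- The weight of an array. -/
noncomputable def treeWeight (D : RowData) (u v : R) (N : ℕ) (M : ℕ → ℕ → ℤ) : R :=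
  ∏ i ∈ Finset.Icc 2 N, stepWeight D u v i (M i) (M (i - 1))

theorem treeWeight_addRow {D : RowData} {N : ℕ} (hN : 1 ≤ N) (hD : D.Admissible (N + 1)) (u v : R)
    (z : ℕ → ℤ) {x : ℕ → ℤ} {M : ℕ → ℕ → ℤ} (hM : IsRowTree D N x M) :
    treeWeight D u v (N + 1) (addRow D (N + 1) z M) =
      stepWeight D u v (N + 1) z x * treeWeight D u v N M := by
  have hk := hD.left_add_width (show 1 ≤ N + 1 by omega) le_rfl
  rw [treeWeight, Finset.prod_Icc_succ_top (by omega), mul_comm]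
  congr 1
  · refine rowW_congr u v _ _ _ _ (fun j h1 h2 => ?_) fun j h1 h2 => ?_
    · exact addRow_last _ _ ⟨by omega, le_rfl, by omega, by omega⟩
    · rw [addRow_of_ne _ _ _ (by omega), Nat.add_sub_cancel, hM.bottom j]
      exact ⟨hN, le_rfl, by have := hD.left_le N hN (by omega); omega,
        by have := hD.right_le N hN (by omega); omega⟩
  · refine Finset.prod_congr rfl fun i hi => ?_
    have hi := Finset.mem_Icc.1 hi
    have e1 : addRow D (N + 1) z M i = M i := funext fun j => addRow_of_ne _ _ _ (by omega)
    have e2 : addRow D (N + 1) z M (i - 1) = M (i - 1) :=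
      funext fun j => addRow_of_ne _ _ _ (by omega)
    rw [e1, e2]

theorem treeSum_eq_finsum {D : RowData} (u v : R) (φ : ℤ → R) {N : ℕ} (hN : 1 ≤ N)
    (hD : D.Admissible N) (z : ℕ → ℤ) : treeSum D u v φ N z =
      ∑ᶠ M ∈ {M | IsRowTree D N z M}, treeWeight D u v N M * φ (M 1 1) := by
  induction N, hN using Nat.le_induction generalizing z with
  | base =>
    rw [setOf_isRowTree_one hD, finsum_mem_singleton]
    simp [treeSum, treeWeight]
  | succ N hN ih =>
    have hD' := hD.mono (show N ≤ N + 1 by omega)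
    have hfin := fun x => setOf_isRowTree_finite hN hD' x
    rw [setOf_isRowTree_succ hN hD, finsum_mem_biUnion _ (upperRows_finite D _ z)
      fun x _ => (hfin x).image _]
    · have e1 : treeSum D u v φ (N + 1) z =
          ∑ᶠ x ∈ upperRows D (N + 1) z, stepWeight D u v (N + 1) z x * treeSum D u v φ N x := by
        rw [finsum_mem_eq_finite_toFinset_sum _ (upperRows_finite D _ z)]
        obtain ⟨K, rfl⟩ : ∃ K, N = K + 1 := ⟨N - 1, by omega⟩
        rw [treeSum]
        symm
        refine Finset.sum_subset (fun x hx => ((Set.Finite.mem_toFinset _).1 hx).1)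
          fun x hx hx' => ?_
        rw [Set.Finite.mem_toFinset] at hx'
        -- Members of the box outside `upperRows` have equal free neighbours, hence weight zero.
        have : ¬ ∀ j, D.left (K + 2) + 1 ≤ j → j + 1 < D.left (K + 2) + 1 + D.width (K + 2) →
            x j ≠ x (j + 1) := fun h => hx' ⟨hx, h⟩
        push Not at this
        obtain ⟨j, h1, h2, h⟩ := this
        rw [stepWeight, rowW_eq_zero _ _ _ _ _ _ h1 h2 h, zero_mul]
      rw [e1]
      refine finsum_mem_congr rfl fun x hx => ?_
      have hinj : Set.InjOn (addRow D (N + 1) z) {M | IsRowTree D N x M} :=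
        fun M hM M' hM' h => eq_of_addRow_eq hM hM' h
      rw [finsum_mem_image hinj, ih hD',
        finsum_mem_eq_finite_toFinset_sum _ (hfin x), finsum_mem_eq_finite_toFinset_sum _ (hfin x),
        Finset.mul_sum]
      refine Finset.sum_congr rfl fun M hM => ?_
      rw [Set.Finite.mem_toFinset] at hM
      rw [treeWeight_addRow hN hD u v z hM, addRow_of_ne _ _ _ (by omega), mul_assoc]
    · intro x hx x' hx' hne
      rw [Function.onFun, Set.disjoint_left]
      rintro _ ⟨M, hM, rfl⟩ ⟨M', hM', h⟩
      have hMM := eq_of_addRow_eq hM' hM h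
      subst hMM
      exact hne (upperRows_eq_of_isRowTree hN hD hx hx' hM hM')

end RowTrees

/-! ### From truncated diagonals to rows -/

section Translation

/-- The length of the truncation of the `k`-th NE-diagonal. -/
def truncNE (l : ℕ) (s : ℕ → ℕ) (k : ℕ) : ℕ := if k ≤ l then s k else 0

/-- The length of the truncation of the `k`-th SE-diagonal. -/
def truncSE (n r : ℕ) (t : ℕ → ℕ) (k : ℕ) : ℕ := if n - r < k then t k else 0

/-- The number of entries deleted at the left end of row `i`. -/
def leftDel (n l : ℕ) (s : ℕ → ℕ) (i : ℕ) : ℕ := ((Finset.Icc 1 l).filter fun j => n < i + s j).card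

/-- The number of entries deleted at the right end of row `i`. -/
def rightDel (n r : ℕ) (t : ℕ → ℕ) (i : ℕ) : ℕ :=
  ((Finset.Icc (n - r + 1) n).filter fun k => n < i + t k).card

/-- The set cut out by P is an initial segment, so its size determines it. This applies to a weakly
decreasing s; the next lemma treats final segments, for a weakly increasing t. -/
theorem le_card_filter_iff {l : ℕ} {P : ℕ → Prop} [DecidablePred P]
    (hP : ∀ i j, 1 ≤ i → i ≤ j → j ≤ l → P j → P i) {j : ℕ} (h1 : 1 ≤ j) (h2 : j ≤ l) :
    P j ↔ j ≤ ((Finset.Icc 1 l).filter P).card := by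
  constructor
  · intro h
    have : Finset.Icc 1 j ⊆ (Finset.Icc 1 l).filter P := fun i hi => by
      have hi := Finset.mem_Icc.1 hi
      exact Finset.mem_filter.2 ⟨Finset.mem_Icc.2 ⟨hi.1, hi.2.trans h2⟩, hP i j hi.1 hi.2 h2 h⟩
    simpa using Finset.card_le_card this
  · intro h
    by_contra hj
    have : (Finset.Icc 1 l).filter P ⊆ Finset.Ico 1 j := fun i hi => by
      obtain ⟨hi, hPi⟩ := Finset.mem_filter.1 hi
      have hi := Finset.mem_Icc.1 hi
      refine Finset.mem_Ico.2 ⟨hi.1, ?_⟩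
      by_contra hji
      exact hj (hP j i h1 (by omega) hi.2 hPi)
    have := Finset.card_le_card this
    rw [Nat.card_Ico] at this
    omega

theorem lt_add_card_filter_iff {a n : ℕ} {P : ℕ → Prop} [DecidablePred P]
    (hP : ∀ i j, a ≤ i → i ≤ j → j ≤ n → P i → P j) {k : ℕ} (h1 : a ≤ k) (h2 : k ≤ n) :
    P k ↔ n < k + ((Finset.Icc a n).filter P).card := by
  constructor
  · intro h
    have : Finset.Icc k n ⊆ (Finset.Icc a n).filter P := fun i hi => by
      have hi := Finset.mem_Icc.1 hi
      exact Finset.mem_filter.2 ⟨Finset.mem_Icc.2 ⟨h1.trans hi.1, hi.2⟩, hP k i h1 hi.1 hi.2 h⟩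
    have := Finset.card_le_card this
    rw [Nat.card_Icc] at this
    omega
  · intro h
    by_contra hj
    have : (Finset.Icc a n).filter P ⊆ Finset.Ioc k n := fun i hi => by
      obtain ⟨hi, hPi⟩ := Finset.mem_filter.1 hi
      have hi := Finset.mem_Icc.1 hi
      refine Finset.mem_Ioc.2 ⟨?_, hi.2⟩
      by_contra hji
      exact hj (hP i k hi.1 (by omega) h2 hPi)
    have := Finset.card_le_card this
    rw [Nat.card_Ioc] at this
    omega

/-- The deletions and the exceptional entries, row by row. -/
def rowData (n l r : ℕ) (s t : ℕ → ℕ) (I J : Finset ℕ) : RowData where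
  left := leftDel n l s
  right := rightDel n r t
  exL i := leftDel n l s i + 1 ∈ I ∧ i + truncNE l s (leftDel n l s i + 1) = n
  exR i := n - rightDel n r t i ∈ J ∧ i + truncSE n r t (n - rightDel n r t i) = n

/-- The hypotheses on the deletions and on the exceptional diagonals. -/
structure Valid (n l r : ℕ) (s t : ℕ → ℕ) (I J : Finset ℕ) : Prop where
  one_le : 1 ≤ n
  add_le : l + r ≤ n
  antitone : AntitoneOn s (Set.Icc 1 l)
  monotone : MonotoneOn t (Set.Icc (n - r + 1) n)
  noInterference : NoInterference n l r s t
  excNE : IsExcNE l s I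
  excSE : IsExcSE n r t J

namespace Valid

variable {n l r : ℕ} {s t : ℕ → ℕ} {I J : Finset ℕ}

theorem leftDel_le (n l : ℕ) (s : ℕ → ℕ) (i : ℕ) : leftDel n l s i ≤ l := by
  simpa [leftDel] using Finset.card_filter_le (Finset.Icc 1 l) fun j => n < i + s j

theorem rightDel_le (n r : ℕ) (t : ℕ → ℕ) (i : ℕ) : rightDel n r t i ≤ n - (n - r) := by
  have := Finset.card_filter_le (Finset.Icc (n - r + 1) n) fun k => n < i + t k
  rw [Nat.card_Icc] at this
  unfold rightDel
  omega

theorem leftDel_mono {i j : ℕ} (h : i ≤ j) : leftDel n l s i ≤ leftDel n l s j :=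
  Finset.card_le_card fun k hk => by
    rw [Finset.mem_filter] at hk ⊢
    exact ⟨hk.1, by omega⟩

theorem rightDel_mono {i j : ℕ} (h : i ≤ j) : rightDel n r t i ≤ rightDel n r t j :=
  Finset.card_le_card fun k hk => by
    rw [Finset.mem_filter] at hk ⊢
    exact ⟨hk.1, by omega⟩

/-- Conjugation of a partition: `leftDel` counts by rows what s counts by diagonals. -/
theorem le_leftDel_iff (h : Valid n l r s t I J) {i j : ℕ} (hi : i ≤ n) (hj : 1 ≤ j) :
    j ≤ leftDel n l s i ↔ n < i + truncNE l s j := by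
  unfold truncNE
  split_ifs with hjl
  · refine (le_card_filter_iff (fun a c ha hac hc hP => ?_) hj hjl).symm
    have := h.antitone ⟨ha, hac.trans hc⟩ ⟨ha.trans hac, hc⟩ hac
    omega
  · have := leftDel_le n l s i
    omega

theorem lt_add_rightDel_iff (h : Valid n l r s t I J) {i k : ℕ} (hi : i ≤ n) (hk : k ≤ n) :
    n < k + rightDel n r t i ↔ n < i + truncSE n r t k := by
  unfold truncSE
  split_ifs with hkr
  · refine (lt_add_card_filter_iff (fun a c ha hac hc hP => ?_) (by omega) hk).symm
    have := h.monotone ⟨ha, hac.trans hc⟩ ⟨ha.trans hac, hc⟩ hac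
    omega
  · have := rightDel_le n r t i
    omega

theorem mem_shape_iff (h : Valid n l r s t I J) {i j : ℕ} :
    (i, j) ∈ shape n l r s t ↔ (rowData n l r s t I J).Mem n i j := by
  simp only [shape, Finset.mem_filter, Finset.mem_product, Finset.mem_Icc, RowData.Mem, rowData]
  constructor
  · rintro ⟨⟨⟨h1, h2⟩, h3, h4⟩, h5, h6, h7⟩
    have e1 := h.le_leftDel_iff h2 h3
    have e2 := h.lt_add_rightDel_iff h2 (show n + j - i ≤ n by omega)
    unfold truncNE at e1
    unfold truncSE at e2
    refine ⟨h1, h2, ?_, ?_⟩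
    · split_ifs at e1 with hh
      · have := h6 hh
        omega
      · omega
    · split_ifs at e2 with hh
      · have := h7 hh
        omega
      · omega
  · rintro ⟨h1, h2, h3, h4⟩
    have e1 := h.le_leftDel_iff h2 (show 1 ≤ j by omega)
    have e2 := h.lt_add_rightDel_iff h2 (show n + j - i ≤ n by omega)
    unfold truncNE at e1
    unfold truncSE at e2
    refine ⟨⟨⟨h1, h2⟩, by omega, by omega⟩, by omega, fun hh => ?_, fun hh => ?_⟩
    · rw [if_pos hh] at e1
      omega
    · rw [if_pos hh] at e2
      omega

theorem endNE_mem (h : Valid n l r s t I J) {k : ℕ} (h1 : 1 ≤ k) (h2 : k ≤ n - r) :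
    (rowData n l r s t I J).Mem n (n - truncNE l s k) k := by
  have := h.noInterference.1 k (Finset.mem_Icc.2 ⟨h1, by omega⟩)
  rw [endPos, if_pos h2] at this
  exact h.mem_shape_iff.1 this

theorem endSE_mem (h : Valid n l r s t I J) {k : ℕ} (h1 : n - r < k) (h2 : k ≤ n) :
    (rowData n l r s t I J).Mem n (n - truncSE n r t k) (k - truncSE n r t k) := by
  have := h.noInterference.1 k (Finset.mem_Icc.2 ⟨by omega, h2⟩)
  rw [endPos, if_neg (by omega)] at this
  rw [truncSE, if_pos h1]
  exact h.mem_shape_iff.1 this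

theorem endPos_ne (h : Valid n l r s t I J) {k m : ℕ} (h1 : 1 ≤ k) (h2 : k ≤ n - r)
    (h3 : n - r < m) (h4 : m ≤ n) :
    (n - truncNE l s k, k) ≠ (n - truncSE n r t m, m - truncSE n r t m) := by
  intro he
  rw [truncSE, if_pos h3] at he
  have he' : endPos n l r s t k = endPos n l r s t m := by
    rw [endPos, endPos, if_pos h2, if_neg (show ¬ m ≤ n - r by omega)]
    exact he
  have : k = m := h.noInterference.2 ⟨h1, by omega⟩ ⟨by omega, h4⟩ he'
  omega

/-- Consider the first row i + 1 without entries. If a NE-diagonal ends in row i, then the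
SE-diagonal through its end also stops there, and two prescribed ends coincide. If none does, a
SE-diagonal ends in row i in a column already deleted from the left. -/
theorem leftDel_add_rightDel_lt (h : Valid n l r s t I J) {i : ℕ} (h1 : 1 ≤ i) (h2 : i ≤ n) :
    leftDel n l s i + rightDel n r t i < i := by
  have hl := fun i => leftDel_le n l s i
  have hr := fun i => rightDel_le n r t i
  have hlr := h.add_le
  induction i, h1 using Nat.le_induction with
  | base =>
    by_contra hc
    have hc : 1 ≤ leftDel n l s 1 ∨ 1 ≤ rightDel n r t 1 := by omega
    rcases hc with hc | hc
    · have e := (h.le_leftDel_iff h2 le_rfl).1 hc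
      have := (h.endNE_mem le_rfl (by have := hl 1; omega)).1
      omega
    · have e := (h.lt_add_rightDel_iff h2 le_rfl).1 (by omega)
      have := (h.endSE_mem (by have := hr 1; omega) le_rfl).1
      omega
  | succ i h1 ih =>
    have ih := ih (by omega)
    by_contra hc
    have ml : leftDel n l s i ≤ leftDel n l s (i + 1) := leftDel_mono (by omega)
    have mr : rightDel n r t i ≤ rightDel n r t (i + 1) := rightDel_mono (by omega)
    have hl1 := hl (i + 1)
    have hr1 := hr (i + 1)
    rcases ml.lt_or_eq with hlt | heq
    · set a := leftDel n l s (i + 1) with ha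
      have e1 := (h.le_leftDel_iff (i := i + 1) h2 (show 1 ≤ a by omega)).1 le_rfl
      have e2 := (h.le_leftDel_iff (i := i) (by omega) (show 1 ≤ a by omega)).not.1 (by omega)
      have hm := h.endNE_mem (k := a) (by omega) (by omega)
      have hrow : n - truncNE l s a = i := by omega
      rw [hrow] at hm
      have h4 := hm.2.2.2
      change a + rightDel n r t i ≤ i at h4
      have f1 := (h.lt_add_rightDel_iff (i := i + 1) h2 (show n + a - i ≤ n by omega)).1 (by omega)
      have f2 := (h.lt_add_rightDel_iff (i := i) (by omega)
        (show n + a - i ≤ n by omega)).not.1 (by omega)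
      refine h.endPos_ne (k := a) (m := n + a - i) (by omega) (by omega) ?_ (by omega) ?_
      · by_contra hk
        rw [truncSE, if_neg hk] at f1
        omega
      · rw [Prod.mk.injEq]
        constructor <;> omega
    -- The first SE-diagonal missing from row i + 1; its end would be in column i + 1 - rightDel (i
    -- + 1), which the left deletions have reached.
    · set k := n + 1 - rightDel n r t (i + 1) with hk
      have f1 := (h.lt_add_rightDel_iff (i := i + 1) h2 (show k ≤ n by omega)).1 (by omega)
      have f2 := (h.lt_add_rightDel_iff (i := i) (by omega) (show k ≤ n by omega)).not.1 (by omega)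
      have hm := h.endSE_mem (k := k) (by omega) (by omega)
      have h3 := hm.2.2.1
      change leftDel n l s (n - truncSE n r t k) < _ at h3
      have hrow : n - truncSE n r t k = i := by omega
      rw [hrow] at h3
      omega

theorem bottomNE_mem (h : Valid n l r s t I J) {k : ℕ} (hk : k ∈ I) :
    (rowData n l r s t I J).Mem n (n - truncNE l s k) k := by
  have hlr := h.add_le
  rcases h.excNE k hk with rfl | ⟨h1, h2, -⟩
  -- If r = n, the first NE-diagonal has no prescribed end of its own. Then l = 0, and its bottom
  -- entry remains because row n is nonempty.
  · rcases Nat.lt_or_ge (n - r) 1 with h0 | h0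
    · have hl : l = 0 := by omega
      have := h.leftDel_add_rightDel_lt h.one_le le_rfl
      have hl' := leftDel_le n l s n
      rw [truncNE, if_neg (by omega), Nat.sub_zero]
      refine ⟨h.one_le, le_rfl, ?_, ?_⟩
      · change leftDel n l s n < 1
        omega
      · change 1 + rightDel n r t n ≤ n
        omega
    · exact h.endNE_mem le_rfl h0
  · exact h.endNE_mem (by omega) (by omega)

theorem bottomSE_mem (h : Valid n l r s t I J) {k : ℕ} (hk : k ∈ J) :
    (rowData n l r s t I J).Mem n (n - truncSE n r t k) (k - truncSE n r t k) := by
  have hlr := h.add_le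
  rcases h.excSE k hk with ⟨h1, h2, -⟩ | rfl
  · exact h.endSE_mem (by omega) (by omega)
  · rcases Nat.lt_or_ge (k - r) k with h0 | h0
    · exact h.endSE_mem h0 le_rfl
    · have := h.leftDel_add_rightDel_lt h.one_le le_rfl
      have hr := rightDel_le k r t k
      rw [truncSE, if_neg (by omega), Nat.sub_zero]
      refine ⟨h.one_le, le_rfl, ?_, ?_⟩
      · change leftDel k l s k < k
        omega
      · change k + rightDel k r t k ≤ k
        omega

theorem mem_I_pos (h : Valid n l r s t I J) {k : ℕ} (hk : k ∈ I) : 1 ≤ k := by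
  rcases h.excNE k hk with rfl | ⟨h1, -⟩ <;> omega

theorem mem_J_le (h : Valid n l r s t I J) {k : ℕ} (hk : k ∈ J) : k ≤ n := by
  rcases h.excSE k hk with ⟨-, h1, -⟩ | rfl <;> omega

/-- Since s_{k-1} > s_k, the preceding diagonal is already missing from the row where diagonal k
ends, so the bottom entry of diagonal k is leftmost in its row. For k = 1 this is automatic. -/
theorem leftDel_of_mem_I (h : Valid n l r s t I J) {k i : ℕ} (hk : k ∈ I)
    (hi : i + truncNE l s k = n) : leftDel n l s i + 1 = k := by
  have hm := (h.bottomNE_mem hk).2.2.1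
  change leftDel n l s _ < k at hm
  rw [show n - truncNE l s k = i by omega] at hm
  rcases h.excNE k hk with rfl | ⟨h1, h2, h3⟩
  · omega
  · have := (h.le_leftDel_iff (i := i) (j := k - 1) (by omega) (by omega)).2 (by
      unfold truncNE at hi ⊢
      rw [if_pos h2] at hi
      rw [if_pos (by omega)]
      omega)
    omega

theorem rightDel_of_mem_J (h : Valid n l r s t I J) {k i : ℕ} (hk : k ∈ J)
    (hi : i + truncSE n r t k = n) : n - rightDel n r t i = k := by
  have hm := (h.bottomSE_mem hk).2.2
  change _ ∧ _ + rightDel n r t _ ≤ _ at hm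
  rw [show n - truncSE n r t k = i by omega] at hm
  rcases h.excSE k hk with ⟨h1, h2, h3⟩ | rfl
  · have := (h.lt_add_rightDel_iff (i := i) (k := k + 1) (by omega) h2).2 (by
      unfold truncSE at hi ⊢
      rw [if_pos (by omega)] at hi ⊢
      omega)
    omega
  · omega

theorem isBottomNE_iff (h : Valid n l r s t I J) {k i j : ℕ} (hk : 1 ≤ k)
    (hm : (rowData n l r s t I J).Mem n (n - truncNE l s k) k) :
    IsBottomNE n l r s t k i j ↔ j = k ∧ i + truncNE l s k = n := by
  have hle : truncNE l s k < n := by have := hm.1; omega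
  have hdel : ∀ i', (i', k) ∈ shape n l r s t → i' + truncNE l s k ≤ n := fun i' hi' => by
    have h' := h.mem_shape_iff.1 hi'
    have := (h.le_leftDel_iff h'.2.1 hk).not.1 (not_le.2 h'.2.2.1)
    omega
  constructor
  · rintro ⟨h1, rfl, h2⟩
    have := h2 _ (h.mem_shape_iff.2 hm)
    have := hdel i h1
    exact ⟨rfl, by omega⟩
  · rintro ⟨rfl, hi⟩
    rw [show n - truncNE l s j = i by omega] at hm
    exact ⟨h.mem_shape_iff.2 hm, rfl, fun i' hi' => by have := hdel i' hi'; omega⟩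

theorem isBottomSE_iff (h : Valid n l r s t I J) {k i j : ℕ} (hk : k ≤ n)
    (hm : (rowData n l r s t I J).Mem n (n - truncSE n r t k) (k - truncSE n r t k)) :
    IsBottomSE n l r s t k i j ↔ n + j = k + i ∧ i + truncSE n r t k = n := by
  have hle : truncSE n r t k < n := by have := hm.1; omega
  have hle' : truncSE n r t k < k := by have := hm.2.2.1; omega
  have hdel : ∀ i' j', (i', j') ∈ shape n l r s t → n + j' = k + i' →
      i' + truncSE n r t k ≤ n := fun i' j' hi' he => by
    have h' := h.mem_shape_iff.1 hi'
    have h4 := h'.2.2.2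
    change j' + rightDel n r t i' ≤ i' at h4
    have := (h.lt_add_rightDel_iff h'.2.1 hk).not.1 (by omega)
    omega
  constructor
  · rintro ⟨h1, h3, h2⟩
    have := h2 _ _ (h.mem_shape_iff.2 hm) (by omega)
    have := hdel i j h1 h3
    exact ⟨h3, by omega⟩
  · rintro ⟨h3, hi⟩
    rw [show n - truncSE n r t k = i by omega, show k - truncSE n r t k = j by omega] at hm
    exact ⟨h.mem_shape_iff.2 hm, h3, fun i' j' hi' he => by have := hdel i' j' hi' he; omega⟩

theorem admissible (h : Valid n l r s t I J) : (rowData n l r s t I J).Admissible n := by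
  refine ⟨fun i h1 h2 => h.leftDel_add_rightDel_lt h1 h2, fun i _ _ => leftDel_mono (by omega),
    fun i _ _ => rightDel_mono (by omega), fun i h1 h2 hex => ?_, fun i h1 h2 hex => ?_⟩
  · exact (h.le_leftDel_iff (i := i + 1) (j := leftDel n l s i + 1) h2 (by omega)).2
      (by have := hex.2; omega)
  · have := (h.lt_add_rightDel_iff (i := i + 1) (k := n - rightDel n r t i) h2 (by omega)).2
      (by have := hex.2; omega)
    change rightDel n r t i < rightDel n r t (i + 1)
    have := h.leftDel_add_rightDel_lt h1 h2.le
    omega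

theorem isRegular_iff (h : Valid n l r s t I J) {i j : ℕ} : IsRegular n l r s t i j ↔
    1 ≤ i ∧ i < n ∧ leftDel n l s (i + 1) < j ∧ j + rightDel n r t (i + 1) ≤ i := by
  rw [IsRegular, h.mem_shape_iff, h.mem_shape_iff, h.mem_shape_iff]
  have ml : leftDel n l s i ≤ leftDel n l s (i + 1) := leftDel_mono (by omega)
  have mr : rightDel n r t i ≤ rightDel n r t (i + 1) := rightDel_mono (by omega)
  simp only [RowData.Mem, rowData]
  omega

/-- An entry without SW or SE neighbour ends its NE- or SE-diagonal and so carries a prescribed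
value; the regular entries are precisely the free places above the next row. -/
theorem isRowTree_iff (h : Valid n l r s t I J) (b : ℕ → ℤ) {M : ℕ → ℕ → ℤ} :
    M ∈ trees n l r s t b ↔ IsRowTree (rowData n l r s t I J) n b M := by
  have hlr := h.add_le
  constructor
  · rintro ⟨hM, hl, hr⟩
    refine ⟨fun i j hij => hM.eq_zero i j (h.mem_shape_iff.not.2 hij), fun j hj => ?_,
      fun i j hm hi hj => ?_, fun i j hm hi hj => ?_, fun i j h1 h2 h3 h4 => ?_,
      fun i j h1 h2 h3 h4 => ?_⟩
    · have hj1 : 1 ≤ j := by have := hj.2.2.1; omega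
      have hj2 : j ≤ n := by have := hj.2.2.2; omega
      rcases Nat.lt_or_ge (n - r) j with hjr | hjr
      · exact hr j n j hjr hj2 ⟨h.mem_shape_iff.2 hj, by omega,
          fun i' j' hm' _ => (h.mem_shape_iff.1 hm').2.1⟩
      · exact hl j n j hj1 hjr ⟨h.mem_shape_iff.2 hj, rfl,
          fun i' hm' => (h.mem_shape_iff.1 hm').2.1⟩
    · have hjl : j ≤ l := hj.trans (leftDel_le n l s (i + 1))
      refine hl j i j (by have := hm.2.2.1; omega) (by omega) ⟨h.mem_shape_iff.2 hm, rfl,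
        fun i' hm' => ?_⟩
      by_contra hii
      have h3 := (h.mem_shape_iff.1 hm').2.2.1
      have hle : leftDel n l s (i + 1) ≤ leftDel n l s i' := leftDel_mono (by omega)
      exact absurd (hj.trans hle) (not_le.2 h3)
    · change i < j + rightDel n r t (i + 1) at hj
      have hjr := rightDel_le n r t (i + 1)
      have h4 := hm.2.2.2
      refine hr (n + j - i) i j (by omega) (by omega) ⟨h.mem_shape_iff.2 hm, by omega,
        fun i' j' hm' he => ?_⟩
      by_contra hii
      have h4' := (h.mem_shape_iff.1 hm').2.2.2
      change j' + rightDel n r t i' ≤ i' at h4'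
      have hle : rightDel n r t (i + 1) ≤ rightDel n r t i' := rightDel_mono (by omega)
      omega
    · have := h.isRegular_iff.2 ⟨h1, h2, h3, h4⟩
      exact ⟨hM.le_left i j this, hM.le_right i j this⟩
    · change j + 1 + rightDel n r t (i + 1) ≤ i at h4
      change leftDel n l s (i + 1) < j at h3
      exact hM.distinct i j (h.isRegular_iff.2 ⟨h1, h2, h3, by omega⟩)
        (h.isRegular_iff.2 ⟨h1, h2, by omega, h4⟩)
  · intro hM
    refine ⟨⟨fun i j hij => hM.eq_zero i j (h.mem_shape_iff.not.1 hij), fun i j hij => ?_,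
      fun i j hij => ?_, fun i j h1 h2 => ?_⟩, fun k i j h1 h2 hb => ?_, fun k i j h1 h2 hb => ?_⟩
    · obtain ⟨h1, h2, h3, h4⟩ := h.isRegular_iff.1 hij
      exact (hM.interlace i j h1 h2 h3 h4).1
    · obtain ⟨h1, h2, h3, h4⟩ := h.isRegular_iff.1 hij
      exact (hM.interlace i j h1 h2 h3 h4).2
    · obtain ⟨h1, h2, h3, -⟩ := h.isRegular_iff.1 h1
      exact hM.distinct i j h1 h2 h3 (h.isRegular_iff.1 ‹_›).2.2.2
    · have hm := h.mem_shape_iff.1 hb.1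
      obtain ⟨rfl, hi⟩ := (h.isBottomNE_iff h1 (h.endNE_mem h1 h2)).1 hb
      rcases hm.2.1.lt_or_eq with hlt | rfl
      · exact hM.left i j hm hlt ((h.le_leftDel_iff (i := i + 1) hlt h1).2 (by omega))
      · exact hM.bottom j hm
    · have hm := h.mem_shape_iff.1 hb.1
      obtain ⟨he, hi⟩ := (h.isBottomSE_iff h2 (h.endSE_mem h1 h2)).1 hb
      rcases hm.2.1.lt_or_eq with hlt | rfl
      · have := (h.lt_add_rightDel_iff (i := i + 1) hlt h2).2 (by omega)
        rw [hM.right i j hm hlt (by change i < j + rightDel n r t (i + 1); omega)]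
        congr 1
        omega
      · rw [hM.bottom j hm]
        congr 1
        omega

end Valid

end Translation

/-! ### Row weights against the inversion statistics -/

section Weights

variable {R : Type*} [CommRing R]

/-- The second product stops one place early: the factor for equality of the last free entry with
its SE neighbour is supplied by `rowW`. -/
theorem rowV_eq_prod (u v lam : R) (p k : ℕ) {z x : ℕ → ℤ}
    (hd : ∀ j, p ≤ j → j + 1 < p + k → x j ≠ x (j + 1)) : rowV u v lam p k z x =
      (∏ j ∈ Finset.Ico p (p + k), if x j = z j then (if j = p then lam else v) else 1) *
        ∏ j ∈ Finset.Ico p (p + k - 1), if x j = z (j + 1) then u else 1 := by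
  induction k using Nat.strong_induction_on with
  | _ k ih =>
    match k with
    | 0 => simp [rowV]
    | 1 => simp [rowV]
    | k + 2 =>
      rw [rowV, ih (k + 1) (by omega) fun j h1 h2 => hd j h1 (by omega),
        if_neg (hd (p + k) (by omega) (by omega)), show p + (k + 2) = p + k + 1 + 1 by omega,
        Finset.prod_Ico_succ_top (by omega), Nat.add_sub_cancel,
        Finset.prod_Ico_succ_top (show p ≤ p + k by omega)
          (fun j => if x j = z (j + 1) then u else 1),
        if_neg (show ¬ p + k + 1 = p by omega), ← add_assoc, Nat.add_sub_cancel]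
      ring

theorem rowW_eq_prod (u v lam mu : R) (p k : ℕ) {z x : ℕ → ℤ}
    (hd : ∀ j, p ≤ j → j + 1 < p + k → x j ≠ x (j + 1)) : rowW u v lam mu p k z x =
      ∏ j ∈ Finset.Ico p (p + k), (if x j = z (j + 1) then (if j + 1 = p + k then mu else u) else 1) *
        if x j = z j then (if j = p then lam else v) else 1 := by
  match k with
  | 0 => simp [rowW]
  | k + 1 =>
    rw [rowW, rowV_eq_prod u v lam p (k + 1) hd, Finset.prod_mul_distrib, ← add_assoc,
      Nat.add_sub_cancel, Finset.prod_Ico_succ_top (show p ≤ p + k by omega)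
        (fun j => if x j = z (j + 1) then (if j + 1 = p + k + 1 then mu else u) else 1),
      if_pos rfl, mul_assoc, mul_comm]
    congr 2
    refine Finset.prod_congr rfl fun j hj => ?_
    have := (Finset.mem_Ico.1 hj).2
    rw [if_neg (show ¬ j + 1 = p + k + 1 by omega)]

namespace Valid

variable {n l r : ℕ} {s t : ℕ → ℕ} {I J : Finset ℕ}

theorem exists_isBottomNE_iff (h : Valid n l r s t I J) {i j : ℕ} :
    (∃ k ∈ I, IsBottomNE n l r s t k (i + 1) j) ↔
      (rowData n l r s t I J).exL (i + 1) ∧ j = leftDel n l s (i + 1) + 1 := by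
  constructor
  · rintro ⟨k, hk, hb⟩
    obtain ⟨rfl, hi⟩ := (h.isBottomNE_iff (h.mem_I_pos hk) (h.bottomNE_mem hk)).1 hb
    have := h.leftDel_of_mem_I hk hi
    refine ⟨⟨?_, ?_⟩, this.symm⟩ <;> rwa [this]
  · rintro ⟨⟨h1, h2⟩, rfl⟩
    exact ⟨_, h1, (h.isBottomNE_iff (h.mem_I_pos h1) (h.bottomNE_mem h1)).2 ⟨rfl, h2⟩⟩

theorem exists_isBottomSE_iff (h : Valid n l r s t I J) {i j : ℕ} (hij : IsRegular n l r s t i j) :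
    (∃ k ∈ J, IsBottomSE n l r s t k (i + 1) (j + 1)) ↔
      (rowData n l r s t I J).exR (i + 1) ∧ j + rightDel n r t (i + 1) = i := by
  obtain ⟨h1, h2, h3, h4⟩ := h.isRegular_iff.1 hij
  constructor
  · rintro ⟨k, hk, hb⟩
    obtain ⟨he, hi⟩ := (h.isBottomSE_iff (h.mem_J_le hk) (h.bottomSE_mem hk)).1 hb
    have := h.rightDel_of_mem_J hk hi
    refine ⟨⟨?_, ?_⟩, by omega⟩ <;> rwa [this]
  · rintro ⟨⟨h5, h6⟩, h7⟩
    exact ⟨_, h5, (h.isBottomSE_iff (h.mem_J_le h5) (h.bottomSE_mem h5)).2 ⟨by omega, h6⟩⟩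

open Classical in
-- The regular entries of row i - 1 are the free places above row i.
theorem prod_regular (h : Valid n l r s t I J) (g : ℕ → ℕ → R) :
    ∏ p ∈ (shape n l r s t).filter (fun p => IsRegular n l r s t p.1 p.2), g p.1 p.2 =
      ∏ i ∈ Finset.Icc 2 n, ∏ j ∈ Finset.Ico ((rowData n l r s t I J).left i + 1)
        ((rowData n l r s t I J).left i + 1 + (rowData n l r s t I J).width i), g (i - 1) j := by
  rw [Finset.prod_sigma']
  refine Finset.prod_bij' (fun p _ => ⟨p.1 + 1, p.2⟩) (fun q _ => (q.1 - 1, q.2)) ?_ ?_ ?_ ?_ ?_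
  · rintro ⟨i, j⟩ hp
    obtain ⟨h1, h2, h3, h4⟩ := h.isRegular_iff.1 (Finset.mem_filter.1 hp).2
    have hw : leftDel n l s (i + 1) + 1 + _ + rightDel n r t (i + 1) = i + 1 :=
      h.admissible.left_add_width (show 1 ≤ i + 1 by omega) h2
    refine Finset.mem_sigma.2 ⟨Finset.mem_Icc.2 ⟨by simp; omega, h2⟩, Finset.mem_Ico.2 ⟨h3, ?_⟩⟩
    change j < leftDel n l s (i + 1) + 1 + (rowData n l r s t I J).width (i + 1)
    change j + rightDel n r t (i + 1) ≤ i at h4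
    omega
  · rintro ⟨i, j⟩ hp
    obtain ⟨h1, h2⟩ := Finset.mem_sigma.1 hp
    have h1 := Finset.mem_Icc.1 h1
    have h2 := Finset.mem_Ico.1 h2
    dsimp only at h1 h2
    obtain ⟨i, rfl⟩ : ∃ m, i = m + 1 := ⟨i - 1, by omega⟩
    have hw : leftDel n l s (i + 1) + 1 + _ + rightDel n r t (i + 1) = i + 1 :=
      h.admissible.left_add_width (show 1 ≤ i + 1 by omega) h1.2
    change leftDel n l s (i + 1) + 1 ≤ j ∧ j < leftDel n l s (i + 1) + 1 + _ at h2
    have hreg : IsRegular n l r s t i j := h.isRegular_iff.2 ⟨by omega, by omega, by omega, by omega⟩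
    exact Finset.mem_filter.2 ⟨hreg.1, hreg⟩
  · rintro ⟨i, j⟩ hp
    rfl
  · rintro ⟨i, j⟩ hp
    have h1 := Finset.mem_Icc.1 (Finset.mem_sigma.1 hp).1
    dsimp only at h1
    simp only [Sigma.mk.injEq, heq_eq_eq, and_true]
    omega
  · rintro ⟨i, j⟩ hp
    rfl

open Classical in
theorem pow_card_filter (c : R) (P : ℕ × ℕ → Prop)
    [DecidablePred fun p : ℕ × ℕ => IsRegular n l r s t p.1 p.2 ∧ P p] :
    c ^ ((shape n l r s t).filter fun p => IsRegular n l r s t p.1 p.2 ∧ P p).card =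
      ∏ p ∈ (shape n l r s t).filter (fun p => IsRegular n l r s t p.1 p.2),
        if P p then c else 1 := by
  rw [← Finset.prod_filter, Finset.prod_const, Finset.filter_filter]
  congr!

/-- A SW neighbour that is the bottom of a diagonal in I is the leftmost entry of an exceptional
row, where `lam` = 1 suppresses v; the right side is analogous with `mu` and u. -/
theorem treeWeight_eq (h : Valid n l r s t I J) (u v : R) {b : ℕ → ℤ} {M : ℕ → ℕ → ℤ}
    (hM : M ∈ trees n l r s t b) : treeWeight (rowData n l r s t I J) u v n M =
      u ^ invExc n l r s t J M * v ^ invExc' n l r s t I M := by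
  classical
  have hM' := (h.isRowTree_iff b).1 hM
  rw [invExc, invExc', pow_card_filter u fun p => M p.1 p.2 = M (p.1 + 1) (p.2 + 1) ∧
      ¬ ∃ k ∈ J, IsBottomSE n l r s t k (p.1 + 1) (p.2 + 1),
    pow_card_filter v fun p => M p.1 p.2 = M (p.1 + 1) p.2 ∧
      ¬ ∃ k ∈ I, IsBottomNE n l r s t k (p.1 + 1) p.2, ← Finset.prod_mul_distrib]
  obtain ⟨g, hg⟩ : ∃ g : ℕ → ℕ → R, ∀ i j, g i j = (if M i j = M (i + 1) (j + 1) then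
        (if j + rightDel n r t (i + 1) = i then (rowData n l r s t I J).mu u (i + 1) else u)
        else 1) *
      if M i j = M (i + 1) j then
        (if j = leftDel n l s (i + 1) + 1 then (rowData n l r s t I J).lam v (i + 1) else v)
        else 1 := ⟨_, fun _ _ => rfl⟩
  refine Eq.trans (b := ∏ p ∈ (shape n l r s t).filter (fun p => IsRegular n l r s t p.1 p.2),
      g p.1 p.2) ?_ (Finset.prod_congr rfl fun p hp => ?_)
  swap
  · have hreg := (Finset.mem_filter.1 hp).2
    simp only [hg, h.exists_isBottomNE_iff, h.exists_isBottomSE_iff hreg, RowData.mu,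
      RowData.lam]
    congr 1 <;> split_ifs <;> first | rfl | tauto
  rw [h.prod_regular, treeWeight]
  refine Finset.prod_congr rfl fun i hi => ?_
  have hi := Finset.mem_Icc.1 hi
  obtain ⟨i, rfl⟩ : ∃ m, i = m + 1 := ⟨i - 1, by omega⟩
  have hw : leftDel n l s (i + 1) + 1 + _ + rightDel n r t (i + 1) = i + 1 :=
    h.admissible.left_add_width (show 1 ≤ i + 1 by omega) hi.2
  rw [stepWeight, rowW_eq_prod]
  · rw [Nat.add_sub_cancel]
    refine Finset.prod_congr rfl fun j hj => ?_
    have : j + 1 = (rowData n l r s t I J).left (i + 1) + 1 + (rowData n l r s t I J).width (i + 1)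
        ↔ j + rightDel n r t (i + 1) = i := by
      change j + 1 = leftDel n l s (i + 1) + 1 + _ ↔ _
      omega
    simp only [this, hg]
    rfl
  · intro j h1 h2
    change j + 1 < leftDel n l s (i + 1) + 1 + _ at h2
    exact hM'.distinct i j (by omega) (by omega) (by omega)
      (by change j + 1 + rightDel n r t (i + 1) ≤ i; omega)

end Valid

end Weights

/-! ### The operators of the theorem, regrouped by rows -/

section OperatorProducts

variable {R : Type*} [CommRing R]

theorem opProd_eq_coe {a k : ℕ} {f : ℕ → Module.End R (MvPolynomial ℕ R)} {g : ℕ → Op R}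
    (h : ∀ i, f i = g i) : opProd a k f = ((∏ i ∈ Finset.Ico a (a + k), g i : Op R) :
      Module.End R (MvPolynomial ℕ R)) := by
  induction k with
  | zero => simp [opProd]
  | succ k ih =>
    rw [opProd, List.range'_1_concat, List.map_append, List.prod_append, ← opProd, ih, ← add_assoc,
      Finset.prod_Ico_succ_top (by omega)]
    simp [h]

theorem strictProd_eq_coe (u v : R) (n : ℕ) :
    strictProd u v n = (opStrictProd u v n : Module.End R (MvPolynomial ℕ R)) := by
  have h : ∀ q, opProd 1 (q - 1) (fun p => strictOp u v q p) =
      ((∏ p ∈ Finset.Ico 1 (1 + (q - 1)), opStrict u v q p : Op R) :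
        Module.End R (MvPolynomial ℕ R)) := fun q => opProd_eq_coe fun p => rfl
  rw [strictProd, opProd_eq_coe h, Finset.prod_sigma', opStrictProd]
  congr 1
  refine Finset.prod_bij' (fun x _ => (x.2, x.1)) (fun x _ => ⟨x.2, x.1⟩) ?_ ?_ ?_ ?_ ?_
  · rintro ⟨q, p⟩ hx
    simp only [Finset.mem_sigma, Finset.mem_Ico] at hx
    rw [mem_pairs]
    dsimp only
    omega
  · rintro ⟨p, q⟩ hx
    rw [mem_pairs] at hx
    simp only [Finset.mem_sigma, Finset.mem_Ico]
    dsimp only at hx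
    omega
  all_goals
    rintro ⟨_, _⟩ _
    rfl

theorem truncOp_eq_coe (u v : R) (n l r : ℕ) (s t : ℕ → ℕ) : truncOp u v n l r s t =
    (((∏ i ∈ Finset.Ico 1 (1 + l), (-(opPinv v i * fwd i)) ^ s i) *
      ∏ j ∈ Finset.Ico (n - r + 1) (n - r + 1 + r), (opQinv u j * bwd j) ^ t j : Op R) :
        Module.End R (MvPolynomial ℕ R)) := by
  have h1 : ∀ i, (-vFwdDiff v i) ^ s i =
      (((-(opPinv v i * fwd i)) ^ s i : Op R) : Module.End R (MvPolynomial ℕ R)) := fun i => rfl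
  have h2 : ∀ j, uBwdDiff u j ^ t j =
      (((opQinv u j * bwd j) ^ t j : Op R) : Module.End R (MvPolynomial ℕ R)) := fun j => rfl
  rw [truncOp, opProd_eq_coe h1, opProd_eq_coe h2]
  rfl

open Classical in
theorem excOp_eq_coe (u v : R) (n : ℕ) (I J : Finset ℕ) : excOp u v n I J =
    (((∏ i ∈ Finset.Ico 1 (1 + n), if i ∈ I then opPinv v i else 1) *
      ∏ j ∈ Finset.Ico 1 (1 + n), if j ∈ J then opQinv u j else 1 : Op R) :
        Module.End R (MvPolynomial ℕ R)) := by
  rw [excOp, opProd_eq_coe (g := fun i => if i ∈ I then opPinv v i else 1) fun i => ?_,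
    opProd_eq_coe (g := fun j => if j ∈ J then opQinv u j else 1) fun j => ?_]
  · rfl
  · split_ifs <;> rfl
  · split_ifs <;> rfl

namespace Valid

variable {n l r : ℕ} {s t : ℕ → ℕ} {I J : Finset ℕ}

/-- Double counting of deleted cells: diagonal j is deleted in the rows i with n - s_j < i ≤ n,
which are s_j in number since s_j < n. -/
theorem prod_left_eq {A : Type*} [CommMonoid A] (h : Valid n l r s t I J) (g : ℕ → A) :
    ∏ i ∈ Finset.Icc 1 n, ∏ j ∈ Finset.Ico 1 (leftDel n l s i + 1), g j =
      ∏ j ∈ Finset.Ico 1 (1 + l), g j ^ s j := by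
  have hlr := h.add_le
  rw [Finset.prod_comm' (t' := Finset.Ico 1 (1 + l))
    (s' := fun j => Finset.Ioc (n - truncNE l s j) n)]
  · refine Finset.prod_congr rfl fun j hj => ?_
    have hj := Finset.mem_Ico.1 hj
    have hm := (h.endNE_mem (k := j) hj.1 (by omega)).1
    rw [Finset.prod_const, Nat.card_Ioc]
    rw [truncNE, if_pos (by omega)] at hm ⊢
    congr 1
    omega
  · intro i j
    simp only [Finset.mem_Icc, Finset.mem_Ico, Finset.mem_Ioc]
    constructor
    · rintro ⟨⟨h1, h2⟩, h3, h4⟩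
      have := (h.le_leftDel_iff h2 h3).1 (by omega)
      have := leftDel_le n l s i
      omega
    · rintro ⟨⟨h1, h2⟩, h3, h4⟩
      have := (h.le_leftDel_iff (i := i) h2 h3).2 (by omega)
      have hm := (h.endNE_mem (k := j) h3 (by omega)).1
      omega

theorem prod_right_eq {A : Type*} [CommMonoid A] (h : Valid n l r s t I J) (g : ℕ → A) :
    ∏ i ∈ Finset.Icc 1 n, ∏ j ∈ Finset.Ioc (n - rightDel n r t i) n, g j =
      ∏ j ∈ Finset.Ico (n - r + 1) (n - r + 1 + r), g j ^ t j := by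
  have hlr := h.add_le
  rw [Finset.prod_comm' (t' := Finset.Ico (n - r + 1) (n - r + 1 + r))
    (s' := fun j => Finset.Ioc (n - truncSE n r t j) n)]
  · refine Finset.prod_congr rfl fun j hj => ?_
    have hj := Finset.mem_Ico.1 hj
    have hm := (h.endSE_mem (k := j) (by omega) (by omega)).1
    rw [Finset.prod_const, Nat.card_Ioc]
    rw [truncSE, if_pos (by omega)] at hm ⊢
    congr 1
    omega
  · intro i j
    simp only [Finset.mem_Icc, Finset.mem_Ico, Finset.mem_Ioc]
    constructor
    · rintro ⟨⟨h1, h2⟩, h3, h4⟩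
      have := (h.lt_add_rightDel_iff h2 h4).1 (by omega)
      have := rightDel_le n r t i
      omega
    · rintro ⟨⟨h1, h2⟩, h3, h4⟩
      have := (h.lt_add_rightDel_iff (i := i) h2 (show j ≤ n by omega)).2 (by omega)
      have hm := (h.endSE_mem (k := j) (by omega) (by omega)).1
      omega

open Classical in
-- An exceptional diagonal k corresponds to the one row n - s_k (n if k > l) in which it ends, and
-- there k is the leftmost remaining diagonal.
theorem prod_excNE_eq {A : Type*} [CommMonoid A] (h : Valid n l r s t I J) (g : ℕ → A) :
    (∏ i ∈ Finset.Icc 1 n,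
      if (rowData n l r s t I J).exL i then g (leftDel n l s i + 1) else 1) =
      ∏ i ∈ Finset.Ico 1 (1 + n), if i ∈ I then g i else 1 := by
  rw [← Finset.prod_filter, ← Finset.prod_filter]
  have hm := fun k (hk : k ∈ I) => h.bottomNE_mem hk
  refine Finset.prod_bij' (fun i _ => leftDel n l s i + 1) (fun k _ => n - truncNE l s k)
    (fun i hi => ?_) (fun k hk => ?_) (fun i hi => ?_) (fun k hk => ?_) (fun i hi => rfl)
  · obtain ⟨hi, hex⟩ := Finset.mem_filter.1 hi
    have hi := Finset.mem_Icc.1 hi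
    have := h.leftDel_add_rightDel_lt hi.1 hi.2
    exact Finset.mem_filter.2 ⟨Finset.mem_Ico.2 ⟨by omega, by omega⟩, hex.1⟩
  · have hk := (Finset.mem_filter.1 hk).2
    have h1 := (hm k hk).1
    have := h.leftDel_of_mem_I hk (i := n - truncNE l s k) (by omega)
    refine Finset.mem_filter.2 ⟨Finset.mem_Icc.2 ⟨h1, by omega⟩, ?_, ?_⟩ <;> rw [this]
    · exact hk
    · omega
  · have := (Finset.mem_filter.1 hi).2.2
    omega
  · have hk := (Finset.mem_filter.1 hk).2
    have h1 := (hm k hk).1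
    exact h.leftDel_of_mem_I hk (by omega)

open Classical in
theorem prod_excSE_eq {A : Type*} [CommMonoid A] (h : Valid n l r s t I J) (g : ℕ → A) :
    (∏ i ∈ Finset.Icc 1 n,
      if (rowData n l r s t I J).exR i then g (n - rightDel n r t i) else 1) =
      ∏ i ∈ Finset.Ico 1 (1 + n), if i ∈ J then g i else 1 := by
  rw [← Finset.prod_filter, ← Finset.prod_filter]
  have hm := fun k (hk : k ∈ J) => h.bottomSE_mem hk
  refine Finset.prod_bij' (fun i _ => n - rightDel n r t i) (fun k _ => n - truncSE n r t k)
    (fun i hi => ?_) (fun k hk => ?_) (fun i hi => ?_) (fun k hk => ?_) (fun i hi => rfl)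
  · obtain ⟨hi, hex⟩ := Finset.mem_filter.1 hi
    have hi := Finset.mem_Icc.1 hi
    have := h.leftDel_add_rightDel_lt hi.1 hi.2
    exact Finset.mem_filter.2 ⟨Finset.mem_Ico.2 ⟨by omega, by omega⟩, hex.1⟩
  · have hk := (Finset.mem_filter.1 hk).2
    have h1 := (hm k hk).1
    have := h.rightDel_of_mem_J hk (i := n - truncSE n r t k) (by omega)
    refine Finset.mem_filter.2 ⟨Finset.mem_Icc.2 ⟨h1, by omega⟩, ?_, ?_⟩ <;> rw [this]
    · exact hk
    · omega
  · have := (Finset.mem_filter.1 hi).2.2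
    omega
  · have hk := (Finset.mem_filter.1 hk).2
    have h1 := (hm k hk).1
    exact h.rightDel_of_mem_J hk (by omega)

theorem excOp_truncOp_strictProd [Algebra ℚ R] (h : Valid n l r s t I J) (u v : R) (d : ℕ)
    (mn : ℤ) : excOp u v n I J (truncOp u v n l r s t (strictProd u v n (detD R n d mn))) =
      treePoly (rowData n l r s t I J) u v d mn n := by
  classical
  rw [excOp_eq_coe, truncOp_eq_coe, strictProd_eq_coe, ← op_smul, ← op_smul, ← op_smul, smul_smul,
    smul_smul, treePoly, opL, opR]
  unfold rowOpL rowOpR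
  rw [Finset.prod_mul_distrib, Finset.prod_mul_distrib,
    show ∏ i ∈ Finset.Icc 1 n, ∏ j ∈ Finset.Ico 1 ((rowData n l r s t I J).left i + 1),
      -(opPinv v j * fwd j) = _ from h.prod_left_eq fun j => -(opPinv v j * fwd j),
    show ∏ i ∈ Finset.Icc 1 n, ∏ j ∈ Finset.Ioc (n - (rowData n l r s t I J).right i) n,
      opQinv u j * bwd j = _ from h.prod_right_eq fun j => opQinv u j * bwd j,
    show (∏ i ∈ Finset.Icc 1 n, if (rowData n l r s t I J).exL i then
      opPinv v ((rowData n l r s t I J).left i + 1) else 1) = _ from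
        h.prod_excNE_eq fun j => opPinv v j,
    show (∏ i ∈ Finset.Icc 1 n, if (rowData n l r s t I J).exR i then
      opQinv u (n - (rowData n l r s t I J).right i) else 1) = _ from
        h.prod_excSE_eq fun j => opQinv u j,
    show ∀ a b c d e : Op R, a * b * (c * d) * e = c * a * (d * b) * e from
      fun a b c d e => by ring]

end Valid

end OperatorProducts

/-! ### Fixing the top entry by binomial inversion -/

section TopEntry

/-- By (b choose A)(m choose b) = (m choose A)(m - A choose b - A) the sum becomes an alternating
row sum of Pascal's triangle. Terms with b > m vanish, so any cutoff K ≥ m is allowed. -/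
theorem sum_alternating_choose_mul_choose {m A K : ℕ} (hm : m ≤ K) :
    ∑ b ∈ Finset.range (K + 1), (-1 : ℤ) ^ (A + b) * b.choose A * m.choose b =
      if m = A then 1 else 0 := by
  rcases Nat.lt_or_ge m A with h | h
  · rw [if_neg h.ne]
    refine Finset.sum_eq_zero fun b _ => ?_
    rcases Nat.lt_or_ge b A with hb | hb
    · simp [Nat.choose_eq_zero_of_lt hb]
    · simp [Nat.choose_eq_zero_of_lt (h.trans_le hb)]
  · obtain ⟨e, rfl⟩ : ∃ e, m = A + e := ⟨m - A, by omega⟩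
    obtain ⟨f, rfl⟩ : ∃ f, K = A + e + f := ⟨K - (A + e), by omega⟩
    rw [show A + e + f + 1 = A + ((e + 1) + f) by omega, Finset.sum_range_add, Finset.sum_range_add,
      Finset.sum_eq_zero (s := Finset.range A), Finset.sum_eq_zero (s := Finset.range f), zero_add,
      add_zero]
    · have : ∀ x ∈ Finset.range (e + 1), (-1 : ℤ) ^ (A + (A + x)) * ((A + x).choose A : ℤ) *
          ((A + e).choose (A + x) : ℤ) = (A + e).choose A * ((-1) ^ x * e.choose x) := by
        intro x hx
        have hx := Finset.mem_range.1 hx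
        have hc := Nat.choose_mul (n := A + e) (k := A + x) (s := A) (by omega)
        rw [Nat.add_sub_cancel_left, Nat.add_sub_cancel_left] at hc
        have hc' : ((A + e).choose (A + x) : ℤ) * (A + x).choose A =
          (A + e).choose A * e.choose x := by exact_mod_cast hc
        rw [show A + (A + x) = 2 * A + x by omega, pow_add, pow_mul]
        linear_combination (-1) ^ x * hc'
      rw [Finset.sum_congr rfl this, ← Finset.mul_sum, Int.alternating_sum_range_choose]
      by_cases he : e = 0
      · simp [he]
      · simp [he]
    · intro x _
      rw [Nat.choose_eq_zero_of_lt (show A + e < A + (e + 1 + x) by omega)]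
      simp
    · intro x hx
      rw [Nat.choose_eq_zero_of_lt (Finset.mem_range.1 hx)]
      simp

variable {R : Type*} [CommRing R] [Algebra ℚ R]

theorem topWeight_eq_choose (d : ℕ) {mn x : ℤ} (hx : mn ≤ x) :
    topWeight R d mn x = ((x - mn).toNat.choose d : R) := by
  obtain ⟨m, rfl⟩ : ∃ m : ℕ, x = mn + m := ⟨(x - mn).toNat, by omega⟩
  have h1 : evalAt (fun _ => mn + (m : ℤ)) (binom (shiftedVar R mn 1) d) =
      (d.factorial : ℚ)⁻¹ • ∏ i ∈ Finset.range d, ((m : R) - i) := by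
    rw [binom, evalAt, ← algebraMap_smul R ((d.factorial : ℚ)⁻¹), smul_eval, algebra_compatible_smul R,
      smul_eq_mul, eval_prod]
    congr 1
    refine Finset.prod_congr rfl fun i _ => ?_
    simp [shiftedVar]
  rw [topWeight, h1, ← descPochhammer_eval_eq_prod_range, descPochhammer_eval_eq_descFactorial,
    Nat.descFactorial_eq_factorial_mul_choose, add_sub_cancel_left, Int.toNat_natCast, Nat.cast_mul,
    ← smul_mul_assoc, algebra_compatible_smul R, smul_eq_mul]
  rw [← map_natCast (algebraMap ℚ R) d.factorial, ← map_mul,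
    inv_mul_cancel₀ (by exact_mod_cast d.factorial_ne_zero), map_one, one_mul]

theorem topWeight_zero (mn x : ℤ) : topWeight R 0 mn x = 1 := by
  rw [topWeight, binom_zero]
  exact map_one _

theorem sum_topWeight {a mn mx x : ℤ} (h1 : mn ≤ a) (h2 : mn ≤ x) (h3 : x ≤ mx) :
    ∑ d ∈ Finset.range ((mx - mn).toNat + 1),
      ((((((a + mn + d).negOnePow : ℤˣ) : ℤ) * (d.choose (a - mn).toNat : ℤ) : ℤ)) : R) *
        topWeight R d mn x = if x = a then 1 else 0 := by
  have h := sum_alternating_choose_mul_choose (m := (x - mn).toNat) (A := (a - mn).toNat)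
    (K := (mx - mn).toNat) (by omega)
  have h' := congrArg (Int.cast : ℤ → R) h
  rw [Int.cast_sum] at h'
  have e : (((if (x - mn).toNat = (a - mn).toNat then 1 else 0 : ℤ)) : R) =
      if x = a then 1 else 0 := by
    by_cases hxa : x = a
    · simp [hxa]
    · rw [if_neg hxa, if_neg (by omega), Int.cast_zero]
  rw [← e, ← h']
  refine Finset.sum_congr rfl fun d _ => ?_
  -- The exponents a + min + d and (a - min) + d have the same parity.
  have hs : (((a + mn + d).negOnePow : ℤˣ) : ℤ) = (-1) ^ ((a - mn).toNat + d) := by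
    rw [show a + mn + d = (((a - mn).toNat + d : ℕ) : ℤ) + 2 * mn by push_cast; omega,
      Int.negOnePow_add, Int.negOnePow_two_mul, mul_one, Int.negOnePow_def, zpow_natCast]
    simp
  rw [topWeight_eq_choose d h2, hs]
  push_cast
  ring

theorem GTTop_eq_sum (n : ℕ) (a mn mx : ℤ) : GTTop R n a mn mx =
    ∑ d ∈ Finset.range ((mx - mn).toNat + 1),
      ((((a + mn + d).negOnePow : ℤˣ) : ℤ) * (d.choose (a - mn).toNat : ℤ)) • detD R n d mn := by
  rw [GTTop]
  refine Finset.sum_congr rfl fun d _ => ?_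
  simp only [detD, shiftedVar, Nat.cast_add, Nat.cast_one]

/-- Interlacing keeps the top entry between the outermost bottom values; this puts it in [min, max],
where the truncated inversion is valid. -/
theorem top_mem_of_isRowTree {D : RowData} {N : ℕ} (hN : 1 ≤ N) (hD : D.Admissible N) {z : ℕ → ℤ}
    (hz : ∀ i, 1 ≤ i → i < N → z i ≤ z (i + 1)) {M : ℕ → ℕ → ℤ} (hM : IsRowTree D N z M) :
    z 1 ≤ M 1 1 ∧ M 1 1 ≤ z N := by
  induction N, hN using Nat.le_induction generalizing z M with
  | base =>
    have := hD.lt 1 le_rfl le_rfl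
    rw [hM.bottom 1 ⟨le_rfl, le_rfl, by omega, by omega⟩]
    exact ⟨le_rfl, le_rfl⟩
  | succ N hN ih =>
    obtain ⟨x, hx, M', hM', rfl⟩ := exists_of_isRowTree_succ hN hD hM
    have hb := fun i h1 h2 => box_between hx.1 hz i h1 h2
    rw [addRow_of_ne _ _ _ (by omega)]
    have := ih (hD.mono (by omega)) (fun i h1 h2 =>
      (hb i h1 (by omega)).2.trans (hb (i + 1) (by omega) (by omega)).1) hM'
    exact ⟨(hb 1 le_rfl (by omega)).1.trans this.1, this.2.trans (hb N hN (by omega)).2⟩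

end TopEntry

/-! ### Assembly of the three statements -/

section Main

variable {R : Type*} [CommRing R] {n l r : ℕ} {s t : ℕ → ℕ} {I J : Finset ℕ}

namespace Valid

theorem trees_eq (h : Valid n l r s t I J) (b : ℕ → ℤ) :
    trees n l r s t b = {M | IsRowTree (rowData n l r s t I J) n b M} :=
  Set.ext fun _ => h.isRowTree_iff b

theorem trees_finite (h : Valid n l r s t I J) (b : ℕ → ℤ) : (trees n l r s t b).Finite := by
  rw [h.trees_eq b]
  exact setOf_isRowTree_finite h.one_le h.admissible b

theorem top_mem (h : Valid n l r s t I J) {b : ℕ → ℤ} (hb : MonotoneOn b (Set.Icc 1 n))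
    {M : ℕ → ℕ → ℤ} (hM : M ∈ trees n l r s t b) : b 1 ≤ M 1 1 ∧ M 1 1 ≤ b n :=
  top_mem_of_isRowTree h.one_le h.admissible
    (fun _ h1 h2 => hb ⟨h1, h2.le⟩ ⟨by omega, h2⟩ (by omega)) ((h.isRowTree_iff b).1 hM)

variable [Algebra ℚ R]

/-- The common source of all parts: d = 0 yields the plain count, general d yields the count
weighted by a binomial in the top entry. -/
theorem evalAt_detD (h : Valid n l r s t I J) (u v : R) {b : ℕ → ℤ}
    (hb : StrictMonoOn b (Set.Icc 1 n) ∨ (u = 1 ∧ v = 1 ∧ MonotoneOn b (Set.Icc 1 n))) (d : ℕ)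
    (mn : ℤ) (hI : d = 0 ∨ (1 ∈ I → v = 1 ∨ ¬ IsBottomNE n l r s t 1 1 1))
    (hJ : d = 0 ∨ (n ∈ J → u = 1 ∨ ¬ IsBottomSE n l r s t n 1 1)) :
    evalAt b (excOp u v n I J (truncOp u v n l r s t (strictProd u v n (detD R n d mn)))) =
      ∑ᶠ M ∈ trees n l r s t b,
        u ^ invExc n l r s t J M * v ^ invExc' n l r s t I M * topWeight R d mn (M 1 1) := by
  have h1 := h.one_le
  have hsum : treeSum (rowData n l r s t I J) u v (topWeight R d mn) n b = ∑ᶠ M ∈ trees n l r s t b,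
      u ^ invExc n l r s t J M * v ^ invExc' n l r s t I M * topWeight R d mn (M 1 1) := by
    rw [treeSum_eq_finsum u v _ h1 h.admissible, ← h.trees_eq b]
    exact finsum_mem_congr rfl fun M hM => by rw [h.treeWeight_eq u v hM]
  rw [h.excOp_truncOp_strictProd, ← hsum]
  have h0 := h.leftDel_add_rightDel_lt le_rfl h1
  rcases hb with hb | ⟨rfl, rfl, hb⟩
  · refine evalAt_treePoly_of_strict u v d mn h1 h.admissible ?_ b
      fun i h1 h2 => hb ⟨h1, h2.le⟩ ⟨by omega, h2⟩ (by omega)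
    rcases hI with hd | hI
    · exact Or.inl hd
    rcases hJ with hd | hJ
    · exact Or.inl hd
    refine Or.inr ⟨fun hex => ?_, fun hex => ?_⟩
    · obtain ⟨h2, h3⟩ := hex
      rw [show leftDel n l s 1 = 0 by omega, zero_add] at h2 h3
      exact (hI h2).resolve_right (not_not.2
        ((h.isBottomNE_iff le_rfl (h.bottomNE_mem h2)).2 ⟨rfl, h3⟩))
    · obtain ⟨h2, h3⟩ := hex
      rw [show rightDel n r t 1 = 0 by omega, Nat.sub_zero] at h2 h3
      exact (hJ h2).resolve_right (not_not.2
        ((h.isBottomSE_iff le_rfl (h.bottomSE_mem h2)).2 ⟨rfl, h3⟩))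
  · exact evalAt_treePoly_of_weak d mn h1 h.admissible b
      fun i h1 h2 => hb ⟨h1, h2.le⟩ ⟨by omega, h2⟩ (by omega)

theorem evalAt_MPoly (h : Valid n l r s t I J) (u v : R) {b : ℕ → ℤ}
    (hb : StrictMonoOn b (Set.Icc 1 n) ∨ (u = 1 ∧ v = 1 ∧ MonotoneOn b (Set.Icc 1 n))) :
    evalAt b (excOp u v n I J (truncOp u v n l r s t (MPoly u v n))) =
      ∑ᶠ M ∈ trees n l r s t b, u ^ invExc n l r s t J M * v ^ invExc' n l r s t I M := by
  rw [MPoly, GT_eq_detD n 0, h.evalAt_detD u v hb 0 0 (Or.inl rfl) (Or.inl rfl)]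
  simp only [topWeight_zero, mul_one]

theorem evalAt_MTopPoly (h : Valid n l r s t I J) (u v : R) {b : ℕ → ℤ}
    (hb : StrictMonoOn b (Set.Icc 1 n) ∨ (u = 1 ∧ v = 1 ∧ MonotoneOn b (Set.Icc 1 n)))
    {a mn mx : ℤ} (ha : mn ≤ a) (hmn : mn ≤ b 1) (hmx : b n ≤ mx)
    (hI : 1 ∈ I → v = 1 ∨ ¬ IsBottomNE n l r s t 1 1 1)
    (hJ : n ∈ J → u = 1 ∨ ¬ IsBottomSE n l r s t n 1 1) :
    evalAt b (excOp u v n I J (truncOp u v n l r s t (MTopPoly u v n a mn mx))) =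
      ∑ᶠ M ∈ {M ∈ trees n l r s t b | M 1 1 = a},
        u ^ invExc n l r s t J M * v ^ invExc' n l r s t I M := by
  classical
  have hmono : MonotoneOn b (Set.Icc 1 n) := by
    rcases hb with hb | ⟨-, -, hb⟩
    · exact hb.monotoneOn
    · exact hb
  have hfin := h.trees_finite b
  have hfin' : {M ∈ trees n l r s t b | M 1 1 = a}.Finite := hfin.subset fun _ hM => hM.1
  have heval : ∀ (c : ℤ) (p : MvPolynomial ℕ R), evalAt b (c • p) = c * evalAt b p := fun c p => by
    rw [evalAt, map_zsmul, zsmul_eq_mul, evalAt]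
  have hsum : ∀ (S : Finset ℕ) (p : ℕ → MvPolynomial ℕ R),
      evalAt b (∑ d ∈ S, p d) = ∑ d ∈ S, evalAt b (p d) := fun S p => map_sum _ _ _
  rw [MTopPoly, GTTop_eq_sum]
  simp only [map_sum, map_zsmul]
  rw [hsum]
  simp only [heval]
  have hterm : ∀ d : ℕ, evalAt b (excOp u v n I J
      (truncOp u v n l r s t (strictProd u v n (detD R n d mn)))) = ∑ M ∈ hfin.toFinset,
        u ^ invExc n l r s t J M * v ^ invExc' n l r s t I M * topWeight R d mn (M 1 1) := fun d => by
    rw [h.evalAt_detD u v hb d mn (Or.inr hI) (Or.inr hJ), finsum_mem_eq_finite_toFinset_sum _ hfin]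
  simp only [hterm, Finset.mul_sum]
  rw [Finset.sum_comm, finsum_mem_eq_finite_toFinset_sum _ hfin',
    show hfin'.toFinset = hfin.toFinset.filter (fun M => M 1 1 = a) by ext M; simp,
    Finset.sum_filter]
  refine Finset.sum_congr rfl fun M hM => ?_
  have htop := h.top_mem hmono ((Set.Finite.mem_toFinset _).1 hM)
  have key := sum_topWeight (R := R) ha (hmn.trans htop.1) (htop.2.trans hmx)
  rw [show (if M 1 1 = a then u ^ invExc n l r s t J M * v ^ invExc' n l r s t I M else 0) =
      u ^ invExc n l r s t J M * v ^ invExc' n l r s t I M * if M 1 1 = a then 1 else 0 by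
    rw [mul_ite, mul_one, mul_zero], ← key, Finset.mul_sum]
  exact Finset.sum_congr rfl fun d _ => mul_left_comm _ _ _

end Valid

theorem invExc_empty (n l r : ℕ) (s t : ℕ → ℕ) (M : ℕ → ℕ → ℤ) :
    invExc n l r s t ∅ M = inv n l r s t M := by
  rw [invExc, inv]
  exact congrArg Finset.card (Finset.ext fun p => by simp)

theorem invExc'_empty (n l r : ℕ) (s t : ℕ → ℕ) (M : ℕ → ℕ → ℤ) :
    invExc' n l r s t ∅ M = inv' n l r s t M := by
  rw [invExc', inv']
  exact congrArg Finset.card (Finset.ext fun p => by simp)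

theorem excOp_empty (u v : R) (n : ℕ) : excOp u v n ∅ ∅ = 1 := by
  simp [excOp, opProd, List.prod_eq_one]

theorem trees_zero (l r : ℕ) (s t : ℕ → ℕ) (b : ℕ → ℤ) : trees 0 l r s t b = {0} := by
  have hs : ∀ p, p ∉ shape 0 l r s t := fun p => by simp [shape]
  ext M
  rw [Set.mem_singleton_iff]
  constructor
  · rintro ⟨hM, -⟩
    funext i j
    exact hM.eq_zero i j (hs _)
  · rintro rfl
    exact ⟨⟨fun _ _ _ => rfl, fun _ _ h => absurd h.1 (hs _), fun _ _ h => absurd h.1 (hs _),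
      fun _ _ h => absurd h.1 (hs _)⟩, fun _ _ _ _ _ h => absurd h.1 (hs _),
      fun _ _ _ _ _ h => absurd h.1 (hs _)⟩

/-- The row induction starts at one row, so the empty triangle is checked directly: both sides are
1. -/
theorem evalAt_MPoly_zero [Algebra ℚ R] (u v : R) (s t : ℕ → ℕ) (b : ℕ → ℤ) (I J : Finset ℕ) :
    evalAt b (excOp u v 0 I J (truncOp u v 0 0 0 s t (MPoly u v 0))) =
      ∑ᶠ M ∈ trees 0 0 0 s t b, u ^ invExc 0 0 0 s t J M * v ^ invExc' 0 0 0 s t I M := by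
  rw [trees_zero, finsum_mem_singleton]
  simp [excOp, truncOp, MPoly, strictProd, opProd, GT, invExc, invExc', shape, evalAt]

theorem isExcNE_empty (l : ℕ) (s : ℕ → ℕ) : IsExcNE l s ∅ := by simp [IsExcNE]

theorem isExcSE_empty (n r : ℕ) (t : ℕ → ℕ) : IsExcSE n r t ∅ := by simp [IsExcSE]

end Main

end STTrees

theorem mainTheorem3 {R : Type*} [CommRing R] [Algebra ℚ R] (u v : R)
    (n l r : ℕ) (hlr : l + r ≤ n) (s t : ℕ → ℕ)
    (hs : AntitoneOn s (Set.Icc 1 l)) (ht : MonotoneOn t (Set.Icc (n - r + 1) n))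
    (hst : STTrees.NoInterference n l r s t)
    (b : ℕ → ℤ)
    (hb : StrictMonoOn b (Set.Icc 1 n) ∨ (u = 1 ∧ v = 1 ∧ MonotoneOn b (Set.Icc 1 n))) :
    (STTrees.trees n l r s t b).Finite ∧
    STTrees.evalAt b (STTrees.truncOp u v n l r s t (STTrees.MPoly u v n)) =
      ∑ᶠ M ∈ STTrees.trees n l r s t b,
        u ^ STTrees.inv n l r s t M * v ^ STTrees.inv' n l r s t M ∧
    (∀ I J : Finset ℕ, STTrees.IsExcNE l s I → STTrees.IsExcSE n r t J →
      STTrees.evalAt b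
          (STTrees.excOp u v n I J (STTrees.truncOp u v n l r s t (STTrees.MPoly u v n))) =
        ∑ᶠ M ∈ STTrees.trees n l r s t b,
          u ^ STTrees.invExc n l r s t J M * v ^ STTrees.invExc' n l r s t I M) ∧
    (∀ a mn mx : ℤ, 1 ≤ n → mn ≤ a → a ≤ mx → mn ≤ b 1 → b n ≤ mx →
      STTrees.evalAt b (STTrees.truncOp u v n l r s t (STTrees.MTopPoly u v n a mn mx)) =
        ∑ᶠ M ∈ {M ∈ STTrees.trees n l r s t b | M 1 1 = a},
          u ^ STTrees.inv n l r s t M * v ^ STTrees.inv' n l r s t M ∧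
      (∀ I J : Finset ℕ, STTrees.IsExcNE l s I → STTrees.IsExcSE n r t J →
        (1 ∈ I → v = 1 ∨ ¬ STTrees.IsBottomNE n l r s t 1 1 1) →
        (n ∈ J → u = 1 ∨ ¬ STTrees.IsBottomSE n l r s t n 1 1) →
        STTrees.evalAt b
            (STTrees.excOp u v n I J
              (STTrees.truncOp u v n l r s t (STTrees.MTopPoly u v n a mn mx))) =
          ∑ᶠ M ∈ {M ∈ STTrees.trees n l r s t b | M 1 1 = a},
            u ^ STTrees.invExc n l r s t J M * v ^ STTrees.invExc' n l r s t I M)) := by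
  open STTrees in
  have valid : ∀ I J : Finset ℕ, 1 ≤ n → IsExcNE l s I → IsExcSE n r t J → Valid n l r s t I J :=
    fun I J hn hI hJ => ⟨hn, hlr, hs, ht, hst, hI, hJ⟩
  have part2 : ∀ I J : Finset ℕ, IsExcNE l s I → IsExcSE n r t J →
      evalAt b (excOp u v n I J (truncOp u v n l r s t (MPoly u v n))) =
        ∑ᶠ M ∈ trees n l r s t b, u ^ invExc n l r s t J M * v ^ invExc' n l r s t I M := by
    intro I J hI hJ
    rcases Nat.eq_zero_or_pos n with rfl | hn
    · obtain ⟨rfl, rfl⟩ : l = 0 ∧ r = 0 := by omega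
      exact evalAt_MPoly_zero u v s t b I J
    · exact (valid I J hn hI hJ).evalAt_MPoly u v hb
  have hI0 := isExcNE_empty l s
  have hJ0 := isExcSE_empty n r t
  refine ⟨?_, ?_, part2, fun a mn mx hn ha _ hmn hmx => ⟨?_, fun I J hI hJ h1 h2 =>
    (valid I J hn hI hJ).evalAt_MTopPoly u v hb ha hmn hmx h1 h2⟩⟩
  · rcases Nat.eq_zero_or_pos n with rfl | hn
    · rw [trees_zero]
      exact Set.finite_singleton _
    · exact (valid ∅ ∅ hn hI0 hJ0).trees_finite b
  -- Without exceptional diagonals the additional operator is the identity and the restricted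
  -- statistics are the full ones.
  · have h := part2 ∅ ∅ hI0 hJ0
    simpa only [excOp_empty, Module.End.one_apply, invExc_empty, invExc'_empty] using h
  · have h := (valid ∅ ∅ hn hI0 hJ0).evalAt_MTopPoly u v hb ha hmn hmx (by simp) (by simp)
    simpa only [excOp_empty, Module.End.one_apply, invExc_empty, invExc'_empty] using h
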